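/- Consider programs over $N$ variables given as duplicate-free lists of statements, each of one of the four types $a=\&b$ (address-of), $a=b$, $a=*b$, $*a=b$. Inclusion-based (Andersen-style) points-to analysis assigns to the variables the least sets $\mathrm{pt}(\cdot)$ satisfying, respectively, $b\in \mathrm{pt}(a)$; $\mathrm{pt}(b)\subseteq \mathrm{pt}(a)$; $\mathrm{pt}(v)\subseteq \mathrm{pt}(a)$ for all $v\in \mathrm{pt}(b)$; $\mathrm{pt}(b)\subseteq \mathrm{pt}(v)$ for all $v\in \mathrm{pt}(a)$. The demand-driven (single-query) problem is: given a program and two variables $p,q$, decide whether $q\in \mathrm{pt}(p)$. Let $T$ be any set of statement types that contains address-of and at least one of the two dereferencing types $a=*b$, $*a=b$. Then the demand-driven problem, for programs in which exactly the statement types in $T$ occur, is hard for Boolean matrix multiplication under combinatorial subcubic reductions, on a word RAM with words of $O(\log n)$ bits, in the following sense. There are a fixed procedure $R$ (depending only on $T$) and constants $c,e$ such that for every $\delta>0$ there is $\delta'>0$ for which the following holds. If $Q$ is any algorithm that solves the demand-driven problem in time $O(N^{3-\delta})$, where $N$ is the number of variables, then $R$, calling $Q$ as a subroutine (black box, with inputs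 passed as a concatenation of memory segments by reference), computes the product of any two $n\times n$ Boolean matrices ($n\ge 1$) in total time $O(n^{3-\delta'})$, the steps made by $Q$ included, and the steps that $R$ makes itself, apart from those of $Q$, number at most $c\,n^2(\log_2 n+1)^e$ (with $\log_2 n$ rounded down). In particular, a truly subcubic combinatorial algorithm for demand-driven inclusion-based points-to analysis with pointer dereferences yields a truly subcubic combinatorial algorithm for Boolean matrix multiplication. -/

import Mathlib

namespace DemandPT

/-! ### Programs and inclusion-based points-to analysis -/

/-- The four normalized statement types:
`a = &b` (`addr`), `a = b` (`copy`), `a = *b` (`load`), `*a = b` (`store`). -/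
inductive Kind
  | addr
  | copy
  | load
  | store
  deriving DecidableEq

/-- A normalized statement over the variables `0, …, N - 1`;
`lhs` is the variable `a` and `rhs` the variable `b` in the forms above. -/
structure Stmt (N : ℕ) where
  kind : Kind
  lhs : Fin N
  rhs : Fin N
  deriving DecidableEq

/-- A normalized (flow-insensitive) program with `N` variables: a duplicate-free list of
statements. The order of the statements is irrelevant for the analysis. -/
structure Program (N : ℕ) where
  stmts : List (Stmt N)
  nodup : stmts.Nodup

/-- The set of statement types that occur in a program. -/
def Program.kinds {N : ℕ} (P : Program N) : Set Kind :=
  {κ | ∃ st ∈ P.stmts, st.kind = κ}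

/-- The inclusion constraint that a statement imposes on an assignment `S` of points-to sets. -/
def Stmt.Holds {N : ℕ} (st : Stmt N) (S : Fin N → Set (Fin N)) : Prop :=
  match st.kind with
  | Kind.addr => st.rhs ∈ S st.lhs
  | Kind.copy => S st.rhs ⊆ S st.lhs
  | Kind.load => ∀ v ∈ S st.rhs, S v ⊆ S st.lhs
  | Kind.store => ∀ v ∈ S st.lhs, S st.rhs ⊆ S v

/-- `S` solves all inclusion constraints of the program. -/
def Program.IsSolution {N : ℕ} (P : Program N) (S : Fin N → Set (Fin N)) : Prop :=
  ∀ st ∈ P.stmts, st.Holds S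

/-- The points-to sets computed by the inclusion-based analysis:
the least solution of the inclusion constraints. -/
def Program.pt {N : ℕ} (P : Program N) (p : Fin N) : Set (Fin N) :=
  {q | ∀ S : Fin N → Set (Fin N), P.IsSolution S → q ∈ S p}

/-- The sets `pt` do solve the constraints, so that they are the least solution. -/
theorem Program.isSolution_pt {N : ℕ} (P : Program N) : P.IsSolution P.pt := by
  rintro ⟨κ, a, b⟩ hst
  cases κ with
  | addr => exact fun S hS => hS _ hst
  | copy => exact fun x hx S hS => hS _ hst (hx S hS)
  | load => exact fun v hv x hx S hS => hS _ hst v (hv S hS) (hx S hS)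
  | store => exact fun v hv x hx S hS => hS _ hst v (hv S hS) (hx S hS)

/-! ### A word RAM with procedure calls -/

/-- The arithmetic and bitwise operations on words. -/
inductive BinOp
  | add
  | sub
  | mul
  | div
  | mod
  | and
  | or
  | xor
  | shl
  | shr
  | lt
  | eq

/-- The value of an operation (subtraction truncates at `0`; comparisons return `0` or `1`). -/
def BinOp.eval : BinOp → ℕ → ℕ → ℕ
  | BinOp.add, x, y => x + y
  | BinOp.sub, x, y => x - y
  | BinOp.mul, x, y => x * y
  | BinOp.div, x, y => x / y
  | BinOp.mod, x, y => x % y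
  | BinOp.and, x, y => x &&& y
  | BinOp.or, x, y => x ||| y
  | BinOp.xor, x, y => x ^^^ y
  | BinOp.shl, x, y => x <<< y
  | BinOp.shr, x, y => x >>> y
  | BinOp.lt, x, y => if x < y then 1 else 0
  | BinOp.eq, x, y => if x = y then 1 else 0

/-- Expressions: constants, registers, indirect memory reads, operations. -/
inductive Expr
  | const (c : ℕ)
  | reg (r : ℕ)
  | read (a : Expr)
  | bin (op : BinOp) (x y : Expr)

/-- Structured RAM code. `cond` and `loop` test an expression for being nonzero.
`call dst segs` passes to the procedure below the input that is the concatenation of the memory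
segments in `segs`, each given by its start address and its length, and puts the result
into register `dst`. -/
inductive Cmd
  | skip
  | assign (dst : ℕ) (e : Expr)
  | write (a e : Expr)
  | seq (c d : Cmd)
  | cond (e : Expr) (c d : Cmd)
  | loop (e : Expr) (c : Cmd)
  | call (dst : ℕ) (segs : List (Expr × Expr))

/-- The state of the machine: registers and memory. -/
structure State where
  reg : ℕ → ℕ
  mem : ℕ → ℕ

/-- The value of an expression on a machine whose words are the numbers below `W`;
there is none if some intermediate value does not fit into a word. -/
def Expr.eval (W : ℕ) (s : State) : Expr → Option ℕ
  | Expr.const c => if c < W then some c else none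
  | Expr.reg r => if s.reg r < W then some (s.reg r) else none
  | Expr.read a => (a.eval W s).bind fun x => if s.mem x < W then some (s.mem x) else none
  | Expr.bin op x y => (x.eval W s).bind fun a => (y.eval W s).bind fun b =>
      if op.eval a b < W then some (op.eval a b) else none

/-- The concatenation of the memory segments described by a list of (start, length) pairs. -/
def readSegs (W : ℕ) (s : State) : List (Expr × Expr) → Option (List ℕ)
  | [] => some []
  | (a, l) :: segs => (a.eval W s).bind fun x => (l.eval W s).bind fun m =>
      if x + m ≤ W then
        (readSegs W s segs).map fun rest => (List.range m).map (fun i => s.mem (x + i)) ++ rest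
      else none

/-- `Exec W proc c s s' t u`: on words below `W`, the code `c` started in state `s` halts in
state `s'` after `t` steps of its own, the procedure calls having taken `u` further steps
altogether. `proc x y v` means that the procedure, on input `x`, returns `y` within `v` steps.
Every elementary command, every test and every call costs one step of its own (the expressions
in a fixed piece of code have fixed size); segments are passed by reference. -/
inductive Exec (W : ℕ) (proc : List ℕ → ℕ → ℕ → Prop) :
    Cmd → State → State → ℕ → ℕ → Prop
  | skip (s : State) : Exec W proc Cmd.skip s s 1 0
  | assign (s : State) (r : ℕ) (e : Expr) (x : ℕ) (hx : e.eval W s = some x) :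
      Exec W proc (Cmd.assign r e) s ⟨Function.update s.reg r x, s.mem⟩ 1 0
  | write (s : State) (a e : Expr) (i x : ℕ) (hi : a.eval W s = some i)
      (hx : e.eval W s = some x) :
      Exec W proc (Cmd.write a e) s ⟨s.reg, Function.update s.mem i x⟩ 1 0
  | seq (c d : Cmd) (s₁ s₂ s₃ : State) (t₁ t₂ u₁ u₂ : ℕ)
      (h₁ : Exec W proc c s₁ s₂ t₁ u₁) (h₂ : Exec W proc d s₂ s₃ t₂ u₂) :
      Exec W proc (Cmd.seq c d) s₁ s₃ (t₁ + t₂) (u₁ + u₂)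
  | cond_true (e : Expr) (c d : Cmd) (s s' : State) (x t u : ℕ)
      (hx : e.eval W s = some x) (h0 : x ≠ 0) (h : Exec W proc c s s' t u) :
      Exec W proc (Cmd.cond e c d) s s' (t + 1) u
  | cond_false (e : Expr) (c d : Cmd) (s s' : State) (t u : ℕ)
      (hx : e.eval W s = some 0) (h : Exec W proc d s s' t u) :
      Exec W proc (Cmd.cond e c d) s s' (t + 1) u
  | loop_stop (e : Expr) (c : Cmd) (s : State) (hx : e.eval W s = some 0) :
      Exec W proc (Cmd.loop e c) s s 1 0
  | loop_step (e : Expr) (c : Cmd) (s₁ s₂ s₃ : State) (x t₁ t₂ u₁ u₂ : ℕ)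
      (hx : e.eval W s₁ = some x) (h0 : x ≠ 0) (h₁ : Exec W proc c s₁ s₂ t₁ u₁)
      (h₂ : Exec W proc (Cmd.loop e c) s₂ s₃ t₂ u₂) :
      Exec W proc (Cmd.loop e c) s₁ s₃ (t₁ + t₂ + 1) (u₁ + u₂)
  | call (s : State) (r : ℕ) (segs : List (Expr × Expr)) (input : List ℕ) (y v : ℕ)
      (hin : readSegs W s segs = some input) (hcall : proc input y v) :
      Exec W proc (Cmd.call r segs) s ⟨Function.update s.reg r y, s.mem⟩ 1 v

/-- The initial state: the input stands in memory from address `0` on, its length in register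
`0`, and everything else is `0`. -/
def initState (input : List ℕ) : State where
  reg := fun r => if r = 0 then input.length else 0
  mem := fun a => input.getD a 0

/-- An algorithm: a stack of procedures, each of which may call the one that follows it. -/
abbrev Algorithm := List Cmd

/-- `Runs Q W input s t u`: with words below `W`, the algorithm `Q` halts on `input` in state `s`,
its first procedure having made `t` steps and the calls to the remaining ones `u` steps
altogether. A called procedure works in a memory of its own and returns the content of its
register `0`; the call takes all the steps of the called procedure, including those of the calls
that it makes in turn. -/
def Runs : Algorithm → ℕ → List ℕ → State → ℕ → ℕ → Prop
  | [], _, _, _, _, _ => False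
  | c :: Q, W, input, s, t, u =>
      Exec W (fun x y v => ∃ s' t' u', Runs Q W x s' t' u' ∧ s'.reg 0 = y ∧ v = t' + u')
        c (initState input) s t u

/-! ### The two problems -/

/-- Numerical codes of the statement types. -/
def Kind.code : Kind → ℕ
  | Kind.addr => 0
  | Kind.copy => 1
  | Kind.load => 2
  | Kind.store => 3

/-- A single query "does `p` point to `q`?" as an input of the machine: the number of variables,
`p`, `q`, and then three words for each statement. -/
def encodeQuery {N : ℕ} (P : Program N) (p q : Fin N) : List ℕ :=
  N :: (p : ℕ) :: (q : ℕ) ::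
    P.stmts.flatMap fun st => [st.kind.code, (st.lhs : ℕ), (st.rhs : ℕ)]

/-- `Q` solves demand-driven inclusion-based points-to analysis, for programs in which exactly the
statement types in `T` occur, in time `O(N ^ (3 - δ))` on words of `O(log N)` bits, where `N` is
the number of variables: given a program and two variables `p`, `q`, it decides whether `q` is in
the points-to set of `p`. -/
def SolvesDemand (T : Set Kind) (Q : Algorithm) (δ : ℝ) : Prop :=
  ∃ (K : ℝ) (k : ℕ), ∀ (N : ℕ) (P : Program N), P.kinds = T → ∀ p q : Fin N,
    ∃ (s : State) (t u : ℕ),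
      Runs Q ((N + 2) ^ k) (encodeQuery P p q) s t u ∧
      (q ∈ P.pt p → s.reg 0 = 1) ∧ (q ∉ P.pt p → s.reg 0 = 0) ∧
      ((t + u : ℕ) : ℝ) ≤ K * (N : ℝ) ^ (3 - δ)

/-- The Boolean product of two Boolean matrices. -/
def boolMul {n : ℕ} (A B : Matrix (Fin n) (Fin n) Bool) : Matrix (Fin n) (Fin n) Bool :=
  fun i j => decide (∃ k, A i k = true ∧ B k j = true)

/-- The entries of a Boolean matrix in row-major order. -/
def entries {n : ℕ} (A : Matrix (Fin n) (Fin n) Bool) : List ℕ :=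
  (List.finRange n).flatMap fun i => (List.finRange n).map fun j => (A i j).toNat

/-- Two Boolean matrices as an input of the machine. -/
def encodeMatrices {n : ℕ} (A B : Matrix (Fin n) (Fin n) Bool) : List ℕ :=
  n :: (entries A ++ entries B)

/-- `M` multiplies `n × n` Boolean matrices in total time `O(n ^ (3 - δ))` on words of
`O(log n)` bits, and its first procedure by itself, without the calls that it makes, takes at most
`c * n ^ 2 * (log₂ n + 1) ^ e` steps. The product is left in memory in row-major order, starting
from the address in register `0`. -/
def MultipliesMatrices (M : Algorithm) (c e : ℕ) (δ : ℝ) : Prop :=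
  ∃ (C : ℝ) (k : ℕ), ∀ n : ℕ, 0 < n → ∀ A B : Matrix (Fin n) (Fin n) Bool,
    ∃ (s : State) (t u : ℕ),
      Runs M ((n + 2) ^ k) (encodeMatrices A B) s t u ∧
      (∀ i j : Fin n, s.mem (s.reg 0 + (i : ℕ) * n + (j : ℕ)) = (boolMul A B i j).toNat) ∧
      t ≤ c * n ^ 2 * (Nat.log 2 n + 1) ^ e ∧
      ((t + u : ℕ) : ℝ) ≤ C * (n : ℝ) ^ (3 - δ)

end DemandPT

/-! Matrix multiplication is reduced to triangle detection by the method of Vassilevska Williams and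
Williams, and triangle detection to a single points-to query on `O(s)` variables.

Let `s` be the integer cube root of `n`. The index range is cut into `t = n / s + 1` intervals of
length `s`, so that there are `t ^ 3 = O(n ^ 2)` triples `(I, K, J)` of intervals. A third matrix
`υ`, at first full of ones, records the pairs `(j, i)` for which no witness is known. For each
triple the procedure is asked whether there are `i`, `k`, `j` with `A i k`, `B k j` and `υ (j, i)`.
If so, binary search on the range of admitted `υ`-entries isolates one pair that lies on a triangle;
its entry in the product is `1`, and it is deleted from `υ`. In the end no triangle is left, so the
deleted pairs are the ones of the product (`triples_spec`, `reduction_spec`). Each deletion is paid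
for by one of the `O(n ^ 2)` entries of `υ`, which gives `O(n ^ 2 log n)` queries in all. A query
costs `O(s ^ (3 - δ)) = O(n ^ (1 - δ / 3))`, and the logarithm is absorbed into a small power of `n`
(`total_time_le`).

The reduction itself can afford only a constant number of steps per query, while the input of a
query has about `s ^ 2` words. Hence the programs are laid out so that a query is the concatenation
of four existing memory segments. Every matrix entry, whether `0` or `1`, is one statement of three
words; a `0` is a statement whose left side lies in a dummy block of variables, where it has no
effect on the answer. Restricting the range of `υ` shortens a segment, and deleting an entry changes
one word.

Two gadgets encode triangles. With loads, points-to sets of a chain of variables follow walks of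
prescribed length through a layered graph, and the length forces the first and the last index to
coincide (`loadGadget_detects`). With stores, a pair of pointers with equal indices is shifted down
to index `0` (`storeGadget_detects`).

The machine code is verified with unbounded values and a bound `V` on all registers and cells;
`Ex.exec` transfers this to words below a power of `V`. -/

namespace DemandPT

open Function

/-! ### Unbounded evaluation of expressions -/

/-- The value of an expression on a machine without a bound on the words. -/
def Expr.val (s : State) : Expr → ℕ
  | Expr.const c => c
  | Expr.reg r => s.reg r
  | Expr.read a => s.mem (a.val s)
  | Expr.bin op x y => op.eval (x.val s) (y.val s)

/-- Operations whose results are polynomially bounded in an obvious way. -/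
def BinOp.Tame : BinOp → Prop
  | BinOp.and | BinOp.or | BinOp.xor | BinOp.shl | BinOp.shr => False
  | _ => True

/-- Expressions built from tame operations. -/
def Expr.Tame : Expr → Prop
  | Expr.const _ => True
  | Expr.reg _ => True
  | Expr.read a => a.Tame
  | Expr.bin op x y => op.Tame ∧ x.Tame ∧ y.Tame

/-- A degree: on words below `V`, the value of a tame expression is below `V ^ deg`. -/
def Expr.deg : Expr → ℕ
  | Expr.const c => c + 1
  | Expr.reg _ => 1
  | Expr.read a => a.deg + 1
  | Expr.bin _ x y => x.deg + y.deg + 1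

/-- Code built from tame expressions. -/
def Cmd.Tame : Cmd → Prop
  | Cmd.skip => True
  | Cmd.assign _ e => e.Tame
  | Cmd.write a e => a.Tame ∧ e.Tame
  | Cmd.seq c d => c.Tame ∧ d.Tame
  | Cmd.cond e c d => e.Tame ∧ c.Tame ∧ d.Tame
  | Cmd.loop e c => e.Tame ∧ c.Tame
  | Cmd.call _ segs => ∀ p ∈ segs, p.1.Tame ∧ p.2.Tame

/-- A bound on the degrees of the expressions in a piece of code. -/
def Cmd.deg : Cmd → ℕ
  | Cmd.skip => 0
  | Cmd.assign _ e => e.deg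
  | Cmd.write a e => a.deg + e.deg
  | Cmd.seq c d => c.deg + d.deg
  | Cmd.cond e c d => e.deg + c.deg + d.deg
  | Cmd.loop e c => e.deg + c.deg
  | Cmd.call _ segs => (segs.map fun p => p.1.deg + p.2.deg).sum

/-- All registers and all memory cells are below `V`. -/
def State.Good (V : ℕ) (s : State) : Prop :=
  (∀ r, s.reg r < V) ∧ ∀ a, s.mem a < V

theorem State.Good.set_reg {V : ℕ} {s : State} (h : s.Good V) (r : ℕ) {x : ℕ} (hx : x < V) :
    State.Good V ⟨update s.reg r x, s.mem⟩ := by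
  refine ⟨fun i => ?_, h.2⟩
  by_cases hi : i = r
  · subst hi; simpa using hx
  · simpa [hi] using h.1 i

theorem State.Good.set_mem {V : ℕ} {s : State} (h : s.Good V) (a : ℕ) {x : ℕ} (hx : x < V) :
    State.Good V ⟨s.reg, update s.mem a x⟩ := by
  refine ⟨h.1, fun i => ?_⟩
  by_cases hi : i = a
  · subst hi; simpa using hx
  · simpa [hi] using h.2 i

/-- One bound serves all tame operations. Its product form makes degrees add up in `Expr.val_lt`: a
value below `V ^ d` satisfies `x + 1 ≤ V ^ d`. -/
theorem BinOp.Tame.eval_le {op : BinOp} (h : op.Tame) (x y : ℕ) :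
    op.eval x y ≤ (x + 1) * (y + 1) := by
  have h1 : x ≤ (x + 1) * (y + 1) := by nlinarith [Nat.zero_le (x * y)]
  have h2 : 1 ≤ (x + 1) * (y + 1) := by nlinarith [Nat.zero_le (x * y)]
  cases op <;> simp only [BinOp.Tame, BinOp.eval] at h ⊢
  · nlinarith [Nat.zero_le (x * y)]
  · exact (Nat.sub_le _ _).trans h1
  · nlinarith [Nat.zero_le (x * y)]
  · exact (Nat.div_le_self _ _).trans h1
  · exact (Nat.mod_le _ _).trans h1
  · split_ifs <;> omega
  · split_ifs <;> omega

theorem Expr.val_lt {V : ℕ} (hV : 2 ≤ V) {s : State} (hs : s.Good V) {e : Expr} (he : e.Tame) :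
    e.val s < V ^ e.deg := by
  induction e with
  | const c =>
    exact (Nat.lt_pow_self (by omega : 1 < 2)).trans_le
      ((Nat.pow_le_pow_left hV _).trans (Nat.pow_le_pow_right (by omega) (Nat.le_succ _)))
  | reg r => simpa [Expr.val, Expr.deg] using hs.1 r
  | read a ih =>
    calc _ < V := hs.2 _
      _ = V ^ 1 := (pow_one _).symm
      _ ≤ _ := Nat.pow_le_pow_right (by omega) (by simp [Expr.deg])
  | bin op x y ihx ihy =>
    obtain ⟨h1, h2, h3⟩ := he
    calc _ ≤ (x.val s + 1) * (y.val s + 1) := h1.eval_le _ _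
      _ ≤ V ^ x.deg * V ^ y.deg := Nat.mul_le_mul (ihx h2) (ihy h3)
      _ = V ^ (x.deg + y.deg) := (pow_add _ _ _).symm
      _ < _ := Nat.pow_lt_pow_right (by omega) (by simp [Expr.deg])

theorem Expr.eval_eq {V W : ℕ} (hV : 2 ≤ V) {s : State} (hs : s.Good V) {e : Expr} (he : e.Tame)
    (hW : V ^ e.deg ≤ W) : e.eval W s = some (e.val s) := by
  induction e with
  | const c =>
    have := (Expr.val_lt hV hs he).trans_le hW
    simpa [Expr.eval, Expr.val] using this
  | reg r =>
    have := (Expr.val_lt hV hs he).trans_le hW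
    simpa [Expr.eval, Expr.val] using this
  | read a ih =>
    have h := (Expr.val_lt hV hs he).trans_le hW
    have := ih he ((Nat.pow_le_pow_right (by omega) (by simp [Expr.deg])).trans hW)
    simpa [Expr.eval, Expr.val, this] using h
  | bin op x y ihx ihy =>
    have h := (Expr.val_lt hV hs he).trans_le hW
    have h1 := ihx he.2.1 ((Nat.pow_le_pow_right (by omega) (by simp [Expr.deg]; omega)).trans hW)
    have h2 := ihy he.2.2 ((Nat.pow_le_pow_right (by omega) (by simp [Expr.deg]; omega)).trans hW)
    simpa [Expr.eval, Expr.val, h1, h2] using h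

/-- The contents of `m` consecutive memory cells. -/
def cells (mem : ℕ → ℕ) (a m : ℕ) : List ℕ := (List.range m).map fun i => mem (a + i)

theorem readSegs_eq {V W : ℕ} (hV : 2 ≤ V) {s : State} (hs : s.Good V) (segs : List (Expr × Expr))
    (ht : ∀ p ∈ segs, p.1.Tame ∧ p.2.Tame)
    (hW : V ^ (segs.map fun p => p.1.deg + p.2.deg).sum ≤ W) :
    readSegs W s segs = some (segs.flatMap fun p => cells s.mem (p.1.val s) (p.2.val s)) := by
  induction segs with
  | nil => rfl
  | cons p segs ih =>
    obtain ⟨a, l⟩ := p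
    have ha := (ht _ List.mem_cons_self).1
    have hl := (ht _ List.mem_cons_self).2
    simp only [List.map_cons, List.sum_cons] at hW
    have hW1 : V ^ (a.deg + l.deg) ≤ W :=
      (Nat.pow_le_pow_right (by omega) (Nat.le_add_right _ _)).trans hW
    have h1 := Expr.eval_eq hV hs ha ((Nat.pow_le_pow_right (by omega) (by simp)).trans hW1)
    have h2 := Expr.eval_eq hV hs hl ((Nat.pow_le_pow_right (by omega) (by simp)).trans hW1)
    have h3 := ih (fun p hp => ht p (List.mem_cons_of_mem _ hp))
      ((Nat.pow_le_pow_right (by omega) (by omega)).trans hW)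
    have h4 : a.val s + l.val s ≤ W := by
      refine le_trans ?_ hW1
      have b1 := Expr.val_lt hV hs ha
      have b2 := Expr.val_lt hV hs hl
      rw [pow_add]
      nlinarith [Nat.zero_le (a.val s * l.val s)]
    simp [readSegs, h1, h2, h3, h4, cells]

/-! ### Runs on words below a bound, with an oracle in place of the procedure -/

/-- Runs in which all registers and cells stay below `V`; `orc` relates the inputs of the
procedure to its results. Only the steps of the code itself are counted. -/
inductive Ex (V : ℕ) (orc : List ℕ → ℕ → Prop) : Cmd → State → State → ℕ → Prop
  | skip (s : State) : Ex V orc Cmd.skip s s 1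
  | assign (s : State) (r : ℕ) (e : Expr) (hs : s.Good V) :
      Ex V orc (Cmd.assign r e) s ⟨update s.reg r (e.val s), s.mem⟩ 1
  | write (s : State) (a e : Expr) (hs : s.Good V) :
      Ex V orc (Cmd.write a e) s ⟨s.reg, update s.mem (a.val s) (e.val s)⟩ 1
  | seq (c d : Cmd) (s₁ s₂ s₃ : State) (t₁ t₂ : ℕ)
      (h₁ : Ex V orc c s₁ s₂ t₁) (h₂ : Ex V orc d s₂ s₃ t₂) :
      Ex V orc (Cmd.seq c d) s₁ s₃ (t₁ + t₂)
  | cond_true (e : Expr) (c d : Cmd) (s s' : State) (t : ℕ) (hs : s.Good V)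
      (h0 : e.val s ≠ 0) (h : Ex V orc c s s' t) :
      Ex V orc (Cmd.cond e c d) s s' (t + 1)
  | cond_false (e : Expr) (c d : Cmd) (s s' : State) (t : ℕ) (hs : s.Good V)
      (h0 : e.val s = 0) (h : Ex V orc d s s' t) :
      Ex V orc (Cmd.cond e c d) s s' (t + 1)
  | loop_done (e : Expr) (c : Cmd) (s : State) (hs : s.Good V) (h0 : e.val s = 0) :
      Ex V orc (Cmd.loop e c) s s 1
  | loop_step (e : Expr) (c : Cmd) (s₁ s₂ s₃ : State) (t₁ t₂ : ℕ) (hs : s₁.Good V)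
      (h0 : e.val s₁ ≠ 0) (h₁ : Ex V orc c s₁ s₂ t₁) (h₂ : Ex V orc (Cmd.loop e c) s₂ s₃ t₂) :
      Ex V orc (Cmd.loop e c) s₁ s₃ (t₁ + t₂ + 1)
  | call (s : State) (r : ℕ) (segs : List (Expr × Expr)) (y : ℕ) (hs : s.Good V)
      (hy : orc (segs.flatMap fun p => cells s.mem (p.1.val s) (p.2.val s)) y) :
      Ex V orc (Cmd.call r segs) s ⟨update s.reg r y, s.mem⟩ 1

/-- On a state bounded by `V`, every intermediate value of tame code is below `V ^ deg`, so nothing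
overflows a word. A call is itself one step of the code, hence `t` steps contain at most `t` calls
of cost at most `B`. -/
theorem Ex.exec {V W B : ℕ} {orc : List ℕ → ℕ → Prop} {proc : List ℕ → ℕ → ℕ → Prop}
    (hV : 2 ≤ V) (hproc : ∀ x y, orc x y → ∃ v ≤ B, proc x y v) {c : Cmd} {s s' : State} {t : ℕ}
    (h : Ex V orc c s s' t) (hc : c.Tame) (hW : V ^ c.deg ≤ W) :
    ∃ u ≤ t * B, Exec W proc c s s' t u := by
  have mono : ∀ {a b : ℕ}, a ≤ b → V ^ b ≤ W → V ^ a ≤ W := fun hab h =>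
    (Nat.pow_le_pow_right (by omega) hab).trans h
  induction h with
  | skip s => exact ⟨0, Nat.zero_le _, .skip s⟩
  | assign s r e hs => exact ⟨0, Nat.zero_le _, .assign s r e _ (Expr.eval_eq hV hs hc hW)⟩
  | write s a e hs =>
    exact ⟨0, Nat.zero_le _, .write s a e _ _
      (Expr.eval_eq hV hs hc.1 (mono (by simp [Cmd.deg]) hW))
      (Expr.eval_eq hV hs hc.2 (mono (by simp [Cmd.deg]) hW))⟩
  | seq c d s₁ s₂ s₃ t₁ t₂ h₁ h₂ ih₁ ih₂ =>
    obtain ⟨u₁, hu₁, e₁⟩ := ih₁ hc.1 (mono (by simp [Cmd.deg]) hW)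
    obtain ⟨u₂, hu₂, e₂⟩ := ih₂ hc.2 (mono (by simp [Cmd.deg]) hW)
    exact ⟨u₁ + u₂, by rw [add_mul]; omega, .seq _ _ _ _ _ _ _ _ _ e₁ e₂⟩
  | cond_true e c d s s' t hs h0 h ih =>
    obtain ⟨u, hu, e₁⟩ := ih hc.2.1 (mono (by simp [Cmd.deg]; omega) hW)
    exact ⟨u, by rw [add_mul]; omega, .cond_true _ _ _ _ _ _ _ _
      (Expr.eval_eq hV hs hc.1 (mono (by simp [Cmd.deg]; omega) hW)) h0 e₁⟩
  | cond_false e c d s s' t hs h0 h ih =>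
    obtain ⟨u, hu, e₁⟩ := ih hc.2.2 (mono (by simp [Cmd.deg]) hW)
    exact ⟨u, by rw [add_mul]; omega, .cond_false _ _ _ _ _ _ _
      (h0 ▸ Expr.eval_eq hV hs hc.1 (mono (by simp [Cmd.deg]; omega) hW)) e₁⟩
  | loop_done e c s hs h0 =>
    exact ⟨0, Nat.zero_le _, Exec.loop_stop _ _ _
      (h0 ▸ Expr.eval_eq hV hs hc.1 (mono (by simp [Cmd.deg]) hW))⟩
  | loop_step e c s₁ s₂ s₃ t₁ t₂ hs h0 h₁ h₂ ih₁ ih₂ =>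
    obtain ⟨u₁, hu₁, e₁⟩ := ih₁ hc.2 (mono (by simp [Cmd.deg]) hW)
    obtain ⟨u₂, hu₂, e₂⟩ := ih₂ hc hW
    exact ⟨u₁ + u₂, by rw [add_mul, add_mul]; omega, .loop_step _ _ _ _ _ _ _ _ _ _
      (Expr.eval_eq hV hs hc.1 (mono (by simp [Cmd.deg]) hW)) h0 e₁ e₂⟩
  | call s r segs y hs hy =>
    obtain ⟨v, hv, hp⟩ := hproc _ _ hy
    exact ⟨v, by omega, .call _ _ _ _ _ _ (readSegs_eq hV hs segs hc hW) hp⟩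

/-! ### Monotonicity in the word size -/

theorem Expr.eval_mono {W W' : ℕ} (hW : W ≤ W') {s : State} {e : Expr} {x : ℕ}
    (h : e.eval W s = some x) : e.eval W' s = some x := by
  induction e generalizing x with
  | const c => simp [Expr.eval] at h ⊢; omega
  | reg r => simp [Expr.eval] at h ⊢; omega
  | read a ih =>
    simp only [Expr.eval, Option.bind_eq_some_iff] at h ⊢
    obtain ⟨i, hi, h⟩ := h
    refine ⟨i, ih hi, ?_⟩
    simp at h ⊢; omega
  | bin op a b iha ihb =>
    simp only [Expr.eval, Option.bind_eq_some_iff] at h ⊢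
    obtain ⟨i, hi, j, hj, h⟩ := h
    refine ⟨i, iha hi, j, ihb hj, ?_⟩
    simp at h ⊢; omega

theorem readSegs_mono {W W' : ℕ} (hW : W ≤ W') {s : State} {segs : List (Expr × Expr)}
    {l : List ℕ} (h : readSegs W s segs = some l) : readSegs W' s segs = some l := by
  induction segs generalizing l with
  | nil => exact h
  | cons p segs ih =>
    obtain ⟨a, b⟩ := p
    simp only [readSegs, Option.bind_eq_some_iff] at h ⊢
    obtain ⟨x, hx, m, hm, h⟩ := h
    refine ⟨x, Expr.eval_mono hW hx, m, Expr.eval_mono hW hm, ?_⟩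
    split_ifs at h with hxm
    rw [if_pos (hxm.trans hW)]
    rw [Option.map_eq_some_iff] at h ⊢
    obtain ⟨r, hr, h⟩ := h
    exact ⟨r, ih hr, h⟩

/-- Overflow leaves an expression without a value instead of wrapping around, so a halting run never
meets the word bound and survives its enlargement. This lets a subroutine designed for words of size
polynomial in `N` run on the larger words of its caller. -/
theorem Exec.mono {W W' : ℕ} (hW : W ≤ W') {proc proc' : List ℕ → ℕ → ℕ → Prop}
    (hp : ∀ x y v, proc x y v → proc' x y v) {c : Cmd} {s s' : State} {t u : ℕ}
    (h : Exec W proc c s s' t u) : Exec W' proc' c s s' t u := by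
  induction h with
  | skip s => exact .skip s
  | assign s r e x hx => exact .assign _ _ _ _ (Expr.eval_mono hW hx)
  | write s a e i x hi hx =>
    exact .write _ _ _ _ _ (Expr.eval_mono hW hi) (Expr.eval_mono hW hx)
  | seq _ _ _ _ _ _ _ _ _ _ _ ih₁ ih₂ => exact .seq _ _ _ _ _ _ _ _ _ ih₁ ih₂
  | cond_true _ _ _ _ _ _ _ _ hx h0 _ ih =>
    exact .cond_true _ _ _ _ _ _ _ _ (Expr.eval_mono hW hx) h0 ih
  | cond_false _ _ _ _ _ _ _ hx _ ih =>
    exact .cond_false _ _ _ _ _ _ _ (Expr.eval_mono hW hx) ih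
  | loop_stop _ _ _ hx => exact Exec.loop_stop _ _ _ (Expr.eval_mono hW hx)
  | loop_step _ _ _ _ _ _ _ _ _ _ hx h0 _ _ ih₁ ih₂ =>
    exact .loop_step _ _ _ _ _ _ _ _ _ _ (Expr.eval_mono hW hx) h0 ih₁ ih₂
  | call s r segs input y v hin hcall =>
    exact .call _ _ _ _ _ _ (readSegs_mono hW hin) (hp _ _ _ hcall)

theorem Runs.mono {W W' : ℕ} (hW : W ≤ W') {Q : Algorithm} {x : List ℕ} {s : State} {t u : ℕ}
    (h : Runs Q W x s t u) : Runs Q W' x s t u := by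
  induction Q generalizing x s t u with
  | nil => exact h
  | cons c Q ih =>
    refine Exec.mono hW ?_ h
    rintro x y v ⟨s', t', u', h1, h2⟩
    exact ⟨s', t', u', ih h1, h2⟩

/-! ### Total correctness -/

/-- The code `c`, started in `s`, halts, in a state and with a number of steps that satisfy
`Q`. -/
def Halts (V : ℕ) (orc : List ℕ → ℕ → Prop) (c : Cmd) (s : State) (Q : State → ℕ → Prop) : Prop :=
  ∃ s' t, Ex V orc c s s' t ∧ Q s' t

section Rules

variable {V : ℕ} {orc : List ℕ → ℕ → Prop} {s : State} {Q Q' : State → ℕ → Prop}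

theorem Halts.imp {c : Cmd} (h : Halts V orc c s Q) (hQ : ∀ s' t, Q s' t → Q' s' t) :
    Halts V orc c s Q' := by
  obtain ⟨s', t, h1, h2⟩ := h
  exact ⟨s', t, h1, hQ _ _ h2⟩

theorem Halts.skip (hQ : Q s 1) : Halts V orc Cmd.skip s Q := ⟨_, _, .skip s, hQ⟩

theorem Halts.assign {r : ℕ} {e : Expr} (hs : s.Good V)
    (hQ : Q ⟨update s.reg r (e.val s), s.mem⟩ 1) : Halts V orc (Cmd.assign r e) s Q :=
  ⟨_, _, .assign s r e hs, hQ⟩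

theorem Halts.write {a e : Expr} (hs : s.Good V)
    (hQ : Q ⟨s.reg, update s.mem (a.val s) (e.val s)⟩ 1) : Halts V orc (Cmd.write a e) s Q :=
  ⟨_, _, .write s a e hs, hQ⟩

theorem Halts.seq {c d : Cmd}
    (h : Halts V orc c s fun s₁ t₁ => Halts V orc d s₁ fun s₂ t₂ => Q s₂ (t₁ + t₂)) :
    Halts V orc (Cmd.seq c d) s Q := by
  obtain ⟨s₁, t₁, h1, s₂, t₂, h2, h3⟩ := h
  exact ⟨s₂, _, .seq _ _ _ _ _ _ _ h1 h2, h3⟩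

theorem Halts.assign_seq {r : ℕ} {e : Expr} {d : Cmd} (hs : s.Good V)
    (h : Halts V orc d ⟨update s.reg r (e.val s), s.mem⟩ fun s₂ t₂ => Q s₂ (1 + t₂)) :
    Halts V orc (Cmd.seq (Cmd.assign r e) d) s Q :=
  Halts.seq (Halts.assign hs h)

theorem Halts.assign_seq_eq {r : ℕ} {e : Expr} {d : Cmd} (hs : s.Good V) {x : ℕ}
    (hx : e.val s = x) (h : ∀ s', s' = ⟨update s.reg r x, s.mem⟩ →
      Halts V orc d s' fun s₂ t₂ => Q s₂ (1 + t₂)) :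
    Halts V orc (Cmd.seq (Cmd.assign r e) d) s Q := by
  subst hx
  exact Halts.assign_seq hs (h _ rfl)

theorem Halts.assign_eq {r : ℕ} {e : Expr} (hs : s.Good V) {x : ℕ} (hx : e.val s = x)
    (hQ : Q ⟨update s.reg r x, s.mem⟩ 1) : Halts V orc (Cmd.assign r e) s Q := by
  subst hx
  exact Halts.assign hs hQ

theorem Halts.write_seq {a e : Expr} {d : Cmd} (hs : s.Good V)
    (h : Halts V orc d ⟨s.reg, update s.mem (a.val s) (e.val s)⟩ fun s₂ t₂ => Q s₂ (1 + t₂)) :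
    Halts V orc (Cmd.seq (Cmd.write a e) d) s Q :=
  Halts.seq (Halts.write hs h)

theorem Halts.cond {e : Expr} {c d : Cmd} (hs : s.Good V)
    (h1 : e.val s ≠ 0 → Halts V orc c s fun s' t => Q s' (t + 1))
    (h2 : e.val s = 0 → Halts V orc d s fun s' t => Q s' (t + 1)) :
    Halts V orc (Cmd.cond e c d) s Q := by
  by_cases h0 : e.val s = 0
  · obtain ⟨s', t, h, hq⟩ := h2 h0
    exact ⟨s', _, .cond_false _ _ _ _ _ _ hs h0 h, hq⟩
  · obtain ⟨s', t, h, hq⟩ := h1 h0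
    exact ⟨s', _, .cond_true _ _ _ _ _ _ hs h0 h, hq⟩

/-- A loop with an invariant `I s k m` that carries the number `k` of steps made so far and a
measure `m` that decreases. -/
theorem Halts.loop {e : Expr} {c : Cmd} (I : State → ℕ → ℕ → Prop) {m : ℕ} (h0 : I s 0 m)
    (hgood : ∀ s k m, I s k m → s.Good V)
    (hstep : ∀ s k m, I s k m → e.val s ≠ 0 →
      Halts V orc c s fun s' t => ∃ m' < m, I s' (k + t + 1) m')
    (hQ : ∀ s k m, I s k m → e.val s = 0 → Q s (k + 1)) :
    Halts V orc (Cmd.loop e c) s Q := by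
  suffices H : ∀ m k s, I s k m → Halts V orc (Cmd.loop e c) s fun s' t => Q s' (k + t) by
    simpa using H _ _ _ h0
  intro m
  induction m using Nat.strong_induction_on with
  | _ m ih =>
    intro k s hI
    by_cases he : e.val s = 0
    · exact ⟨s, 1, .loop_done _ _ _ (hgood _ _ _ hI) he, hQ _ _ _ hI he⟩
    · obtain ⟨s₂, t₁, h1, m', hm', h2⟩ := hstep _ _ _ hI he
      obtain ⟨s₃, t₂, h3, h4⟩ := ih m' hm' _ _ h2
      refine ⟨s₃, _, .loop_step _ _ _ _ _ _ _ (hgood _ _ _ hI) he h1 h3, ?_⟩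
      convert h4 using 1
      omega

theorem Halts.call {r : ℕ} {segs : List (Expr × Expr)} {y : ℕ} (hs : s.Good V)
    (hy : orc (segs.flatMap fun p => cells s.mem (p.1.val s) (p.2.val s)) y)
    (hQ : Q ⟨update s.reg r y, s.mem⟩ 1) : Halts V orc (Cmd.call r segs) s Q :=
  ⟨_, _, .call s r segs y hs hy, hQ⟩

end Rules

/-! ### Programs over the natural numbers -/

/-- A statement whose variables are natural numbers. -/
abbrev Line := Kind × ℕ × ℕ

/-- The inclusion constraint of a statement. -/
def Line.Holds (ℓ : Line) (S : ℕ → Set ℕ) : Prop :=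
  match ℓ with
  | (Kind.addr, a, b) => b ∈ S a
  | (Kind.copy, a, b) => S b ⊆ S a
  | (Kind.load, a, b) => ∀ v ∈ S b, S v ⊆ S a
  | (Kind.store, a, b) => ∀ v ∈ S a, S b ⊆ S v

/-- The program with `N` variables that consists of the given statements. -/
def programOf (N : ℕ) (l : List Line) (hl : ∀ ℓ ∈ l, ℓ.2.1 < N ∧ ℓ.2.2 < N) (hn : l.Nodup) :
    Program N where
  stmts := l.pmap (fun ℓ h => ⟨ℓ.1, ⟨ℓ.2.1, h.1⟩, ⟨ℓ.2.2, h.2⟩⟩) hl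
  nodup := hn.pmap (by
    rintro ⟨κ, a, b⟩ h ⟨κ', a', b'⟩ h' e
    simp only [Stmt.mk.injEq, Fin.mk.injEq] at e
    obtain ⟨rfl, rfl, rfl⟩ := e
    rfl)

theorem mem_programOf {N : ℕ} {l : List Line} {hl : ∀ ℓ ∈ l, ℓ.2.1 < N ∧ ℓ.2.2 < N} {hn : l.Nodup}
    {st : Stmt N} :
    st ∈ (programOf N l hl hn).stmts ↔ (st.kind, (st.lhs : ℕ), (st.rhs : ℕ)) ∈ l := by
  simp only [programOf, List.mem_pmap]
  constructor
  · rintro ⟨⟨κ, a, b⟩, h, rfl⟩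
    exact h
  · intro h
    exact ⟨_, h, rfl⟩

theorem programOf_kinds {N : ℕ} {l : List Line} {hl : ∀ ℓ ∈ l, ℓ.2.1 < N ∧ ℓ.2.2 < N}
    {hn : l.Nodup} : (programOf N l hl hn).kinds = {κ | ∃ ℓ ∈ l, ℓ.1 = κ} := by
  ext κ
  constructor
  · rintro ⟨st, h, rfl⟩
    exact ⟨_, mem_programOf.1 h, rfl⟩
  · rintro ⟨ℓ, h, rfl⟩
    exact ⟨⟨ℓ.1, ⟨ℓ.2.1, (hl _ h).1⟩, ⟨ℓ.2.2, (hl _ h).2⟩⟩, mem_programOf.2 h, rfl⟩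

theorem encodeQuery_programOf {N : ℕ} {l : List Line} {hl : ∀ ℓ ∈ l, ℓ.2.1 < N ∧ ℓ.2.2 < N}
    {hn : l.Nodup} (p q : Fin N) :
    encodeQuery (programOf N l hl hn) p q =
      N :: (p : ℕ) :: (q : ℕ) :: l.flatMap fun ℓ => [ℓ.1.code, ℓ.2.1, ℓ.2.2] := by
  simp only [encodeQuery, programOf, List.cons.injEq, true_and]
  clear hn
  induction l with
  | nil => rfl
  | cons ℓ l ih =>
    simp only [List.pmap_cons, List.flatMap_cons]
    rw [ih]

theorem mem_pt_programOf {N : ℕ} {l : List Line} {hl : ∀ ℓ ∈ l, ℓ.2.1 < N ∧ ℓ.2.2 < N}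
    {hn : l.Nodup} (p q : Fin N) :
    q ∈ (programOf N l hl hn).pt p ↔
      ∀ S : ℕ → Set ℕ, (∀ ℓ ∈ l, Line.Holds ℓ S) → (q : ℕ) ∈ S p := by
  constructor
  · intro h S hS
    -- A solution over the natural numbers restricts to one over `Fin N`.
    refine h (fun a => {b | (b : ℕ) ∈ S a}) ?_
    rintro ⟨κ, a, b⟩ hst
    have := hS _ (mem_programOf.1 hst)
    cases κ with
    | addr => exact this
    | copy => exact fun x hx => this hx
    | load => exact fun v hv x hx => this v hv hx
    | store => exact fun v hv x hx => this v hv hx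
  · intro h S hS
    -- Conversely, a solution over `Fin N` is extended by empty sets; the statements mention only
    -- variables below `N`.
    obtain ⟨_, _, h⟩ := h (fun a => {b | ∃ (ha : a < N) (hb : b < N), ⟨b, hb⟩ ∈ S ⟨a, ha⟩}) (by
      rintro ⟨κ, a, b⟩ hℓ
      obtain ⟨ha, hb⟩ := hl _ hℓ
      have := hS ⟨κ, ⟨a, ha⟩, ⟨b, hb⟩⟩ (mem_programOf.2 hℓ)
      cases κ with
      | addr => exact ⟨ha, hb, this⟩
      | copy =>
        rintro x ⟨_, hx, h⟩
        exact ⟨ha, hx, this h⟩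
      | load =>
        rintro v ⟨_, hv, h⟩ x ⟨_, hx, h'⟩
        exact ⟨ha, hx, this _ h h'⟩
      | store =>
        rintro v ⟨_, hv, h⟩ x ⟨_, hx, h'⟩
        exact ⟨hv, hx, this _ h h'⟩)
    exact h

/-! ### Gadgets -/

/-- The width of a block of variables. -/
abbrev width (s : ℕ) : ℕ := s + 4

/-- The statements with variables `xb * w + (xo + i)` and `yb * w + (yo + i)`, `i < cs * s + cc`. -/
structure Family where
  kind : Kind
  cs : ℕ
  cc : ℕ
  xb : ℕ
  xo : ℕ
  yb : ℕ
  yo : ℕ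

def Family.count (f : Family) (s : ℕ) : ℕ := f.cs * s + f.cc

def Family.line (f : Family) (s i : ℕ) : Line :=
  (f.kind, f.xb * width s + (f.xo + i), f.yb * width s + (f.yo + i))

def Family.lines (f : Family) (s : ℕ) : List Line := (List.range (f.count s)).map (f.line s)

/-- The statements that represent a matrix: an entry `0` is represented by a statement whose left
side is in the block after the block `x`. -/
structure Slots where
  kind : Kind
  x : ℕ
  y : ℕ

def Slots.line (d : Slots) (s : ℕ) (bit : Bool) (z : ℕ) : Line :=
  (d.kind, (d.x + (1 - bit.toNat)) * width s + z / s, d.y * width s + z % s)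

/-- The statements for the entries from `lo` on, `m` in number. -/
def Slots.lines (d : Slots) (s : ℕ) (bit : ℕ → Bool) (lo m : ℕ) : List Line :=
  (List.range m).map fun i => d.line s (bit (lo + i)) (lo + i)

/-- A scheme for programs that detect triangles. The query is whether the variable
`pb * w + (ps * s + pc)` points to the variable `qb * w + (qs * s + qc)`. -/
structure Gadget where
  blocks : ℕ
  pb : ℕ
  ps : ℕ
  pc : ℕ
  qb : ℕ
  qs : ℕ
  qc : ℕ
  fams : List Family
  a : Slots
  b : Slots
  u : Slots

def Gadget.size (g : Gadget) (s : ℕ) : ℕ := g.blocks * width s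
def Gadget.p (g : Gadget) (s : ℕ) : ℕ := g.pb * width s + (g.ps * s + g.pc)
def Gadget.q (g : Gadget) (s : ℕ) : ℕ := g.qb * width s + (g.qs * s + g.qc)

/-- The order is that of the four segments of a query. Only the last group is cut to a range, since
the binary search runs over the entries of `υ` alone. -/
def Gadget.lines (g : Gadget) (s : ℕ) (α β υ : ℕ → Bool) (lo m : ℕ) : List Line :=
  g.fams.flatMap (fun f => f.lines s) ++
    (g.a.lines s α 0 (s * s) ++ (g.b.lines s β 0 (s * s) ++ g.u.lines s υ lo m))

/-- There is a triangle that uses an edge of the third kind in the range from `lo` to `hi`. -/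
def Triangle (s : ℕ) (α β υ : ℕ → Bool) (lo hi : ℕ) : Prop :=
  ∃ i < s, ∃ k < s, ∃ j < s, α (i * s + k) = true ∧ β (k * s + j) = true ∧
    υ (j * s + i) = true ∧ lo ≤ j * s + i ∧ j * s + i < hi

/-- The statement type and the blocks of the two variables. -/
def Family.key (f : Family) : Line := (f.kind, f.xb, f.yb)

def Slots.keys (d : Slots) : List Line := [(d.kind, d.x, d.y), (d.kind, d.x + 1, d.y)]

/-- The syntactic conditions on a gadget. -/
structure Gadget.WellFormed (g : Gadget) (T : Set Kind) : Prop where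
  fams : ∀ f ∈ g.fams, f.cs ≤ 1 ∧ f.xo + f.cc ≤ 4 ∧ f.yo + f.cc ≤ 4 ∧
    f.xb < g.blocks ∧ f.yb < g.blocks ∧ f.kind ∈ T
  slots : ∀ d ∈ [g.a, g.b, g.u], d.x + 1 < g.blocks ∧ d.y < g.blocks ∧ d.kind ∈ T
  kinds : ∀ κ ∈ T, ∃ f ∈ g.fams, f.kind = κ ∧ 0 < f.cc
  keys : (g.fams.map Family.key ++ (g.a.keys ++ (g.b.keys ++ g.u.keys))).Nodup
  p_lt : g.pb < g.blocks ∧ g.ps ≤ 1 ∧ g.pc < 4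
  q_lt : g.qb < g.blocks ∧ g.qs ≤ 1 ∧ g.qc < 4

/-- The gadget detects triangles. -/
def Gadget.Detects (g : Gadget) : Prop :=
  ∀ (s : ℕ) (α β υ : ℕ → Bool) (lo m : ℕ), 0 < s → lo + m ≤ s * s →
    ((∀ S : ℕ → Set ℕ, (∀ ℓ ∈ g.lines s α β υ lo m, Line.Holds ℓ S) → g.q s ∈ S (g.p s)) ↔
      Triangle s α β υ lo (lo + m))

theorem Family.mem_lines {f : Family} {s : ℕ} {ℓ : Line} :
    ℓ ∈ f.lines s ↔ ∃ i < f.count s, ℓ = f.line s i := by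
  simp [Family.lines, eq_comm]

theorem Slots.mem_lines {d : Slots} {s : ℕ} {bit : ℕ → Bool} {lo m : ℕ} {ℓ : Line} :
    ℓ ∈ d.lines s bit lo m ↔ ∃ z, lo ≤ z ∧ z < lo + m ∧ ℓ = d.line s (bit z) z := by
  simp only [Slots.lines, List.mem_map, List.mem_range]
  constructor
  · rintro ⟨i, hi, rfl⟩
    exact ⟨lo + i, by omega, by omega, rfl⟩
  · rintro ⟨z, h1, h2, rfl⟩
    exact ⟨z - lo, by omega, by rw [Nat.add_sub_cancel' h1]⟩

theorem block_div {b w i : ℕ} (h : i < w) : (b * w + i) / w = b := by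
  rw [mul_comm, Nat.mul_add_div (by omega), Nat.div_eq_of_lt h, add_zero]

theorem block_mod {b w i : ℕ} (h : i < w) : (b * w + i) % w = i := by
  rw [mul_comm, Nat.mul_add_mod, Nat.mod_eq_of_lt h]

theorem block_lt {b w i B : ℕ} (h : i < w) (hb : b < B) : b * w + i < B * w := by
  calc b * w + i < b * w + w := by omega
    _ = (b + 1) * w := by ring
    _ ≤ _ := Nat.mul_le_mul_right _ hb

/-- The statement type and the blocks of the variables of a statement. -/
def Line.key (s : ℕ) (ℓ : Line) : Line := (ℓ.1, ℓ.2.1 / width s, ℓ.2.2 / width s)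

theorem Slots.line_key {d : Slots} {s : ℕ} (hs : 0 < s) (bit : Bool) {z : ℕ} (hz : z < s * s) :
    Line.key s (d.line s bit z) = (d.kind, d.x + (1 - bit.toNat), d.y) := by
  have h1 : z / s < width s := by have := Nat.div_lt_of_lt_mul hz; simp only [width]; omega
  have h2 : z % s < width s := by have := Nat.mod_lt z hs; simp only [width]; omega
  simp only [Line.key, Slots.line, block_div h1, block_div h2]

theorem Slots.line_key_mem {d : Slots} {s : ℕ} (hs : 0 < s) (bit : Bool) {z : ℕ} (hz : z < s * s) :
    Line.key s (d.line s bit z) ∈ d.keys := by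
  rw [Slots.line_key hs bit hz]
  cases bit <;> simp [Slots.keys]

theorem Slots.lines_nodup {d : Slots} {s : ℕ} (hs : 0 < s) (bit : ℕ → Bool) {lo m : ℕ}
    (hm : lo + m ≤ s * s) : (d.lines s bit lo m).Nodup := by
  refine List.Nodup.map_on ?_ List.nodup_range
  intro i hi j hj h
  simp only [List.mem_range] at hi hj
  have hi' : lo + i < s * s := by omega
  have hj' : lo + j < s * s := by omega
  have a1 : (lo + i) / s < width s := by have := Nat.div_lt_of_lt_mul hi'; simp only [width]; omega
  have a2 : (lo + j) / s < width s := by have := Nat.div_lt_of_lt_mul hj'; simp only [width]; omega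
  have b1 : (lo + i) % s < width s := by have := Nat.mod_lt (lo + i) hs; simp only [width]; omega
  have b2 : (lo + j) % s < width s := by have := Nat.mod_lt (lo + j) hs; simp only [width]; omega
  simp only [Slots.line, Prod.mk.injEq] at h
  have e1 := congrArg (· % width s) h.2.1
  have e2 := congrArg (· % width s) h.2.2
  simp only [block_mod, a1, a2, b1, b2] at e1 e2
  have c1 := Nat.div_add_mod (lo + i) s
  have c2 := Nat.div_add_mod (lo + j) s
  rw [e1, e2] at c1
  omega

/-- Statements with different keys are different, so duplicates across groups are excluded by a
finite check on kinds and block numbers, independent of `s` and of the matrices. -/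
theorem nodup_append_of_keys {s : ℕ} {l l' k k' : List Line} (hl : l.Nodup) (hl' : l'.Nodup)
    (hk : ∀ ℓ ∈ l, Line.key s ℓ ∈ k) (hk' : ∀ ℓ ∈ l', Line.key s ℓ ∈ k') (h : (k ++ k').Nodup) :
    (l ++ l').Nodup := by
  refine List.nodup_append'.2 ⟨hl, hl', fun ℓ h1 h2 => ?_⟩
  exact (List.nodup_append'.1 h).2.2 (hk _ h1) (hk' _ h2)

theorem Gadget.mem_lines_cases {g : Gadget} {s : ℕ} {α β υ : ℕ → Bool} {lo m : ℕ}
    (hm : lo + m ≤ s * s) {ℓ : Line}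
    (hℓ : ℓ ∈ g.lines s α β υ lo m) :
    (∃ f ∈ g.fams, ∃ i < f.count s, ℓ = f.line s i) ∨
      ∃ d ∈ [g.a, g.b, g.u], ∃ bit, ∃ z < s * s, ℓ = d.line s bit z := by
  simp only [Gadget.lines, List.mem_append, List.mem_flatMap, Family.mem_lines,
    Slots.mem_lines] at hℓ
  rcases hℓ with h | ⟨z, -, hz, rfl⟩ | ⟨z, -, hz, rfl⟩ | ⟨z, -, hz, rfl⟩
  · exact Or.inl h
  · exact Or.inr ⟨g.a, by simp, _, z, by omega, rfl⟩
  · exact Or.inr ⟨g.b, by simp, _, z, by omega, rfl⟩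
  · exact Or.inr ⟨g.u, by simp, _, z, by omega, rfl⟩

section

variable {g : Gadget} {T : Set Kind} (hg : g.WellFormed T) {s : ℕ} (hs : 0 < s)
  {α β υ : ℕ → Bool} {lo m : ℕ} (hm : lo + m ≤ s * s)
include hg

theorem Gadget.WellFormed.family_index_lt {f : Family} (hf : f ∈ g.fams) {i : ℕ}
    (hi : i < f.count s) : f.xo + i < width s ∧ f.yo + i < width s := by
  obtain ⟨h1, h2, h3, -⟩ := hg.fams f hf
  have : f.cs * s ≤ s := by nlinarith
  simp only [Family.count] at hi
  simp only [width]
  constructor <;> omega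

theorem Gadget.WellFormed.family_key {f : Family} (hf : f ∈ g.fams) {ℓ : Line}
    (hℓ : ℓ ∈ f.lines s) : Line.key s ℓ = f.key := by
  obtain ⟨i, hi, rfl⟩ := Family.mem_lines.1 hℓ
  obtain ⟨h1, h2⟩ := hg.family_index_lt hf hi
  simp only [Line.key, Family.line, Family.key, block_div h1, block_div h2]

theorem Gadget.WellFormed.p_lt_size : g.p s < g.size s := by
  obtain ⟨h1, h2, h3⟩ := hg.p_lt
  exact block_lt (by nlinarith) h1

theorem Gadget.WellFormed.q_lt_size : g.q s < g.size s := by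
  obtain ⟨h1, h2, h3⟩ := hg.q_lt
  exact block_lt (by nlinarith) h1

include hm

theorem Gadget.WellFormed.lines_kinds : {κ | ∃ ℓ ∈ g.lines s α β υ lo m, ℓ.1 = κ} = T := by
  ext κ
  constructor
  · rintro ⟨ℓ, hℓ, rfl⟩
    rcases g.mem_lines_cases hm hℓ with ⟨f, hf, i, hi, rfl⟩ | ⟨d, hd, bit, z, hz, rfl⟩
    · exact (hg.fams f hf).2.2.2.2.2
    · exact (hg.slots d hd).2.2
  · intro hκ
    obtain ⟨f, hf, rfl, hc⟩ := hg.kinds κ hκ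
    -- The first statement of a family exists for every `s` because its constant part `cc` is
    -- positive.
    refine ⟨f.line s 0, ?_, rfl⟩
    refine List.mem_append_left _ (List.mem_flatMap.2 ⟨f, hf, Family.mem_lines.2 ⟨0, ?_, rfl⟩⟩)
    simp [Family.count]; omega

include hs

theorem Gadget.WellFormed.lines_nodup : (g.lines s α β υ lo m).Nodup := by
  have hm' : 0 + s * s ≤ s * s := by omega
  have key : ∀ (d : Slots) (bit : ℕ → Bool) (lo m : ℕ), lo + m ≤ s * s →
      ∀ ℓ ∈ d.lines s bit lo m, Line.key s ℓ ∈ d.keys := by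
    intro d bit lo m hm ℓ hℓ
    obtain ⟨z, -, hz, rfl⟩ := Slots.mem_lines.1 hℓ
    exact Slots.line_key_mem hs _ (by omega)
  have hk := hg.keys
  refine nodup_append_of_keys (s := s) ?_ ?_ ?_ ?_ hk
  · rw [List.nodup_flatMap]
    refine ⟨fun f hf => ?_, ?_⟩
    · refine List.Nodup.map_on ?_ List.nodup_range
      intro i _ j _ h
      simp only [Family.line, Prod.mk.injEq] at h
      omega
    · have := (List.pairwise_map.1 (List.nodup_append'.1 hk).1)
      refine this.imp_of_mem ?_
      intro f f' hf hf' hne ℓ h1 h2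
      exact hne ((hg.family_key hf h1).symm.trans (hg.family_key hf' h2))
  · have hk := (List.nodup_append'.1 hk).2.1
    refine nodup_append_of_keys (Slots.lines_nodup hs _ hm') ?_ (key _ _ _ _ hm') ?_ hk
    · exact nodup_append_of_keys (Slots.lines_nodup hs _ hm') (Slots.lines_nodup hs _ hm)
        (key _ _ _ _ hm') (key _ _ _ _ hm) (List.nodup_append'.1 hk).2.1
    · intro ℓ hℓ
      rw [List.mem_append] at hℓ ⊢
      exact hℓ.imp (key _ _ _ _ hm' _) (key _ _ _ _ hm _)
  · intro ℓ hℓ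
    obtain ⟨f, hf, h⟩ := List.mem_flatMap.1 hℓ
    rw [hg.family_key hf h]
    exact List.mem_map_of_mem hf
  · intro ℓ hℓ
    simp only [List.mem_append] at hℓ ⊢
    exact hℓ.imp (key _ _ _ _ hm' _) (Or.imp (key _ _ _ _ hm' _) (key _ _ _ _ hm _))

theorem Gadget.WellFormed.lines_lt : ∀ ℓ ∈ g.lines s α β υ lo m,
    ℓ.2.1 < g.size s ∧ ℓ.2.2 < g.size s := by
  intro ℓ hℓ
  rcases g.mem_lines_cases hm hℓ with ⟨f, hf, i, hi, rfl⟩ | ⟨d, hd, bit, z, hz, rfl⟩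
  · obtain ⟨h1, h2⟩ := hg.family_index_lt hf hi
    obtain ⟨-, -, -, h3, h4, -⟩ := hg.fams f hf
    exact ⟨block_lt h1 h3, block_lt h2 h4⟩
  · obtain ⟨h3, h4, -⟩ := hg.slots d hd
    have a1 : z / s < width s := by have := Nat.div_lt_of_lt_mul hz; simp only [width]; omega
    have b1 : z % s < width s := by have := Nat.mod_lt z hs; simp only [width]; omega
    exact ⟨block_lt a1 (by omega), block_lt b1 h4⟩

end

/-- Every answer to a triangle query is an answer to a demand-driven query. -/
theorem Gadget.exists_query {g : Gadget} {T : Set Kind} (hg : g.WellFormed T) (hd : g.Detects)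
    {s : ℕ} (hs : 0 < s) (α β υ : ℕ → Bool) {lo m : ℕ} (hm : lo + m ≤ s * s) :
    ∃ (P : Program (g.size s)) (p q : Fin (g.size s)), P.kinds = T ∧
      (q ∈ P.pt p ↔ Triangle s α β υ lo (lo + m)) ∧
      encodeQuery P p q = g.size s :: g.p s :: g.q s ::
        (g.lines s α β υ lo m).flatMap fun ℓ => [ℓ.1.code, ℓ.2.1, ℓ.2.2] :=
  ⟨programOf _ _ (hg.lines_lt hs hm) (hg.lines_nodup hs hm), ⟨g.p s, hg.p_lt_size⟩,
    ⟨g.q s, hg.q_lt_size⟩, programOf_kinds.trans (hg.lines_kinds hm),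
    (mem_pt_programOf _ _).trans (hd s α β υ lo m hs hm), encodeQuery_programOf _ _⟩

/-! ### The gadget for loads -/

/-- One harmless statement of each type in a list, on a variable of its own. -/
def ballast (b : ℕ) (ks : List Kind) : List Family := ks.map fun κ => ⟨κ, 0, 1, b, 0, b, 0⟩

/-- Blocks `0`, `2`, `4`, `6` are the layers of a graph whose edges are address-of statements. Layer
`0` is a chain `0 → 1 → ⋯ → s`, the matrices lead from layer `0` through `2` and `4` to `6`, and
layer `6` is again a chain ending in `s`. Blocks `1`, `3`, `5` are the dummies, which the walks
never reach. Block `7` holds variables `x_0, …, x_{s+3}` with `x_{m+1} = *x_m`, so that `x_m` points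
to the nodes at the end of walks of length `m` from the start of the first chain. The index `s + 3`
accounts for the width `s + 4` of a block. Block `8` is for the ballast. -/
def loadGadget (ks : List Kind) : Gadget where
  blocks := 9
  pb := 7
  ps := 1
  pc := 3
  qb := 6
  qs := 1
  qc := 0
  fams := [⟨Kind.addr, 1, 0, 0, 0, 0, 1⟩, ⟨Kind.addr, 1, 0, 6, 0, 6, 1⟩,
    ⟨Kind.addr, 0, 1, 7, 0, 0, 0⟩, ⟨Kind.load, 1, 3, 7, 1, 7, 0⟩] ++ ballast 8 ks
  a := ⟨Kind.addr, 0, 2⟩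
  b := ⟨Kind.addr, 2, 4⟩
  u := ⟨Kind.addr, 4, 6⟩

/-- Write `r_i`, `u_i`, `l_j`, `m_k` for the variables of blocks `0`, `1`, `6`, `8`. Block `2`
points to the `r_i`, block `4` to the `m_k` and block `9` to the `u_i`, so that a store through
block `2` or `4` acts as a copy into `r_i` or `m_k`. The matrices thus pass `u_i` from `l_j` to
`m_k` to `r_i`. The two shifting families say that everything `r_{i+1}` points to receives `r_i`,
and everything `u_{i+1}` points to receives `u_i`. The dummies `3` and `5` have empty points-to
sets, which makes stores through them void; the dummy `7` is never read. -/
def storeGadget (ks : List Kind) : Gadget where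
  blocks := 11
  pb := 0
  ps := 0
  pc := 0
  qb := 1
  qs := 0
  qc := 0
  fams := [⟨Kind.addr, 1, 0, 2, 0, 0, 0⟩, ⟨Kind.addr, 1, 0, 4, 0, 8, 0⟩,
    ⟨Kind.store, 1, 0, 0, 1, 2, 0⟩, ⟨Kind.addr, 1, 0, 9, 0, 1, 0⟩,
    ⟨Kind.store, 1, 0, 1, 1, 9, 0⟩] ++ ballast 10 ks
  a := ⟨Kind.store, 2, 8⟩
  b := ⟨Kind.store, 4, 6⟩
  u := ⟨Kind.addr, 6, 1⟩

theorem loadGadget_wellFormed {T : Set Kind} {ks : List Kind} (hn : ks.Nodup)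
    (hks : ∀ κ, κ ∈ ks ↔ κ ∈ T) (h1 : Kind.addr ∈ T) (h2 : Kind.load ∈ T) :
    (loadGadget ks).WellFormed T where
  fams := by
    simp +contextual [loadGadget, ballast, h1, h2, hks]
  slots := by simp [loadGadget, h1]
  kinds := fun κ hκ => ⟨⟨κ, 0, 1, 8, 0, 8, 0⟩, by simp [loadGadget, ballast, hks, hκ], rfl, by simp⟩
  keys := by
    have : (ks.map fun κ => ((κ, 8, 8) : Line)).Nodup := hn.map fun a b h => by simpa using h
    simp [loadGadget, ballast, Family.key, Slots.keys, Function.comp_def, List.nodup_append, this]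
  p_lt := by simp [loadGadget]
  q_lt := by simp [loadGadget]

theorem storeGadget_wellFormed {T : Set Kind} {ks : List Kind} (hn : ks.Nodup)
    (hks : ∀ κ, κ ∈ ks ↔ κ ∈ T) (h1 : Kind.addr ∈ T) (h2 : Kind.store ∈ T) :
    (storeGadget ks).WellFormed T where
  fams := by
    simp +contextual [storeGadget, ballast, h1, h2, hks]
  slots := by simp [storeGadget, h1, h2]
  kinds := fun κ hκ =>
    ⟨⟨κ, 0, 1, 10, 0, 10, 0⟩, by simp [storeGadget, ballast, hks, hκ], rfl, by simp⟩
  keys := by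
    have : (ks.map fun κ => ((κ, 10, 10) : Line)).Nodup := hn.map fun a b h => by simpa using h
    simp [storeGadget, ballast, Family.key, Slots.keys, Function.comp_def, List.nodup_append, this]
  p_lt := by simp [storeGadget]
  q_lt := by simp [storeGadget]

/-- The variable with a given index in a block. -/
def var (s b i : ℕ) : ℕ := b * width s + i

theorem var_div {s b i : ℕ} (h : i < s + 4) : var s b i / width s = b := block_div h
theorem var_mod {s b i : ℕ} (h : i < s + 4) : var s b i % width s = i := block_mod h

/-- The statements of a gadget hold in `S`, entry by entry. -/
theorem Gadget.holds_iff {g : Gadget} {s : ℕ} (hs : 0 < s) {α β υ : ℕ → Bool} {lo m : ℕ}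
    (hm : lo + m ≤ s * s) {S : ℕ → Set ℕ} :
    (∀ ℓ ∈ g.lines s α β υ lo m, Line.Holds ℓ S) ↔
      (∀ f ∈ g.fams, ∀ i < f.cs * s + f.cc,
        Line.Holds (f.kind, var s f.xb (f.xo + i), var s f.yb (f.yo + i)) S) ∧
      (∀ i < s, ∀ k < s, Line.Holds
        (g.a.kind, var s (g.a.x + (1 - (α (i * s + k)).toNat)) i, var s g.a.y k) S) ∧
      (∀ k < s, ∀ j < s, Line.Holds
        (g.b.kind, var s (g.b.x + (1 - (β (k * s + j)).toNat)) k, var s g.b.y j) S) ∧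
      (∀ j < s, ∀ i < s, lo ≤ j * s + i → j * s + i < lo + m → Line.Holds
        (g.u.kind, var s (g.u.x + (1 - (υ (j * s + i)).toNat)) j, var s g.u.y i) S) := by
  have slots : ∀ (d : Slots) (bit : ℕ → Bool) (lo m : ℕ), lo + m ≤ s * s →
      ((∀ ℓ ∈ d.lines s bit lo m, Line.Holds ℓ S) ↔
        ∀ j < s, ∀ i < s, lo ≤ j * s + i → j * s + i < lo + m → Line.Holds
        (d.kind, var s (d.x + (1 - (bit (j * s + i)).toNat)) j, var s d.y i) S) := by
    intro d bit lo m hm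
    constructor
    · intro h j hj i hi h1 h2
      have := h _ (Slots.mem_lines.2 ⟨_, h1, h2, rfl⟩)
      rwa [Slots.line, block_div hi, block_mod hi] at this
    · intro h ℓ hℓ
      obtain ⟨z, h1, h2, rfl⟩ := Slots.mem_lines.1 hℓ
      have e : z / s * s + z % s = z := by rw [mul_comm]; exact Nat.div_add_mod z s
      have := h (z / s) (Nat.div_lt_of_lt_mul (by omega)) (z % s) (Nat.mod_lt z hs)
      rw [e] at this
      exact this h1 h2
  have lt : ∀ i < s, ∀ k < s, i * s + k < 0 + s * s := fun i hi k hk => by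
    rw [zero_add]; exact block_lt hk hi
  have full : ∀ (d : Slots) (bit : ℕ → Bool),
      ((∀ ℓ ∈ d.lines s bit 0 (s * s), Line.Holds ℓ S) ↔ ∀ j < s, ∀ i < s, Line.Holds
        (d.kind, var s (d.x + (1 - (bit (j * s + i)).toNat)) j, var s d.y i) S) := by
    intro d bit
    rw [slots d bit 0 (s * s) (by omega)]
    exact ⟨fun h j hj i hi => h j hj i hi (Nat.zero_le _) (lt j hj i hi),
      fun h j hj i hi _ _ => h j hj i hi⟩
  simp only [Gadget.lines, List.mem_append, or_imp, forall_and, full, slots _ _ _ _ hm]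
  refine and_congr_left fun _ => ?_
  constructor
  · intro h f hf i hi
    exact h _ (List.mem_flatMap.2 ⟨f, hf, Family.mem_lines.2 ⟨i, hi, rfl⟩⟩)
  · intro h ℓ hℓ
    obtain ⟨f, hf, hℓ⟩ := List.mem_flatMap.1 hℓ
    obtain ⟨i, hi, rfl⟩ := Family.mem_lines.1 hℓ
    exact h f hf i hi

/-- The assignment of points-to sets given by a relation between blocks and indices. -/
def blockSets (s : ℕ) (R : ℕ → ℕ → ℕ → ℕ → Prop) (x : ℕ) : Set ℕ :=
  {y | R (x / width s) (x % width s) (y / width s) (y % width s)}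

theorem mem_blockSets {s : ℕ} {R : ℕ → ℕ → ℕ → ℕ → Prop} {b i b' i' : ℕ} (h : i < s + 4)
    (h' : i' < s + 4) : var s b' i' ∈ blockSets s R (var s b i) ↔ R b i b' i' := by
  simp only [blockSets, Set.mem_ofPred_eq, var_div h, var_mod h, var_div h', var_mod h']

theorem holds_blockSets {s : ℕ} {R : ℕ → ℕ → ℕ → ℕ → Prop} {κ : Kind} {b i b' i' : ℕ}
    (h : i < s + 4) (h' : i' < s + 4)
    (hR : match κ with
      | Kind.addr => R b i b' i'
      | Kind.copy => ∀ c j, R b' i' c j → R b i c j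
      | Kind.load => ∀ c j d k, R b' i' c j → R c j d k → R b i d k
      | Kind.store => ∀ c j d k, R b i c j → R b' i' d k → R c j d k) :
    Line.Holds (κ, var s b i, var s b' i') (blockSets s R) := by
  cases κ with
  | addr => exact (mem_blockSets h h').2 hR
  | copy =>
    intro v hv
    simp only [blockSets, Set.mem_ofPred_eq, var_div h, var_mod h, var_div h', var_mod h'] at hv ⊢
    exact hR _ _ hv
  | load =>
    intro v hv x hx
    simp only [blockSets, Set.mem_ofPred_eq, var_div h, var_mod h, var_div h', var_mod h'] at hv hx ⊢
    exact hR _ _ _ _ hv hx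
  | store =>
    intro v hv x hx
    simp only [blockSets, Set.mem_ofPred_eq, var_div h, var_mod h, var_div h', var_mod h'] at hv hx ⊢
    exact hR _ _ _ _ hv hx

/-! ### The gadget for loads: walks of prescribed length -/

section Load

variable (s : ℕ) (α β υ : ℕ → Bool) (lo hi : ℕ)

/-- The address-of edges among the layers of the gadget for loads. -/
inductive LoadEdge : ℕ → ℕ → ℕ → ℕ → Prop
  | chain {i} : i < s → LoadEdge 0 i 0 (i + 1)
  | a {i k} : i < s → k < s → α (i * s + k) = true → LoadEdge 0 i 2 k
  | a' {i k} : i < s → k < s → LoadEdge 1 i 2 k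
  | b {k j} : k < s → j < s → β (k * s + j) = true → LoadEdge 2 k 4 j
  | b' {k j} : k < s → j < s → LoadEdge 3 k 4 j
  | u {j i} : j < s → i < s → υ (j * s + i) = true → lo ≤ j * s + i → j * s + i < hi →
      LoadEdge 4 j 6 i
  | u' {j i} : j < s → i < s → LoadEdge 5 j 6 i
  | tail {i} : i < s → LoadEdge 6 i 6 (i + 1)

/-- The nodes at a given distance from the beginning of the chain. -/
inductive LoadDist : ℕ → ℕ → ℕ → Prop
  | start : LoadDist 0 0 0
  | step {m b i b' i'} : LoadDist m b i → LoadEdge s α β υ lo hi b i b' i' → LoadDist (m + 1) b' i'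

/-- A solution of the constraints small enough to refute the query when there is no triangle. -/
inductive LoadPts : ℕ → ℕ → ℕ → ℕ → Prop
  | edge {b i b' i'} : LoadEdge s α β υ lo hi b i b' i' → LoadPts b i b' i'
  | dist {m b i} : LoadDist s α β υ lo hi m b i → LoadPts 7 m b i
  | ballast : LoadPts 8 0 8 0

variable {s α β υ lo hi}

/-- A walk makes `i₀` chain steps, leaves through one edge of each matrix, enters the last layer at
`i₁`, and makes `i - i₁` further chain steps. Layers are never revisited, so its length determines
`i₀ - i₁` once its end in the last layer is known. -/
theorem LoadDist.spec {m b i : ℕ} (h : LoadDist s α β υ lo hi m b i) :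
    (b = 0 ∧ m = i) ∨
    (b = 2 ∧ ∃ i₀ < s, i < s ∧ α (i₀ * s + i) = true ∧ m = i₀ + 1) ∨
    (b = 4 ∧ ∃ i₀ < s, ∃ k < s, i < s ∧ α (i₀ * s + k) = true ∧ β (k * s + i) = true ∧
      m = i₀ + 2) ∨
    (b = 6 ∧ ∃ i₀ < s, ∃ k < s, ∃ j < s, ∃ i₁ < s, α (i₀ * s + k) = true ∧
      β (k * s + j) = true ∧ υ (j * s + i₁) = true ∧ lo ≤ j * s + i₁ ∧ j * s + i₁ < hi ∧
      i₁ ≤ i ∧ m + i₁ = i₀ + 3 + i) := by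
  induction h with
  | start => exact Or.inl ⟨rfl, rfl⟩
  | step h e ih =>
    rcases ih with ⟨rfl, rfl⟩ | ⟨rfl, i₀, h0, h1, h2, rfl⟩ | ⟨rfl, i₀, h0, k, h1, h2, h3, h4, rfl⟩ |
      ⟨rfl, i₀, h0, k, h1, j, h2, i₁, h3, h4, h5, h6, h7, h8, h9, h10⟩
    · cases e with
      | chain h => exact Or.inl ⟨rfl, rfl⟩
      | a h h' h'' => exact Or.inr (Or.inl ⟨rfl, _, h, h', h'', rfl⟩)
    · cases e with
      | b h h' h'' => exact Or.inr (Or.inr (Or.inl ⟨rfl, _, h0, _, h1, h', h2, h'', rfl⟩))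
    · cases e with
      | u h h' h'' l l' =>
        exact Or.inr (Or.inr (Or.inr ⟨rfl, _, h0, _, h1, _, h, _, h', h3, h4, h'', l, l', le_rfl,
          by omega⟩))
    · cases e with
      | tail h =>
        exact Or.inr (Or.inr (Or.inr ⟨rfl, _, h0, _, h1, _, h2, _, h3, h4, h5, h6, h7, h8,
          by omega, by omega⟩))

end Load

theorem loadGadget_detects (ks : List Kind) : (loadGadget ks).Detects := by
  intro s α β υ lo m hs hm
  simp only [Gadget.holds_iff hs hm]
  constructor
  · intro h
    have := h (blockSets s (LoadPts s α β υ lo (lo + m))) (by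
      refine ⟨?_, ?_, ?_, ?_⟩
      · simp only [loadGadget, ballast, List.cons_append, List.nil_append, List.mem_cons,
          List.mem_map]
        rintro f (rfl | rfl | rfl | rfl | ⟨κ, -, rfl⟩) i hi <;> dsimp only at hi ⊢
        · exact holds_blockSets (by omega) (by omega)
            (by simpa [add_comm] using .edge (.chain (by omega)))
        · exact holds_blockSets (by omega) (by omega)
            (by simpa [add_comm] using .edge (.tail (by omega)))
        · obtain rfl : i = 0 := by omega
          exact holds_blockSets (by omega) (by omega) (.dist .start)
        · refine holds_blockSets (by omega) (by omega) ?_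
          rintro c j d k (h | h) h'
          · cases h
          · cases h' with
            | edge h' => simpa [add_comm] using LoadPts.dist (h.step h')
            -- A variable of block `7` or `8` is never reached by a walk, so only genuine edges can
            -- prolong one.
            | dist h' => rcases h.spec with h | h | h | h <;> simp at h
            | ballast => rcases h.spec with h | h | h | h <;> simp at h
        · obtain rfl : i = 0 := by omega
          refine holds_blockSets (by omega) (by omega) ?_
          cases κ with
          | addr => exact .ballast
          | copy => exact fun c j h => h
          | load =>
            rintro c j d k (h | h | h) h'
            · cases h
            · exact h'
          | store =>
            rintro c j d k (h | h | h) h'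
            · cases h
            · exact h'
      · intro i hi k hk
        refine holds_blockSets (by omega) (by omega) ?_
        cases h : α (i * s + k)
        · exact .edge (.a' hi hk)
        · exact .edge (.a hi hk h)
      · intro i hi k hk
        refine holds_blockSets (by omega) (by omega) ?_
        cases h : β (i * s + k)
        · exact .edge (.b' hi hk)
        · exact .edge (.b hi hk h)
      · intro i hi k hk h1 h2
        refine holds_blockSets (by omega) (by omega) ?_
        cases h : υ (i * s + k)
        · exact .edge (.u' hi hk)
        · exact .edge (.u hi hk h h1 h2))
    change var s 6 (1 * s + 0) ∈ blockSets s _ (var s 7 (1 * s + 3)) at this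
    rw [mem_blockSets (by omega) (by omega)] at this
    cases this with
    | edge h => cases h
    | dist h =>
      obtain h | h | h | ⟨-, i₀, h0, k, h1, j, h2, i₁, h3, h4, h5, h6, h7, h8, h9, h10⟩ := h.spec
      · simp at h
      · simp at h
      · simp at h
      -- The length `s + 3` of a walk ending at index `s` gives `s + 3 + i₁ = i₀ + 3 + s`: the three
      -- edges close up to a triangle.
      · obtain rfl : i₁ = i₀ := by omega
        exact ⟨i₁, h0, k, h1, j, h2, h4, h5, h6, h7, h8⟩
  · rintro ⟨i, hi, k, hk, j, hj, h1, h2, h3, h4, h5⟩ S ⟨hf, ha, hb, hu⟩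
    simp only [loadGadget, ballast, List.cons_append, List.nil_append, List.mem_cons,
      forall_eq_or_imp] at hf
    obtain ⟨f1, f2, f3, f4, -⟩ := hf
    have chain : ∀ i < s, var s 0 (i + 1) ∈ S (var s 0 i) := fun i hi => by
      simpa [Line.Holds, add_comm] using f1 i (by omega)
    have tail : ∀ i < s, var s 6 (i + 1) ∈ S (var s 6 i) := fun i hi => by
      simpa [Line.Holds, add_comm] using f2 i (by omega)
    have start : var s 0 0 ∈ S (var s 7 0) := f3 0 (by omega)
    have step : ∀ m < s + 3, ∀ v ∈ S (var s 7 m), S v ⊆ S (var s 7 (m + 1)) := fun m hm => by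
      simpa [Line.Holds, add_comm] using f4 m (by omega)
    have ea := ha i hi k hk
    have eb := hb k hk j hj
    have eu := hu j hj i hi h4 h5
    rw [h1] at ea
    rw [h2] at eb
    rw [h3] at eu
    -- The walk of a triangle: `i` steps on the first chain, three edges, and `s - i` steps on the
    -- last chain.
    have c : ∀ i' ≤ i, var s 0 i' ∈ S (var s 7 i') := by
      intro i'
      induction i' with
      | zero => exact fun _ => start
      | succ i' ih => exact fun h => step i' (by omega) _ (ih (by omega)) (chain i' (by omega))
    have t : ∀ d, i + d ≤ s → var s 6 (i + d) ∈ S (var s 7 (i + 3 + d)) := by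
      intro d
      induction d with
      | zero =>
        exact fun _ => step (i + 2) (by omega) _ (step (i + 1) (by omega) _
          (step i (by omega) _ (c i le_rfl) ea) eb) eu
      | succ d ih =>
        exact fun h => step (i + 3 + d) (by omega) _ (ih (by omega)) (tail (i + d) (by omega))
    have := t (s - i) (by omega)
    change var s 6 (1 * s + 0) ∈ S (var s 7 (1 * s + 3))
    have e1 : i + (s - i) = 1 * s + 0 := by omega
    have e2 : i + 3 + (s - i) = 1 * s + 3 := by omega
    rwa [e1, e2] at this

/-! ### The gadget for stores: shifting pairs of pointers -/

section Store

variable (s : ℕ) (α β υ : ℕ → Bool) (lo hi : ℕ)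

def StorePath (a b : ℕ) : Prop :=
  ∃ k < s, ∃ j < s, α (a * s + k) = true ∧ β (k * s + j) = true ∧ υ (j * s + b) = true ∧
    lo ≤ j * s + b ∧ j * s + b < hi

/-- The refuting solution. Its invariant is that `r_a` points to `u_b` only if `(a + d, b + d)` is
joined by a path through the matrices for some `d`; the constructor `u` describes the intermediate
stage, where the first index has already been lowered and the second has not. The difference of
indices is preserved, so `(0, 0)` stems from a pair on the diagonal. -/
inductive StorePts : ℕ → ℕ → ℕ → ℕ → Prop
  | r {a b} (d) : a + d < s → b + d < s → StorePath s α β υ lo hi (a + d) (b + d) → StorePts 0 a 1 b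
  | u {a b} (d) : a + 1 + d < s → b + d < s → StorePath s α β υ lo hi (a + 1 + d) (b + d) →
      StorePts 1 b 0 a
  | rHat {i} : i < s → StorePts 2 i 0 i
  | mHat {k} : k < s → StorePts 4 k 8 k
  | l {j i} : j < s → i < s → υ (j * s + i) = true → lo ≤ j * s + i → j * s + i < hi →
      StorePts 6 j 1 i
  | l' {j i} : j < s → i < s → StorePts 7 j 1 i
  | m {k i j} : k < s → j < s → i < s → β (k * s + j) = true → υ (j * s + i) = true →
      lo ≤ j * s + i → j * s + i < hi → StorePts 8 k 1 i
  | y {k} : k < s → StorePts 9 k 1 k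
  | ballast : StorePts 10 0 10 0

end Store

theorem storeGadget_detects (ks : List Kind) : (storeGadget ks).Detects := by
  intro s α β υ lo m hs hm
  simp only [Gadget.holds_iff hs hm]
  constructor
  · intro h
    have := h (blockSets s (StorePts s α β υ lo (lo + m))) (by
      refine ⟨?_, ?_, ?_, ?_⟩
      · simp only [storeGadget, ballast, List.cons_append, List.nil_append, List.mem_cons,
          List.mem_map]
        rintro f (rfl | rfl | rfl | rfl | rfl | ⟨κ, -, rfl⟩) i hi <;> dsimp only at hi ⊢
        · exact holds_blockSets (by omega) (by omega) (by simpa using .rHat (by omega))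
        · exact holds_blockSets (by omega) (by omega) (by simpa using .mHat (by omega))
        · refine holds_blockSets (by omega) (by omega) ?_
          rintro c j d k h h'
          simp only [zero_add] at h'
          cases h' with | rHat _ => ?_
          cases h with | r e h1 h2 h3 => ?_
          exact .u e (by omega) h2 (by convert h3 using 1; omega)
        · exact holds_blockSets (by omega) (by omega) (by simpa using .y (by omega))
        · refine holds_blockSets (by omega) (by omega) ?_
          rintro c j d k h h'
          simp only [zero_add] at h'
          cases h' with | y _ => ?_
          cases h with | u e h1 h2 h3 => ?_
          -- Both indices have now been lowered by one, so the common shift grows by one.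
          refine .r (e + 1) (by omega) (by omega) ?_
          convert h3 using 1 <;> omega
        · obtain rfl : i = 0 := by omega
          refine holds_blockSets (by omega) (by omega) ?_
          cases κ with
          | addr => exact .ballast
          | copy => exact fun c j h => h
          | load =>
            rintro c j d k h h'
            cases h
            exact h'
          | store =>
            rintro c j d k h h'
            cases h
            exact h'
      · intro i hi k hk
        refine holds_blockSets (by omega) (by omega) ?_
        intro c j d e h h'
        cases hα : α (i * s + k) <;> simp only [storeGadget, hα] at h h'
        · cases h
        · cases h with | rHat _ => ?_
          cases h' with | m _ h2 h3 h4 h5 h6 h7 => ?_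
          exact .r 0 hi h3 ⟨k, hk, _, h2, hα, h4, h5, h6, h7⟩
      · intro i hi k hk
        refine holds_blockSets (by omega) (by omega) ?_
        intro c j d e h h'
        cases hβ : β (i * s + k) <;> simp only [storeGadget, hβ] at h h'
        · cases h
        · cases h with | mHat _ => ?_
          cases h' with | l _ h2 h3 h4 h5 => ?_
          exact .m hi hk h2 hβ h3 h4 h5
      · intro i hi k hk h1 h2
        refine holds_blockSets (by omega) (by omega) ?_
        cases h : υ (i * s + k)
        · exact .l' hi hk
        · exact .l hi hk h h1 h2)
    change var s 1 (0 * s + 0) ∈ blockSets s _ (var s 0 (0 * s + 0)) at this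
    rw [mem_blockSets (by omega) (by omega)] at this
    simp only [zero_mul, add_zero] at this
    cases this with
    | r d h1 h2 h3 =>
      obtain ⟨k, hk, j, hj, h4, h5, h6, h7, h8⟩ := h3
      exact ⟨0 + d, h1, k, hk, j, hj, h4, h5, h6, h7, h8⟩
  · rintro ⟨i, hi, k, hk, j, hj, h1, h2, h3, h4, h5⟩ S ⟨hf, ha, hb, hu⟩
    simp only [storeGadget, ballast, List.cons_append, List.nil_append, List.mem_cons,
      forall_eq_or_imp] at hf
    obtain ⟨f1, f2, f3, f4, f5, -⟩ := hf
    have rhat : ∀ i < s, var s 0 i ∈ S (var s 2 i) := fun i hi => by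
      simpa [Line.Holds] using f1 i (by omega)
    have mhat : ∀ i < s, var s 8 i ∈ S (var s 4 i) := fun i hi => by
      simpa [Line.Holds] using f2 i (by omega)
    have rst : ∀ i < s, ∀ v ∈ S (var s 0 (i + 1)), S (var s 2 i) ⊆ S v := fun i hi => by
      simpa [Line.Holds, add_comm] using f3 i (by omega)
    have yy : ∀ i < s, var s 1 i ∈ S (var s 9 i) := fun i hi => by
      simpa [Line.Holds] using f4 i (by omega)
    have ust : ∀ i < s, ∀ v ∈ S (var s 1 (i + 1)), S (var s 9 i) ⊆ S v := fun i hi => by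
      simpa [Line.Holds, add_comm] using f5 i (by omega)
    have ea := ha i hi k hk
    have eb := hb k hk j hj
    have eu := hu j hj i hi h4 h5
    rw [h1] at ea
    rw [h2] at eb
    rw [h3] at eu
    -- The triangle passes `u_i` from `l_j` to `m_k` and on to `r_i`.
    have base : var s 1 i ∈ S (var s 0 i) := ea _ (rhat i hi) (eb _ (mhat k hk) eu)
    have down : ∀ d ≤ i, var s 1 (i - d) ∈ S (var s 0 (i - d)) := by
      intro d
      induction d with
      | zero => exact fun _ => base
      | succ d ih =>
        intro hd
        have h := ih (by omega)
        have e : i - d = i - (d + 1) + 1 := by omega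
        rw [e] at h
        -- As `r_{a+1}` points to `u_{a+1}`, the first shift makes `u_{a+1}` point to `r_a`, and
        -- then the second makes `r_a` point to `u_a`.
        exact ust (i - (d + 1)) (by omega) _ (rst (i - (d + 1)) (by omega) _ h
          (rhat (i - (d + 1)) (by omega))) (yy (i - (d + 1)) (by omega))
    have := down i le_rfl
    change var s 1 (0 * s + 0) ∈ S (var s 0 (0 * s + 0))
    simpa using this

theorem exists_gadget {T : Set Kind} (h1 : Kind.addr ∈ T) (h2 : Kind.load ∈ T ∨ Kind.store ∈ T) :
    ∃ g : Gadget, g.WellFormed T ∧ g.Detects := by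
  classical
  have hn : ([Kind.addr, Kind.copy, Kind.load, Kind.store].filter (· ∈ T)).Nodup :=
    List.Nodup.filter _ (by simp)
  have hks : ∀ κ, κ ∈ [Kind.addr, Kind.copy, Kind.load, Kind.store].filter (· ∈ T) ↔ κ ∈ T := by
    intro κ
    simp only [List.mem_filter, decide_eq_true_eq, and_iff_right_iff_imp]
    cases κ <;> simp
  rcases h2 with h2 | h2
  · exact ⟨_, loadGadget_wellFormed hn hks h1 h2, loadGadget_detects _⟩
  · exact ⟨_, storeGadget_wellFormed hn hks h1 h2, storeGadget_detects _⟩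

/-! ### Building lists in memory -/

instance : Add Expr := ⟨Expr.bin BinOp.add⟩
instance : Sub Expr := ⟨Expr.bin BinOp.sub⟩
instance : Mul Expr := ⟨Expr.bin BinOp.mul⟩
instance : Div Expr := ⟨Expr.bin BinOp.div⟩
instance : Mod Expr := ⟨Expr.bin BinOp.mod⟩
instance (c : ℕ) : OfNat Expr c := ⟨Expr.const c⟩

/-- The comparison of two expressions. -/
def Expr.lt (x y : Expr) : Expr := Expr.bin BinOp.lt x y

section Val

variable (s : State) (x y : Expr) (c r : ℕ)

@[simp] theorem Expr.val_add : (x + y).val s = x.val s + y.val s := rfl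
@[simp] theorem Expr.val_sub : (x - y).val s = x.val s - y.val s := rfl
@[simp] theorem Expr.val_mul : (x * y).val s = x.val s * y.val s := rfl
@[simp] theorem Expr.val_div : (x / y).val s = x.val s / y.val s := rfl
@[simp] theorem Expr.val_mod : (x % y).val s = x.val s % y.val s := rfl
@[simp] theorem Expr.val_lt' : (x.lt y).val s = if x.val s < y.val s then 1 else 0 := rfl
@[simp] theorem Expr.val_const : (Expr.const c).val s = c := rfl
@[simp] theorem Expr.val_ofNat : (ofNat(c) : Expr).val s = c := rfl
@[simp] theorem Expr.val_reg : (Expr.reg r).val s = s.reg r := rfl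
@[simp] theorem Expr.val_read : (Expr.read x).val s = s.mem (x.val s) := rfl

@[simp] theorem Expr.tame_add : (x + y).Tame ↔ x.Tame ∧ y.Tame := by
  change True ∧ _ ↔ _; simp
@[simp] theorem Expr.tame_sub : (x - y).Tame ↔ x.Tame ∧ y.Tame := by
  change True ∧ _ ↔ _; simp
@[simp] theorem Expr.tame_mul : (x * y).Tame ↔ x.Tame ∧ y.Tame := by
  change True ∧ _ ↔ _; simp
@[simp] theorem Expr.tame_div : (x / y).Tame ↔ x.Tame ∧ y.Tame := by
  change True ∧ _ ↔ _; simp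
@[simp] theorem Expr.tame_mod : (x % y).Tame ↔ x.Tame ∧ y.Tame := by
  change True ∧ _ ↔ _; simp
@[simp] theorem Expr.tame_lt : (x.lt y).Tame ↔ x.Tame ∧ y.Tame := by
  change True ∧ _ ↔ _; simp
@[simp] theorem Expr.tame_const : (Expr.const c).Tame := trivial
@[simp] theorem Expr.tame_ofNat : (ofNat(c) : Expr).Tame := trivial
@[simp] theorem Expr.tame_reg : (Expr.reg r).Tame := trivial
@[simp] theorem Expr.tame_read : (Expr.read x).Tame ↔ x.Tame := Iff.rfl

end Val

@[simp] theorem length_cells (mem : ℕ → ℕ) (a m : ℕ) : (cells mem a m).length = m := by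
  simp [cells]

theorem cells_add (mem : ℕ → ℕ) (a m m' : ℕ) :
    cells mem a (m + m') = cells mem a m ++ cells mem (a + m) m' := by
  simp [cells, List.range_add, Function.comp_def, add_assoc]

theorem cells_congr {mem mem' : ℕ → ℕ} {a m : ℕ} (h : ∀ x, a ≤ x → x < a + m → mem' x = mem x) :
    cells mem' a m = cells mem a m := by
  refine List.map_congr_left fun i hi => ?_
  rw [List.mem_range] at hi
  exact h _ (by omega) (by omega)

theorem cells_one (mem : ℕ → ℕ) (a : ℕ) : cells mem a 1 = [mem a] := by simp [cells]

theorem cells_three (mem : ℕ → ℕ) (a : ℕ) :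
    cells mem a 3 = [mem a, mem (a + 1), mem (a + 2)] := by
  simp [cells, List.range_succ]

/-- From `s` to `s'` the list `l` has been appended at the address in register `5`; register `6`
has been used as a counter. -/
structure Emitted (V : ℕ) (l : List ℕ) (s s' : State) : Prop where
  good : s'.Good V
  reg : ∀ r, r ≠ 5 → r ≠ 6 → s'.reg r = s.reg r
  ptr : s'.reg 5 = s.reg 5 + l.length
  mem : ∀ a < s.reg 5, s'.mem a = s.mem a
  cells : cells s'.mem (s.reg 5) l.length = l

theorem Emitted.nil {V : ℕ} {s : State} (hs : s.Good V) : Emitted V [] s s :=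
  ⟨hs, fun _ _ _ => rfl, rfl, fun _ _ => rfl, rfl⟩

theorem Emitted.trans {V : ℕ} {l l' : List ℕ} {s s' s'' : State} (h : Emitted V l s s')
    (h' : Emitted V l' s' s'') : Emitted V (l ++ l') s s'' where
  good := h'.good
  reg r h5 h6 := (h'.reg r h5 h6).trans (h.reg r h5 h6)
  ptr := by rw [h'.ptr, h.ptr, List.length_append, add_assoc]
  mem a ha := (h'.mem a (by rw [h.ptr]; omega)).trans (h.mem a ha)
  cells := by
    have h1 := h.cells
    have h2 := h'.cells
    rw [List.length_append, cells_add, ← h.ptr, h2]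
    congr 1
    refine (cells_congr fun x _ hx => h'.mem x ?_).trans h1
    rw [h.ptr]; omega

/-- Code that appends the values of some expressions. -/
def emit : List Expr → Cmd
  | [] => Cmd.skip
  | e :: es => Cmd.seq (Cmd.write (Expr.reg 5) e)
      (Cmd.seq (Cmd.assign 5 (Expr.reg 5 + 1)) (emit es))

/-- The pointer and the memory from it on change during the output, so the values must be the same
in all states that differ only in register `5` and in the cells from `p₀` on. In a loop, `p₀` stays
at the beginning of the whole output. -/
theorem emit_spec {V : ℕ} {orc : List ℕ → ℕ → Prop} {es : List Expr} {vs : List ℕ} {s : State}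
    (hs : s.Good V) (p₀ : ℕ) (hp : p₀ ≤ s.reg 5) (hend : s.reg 5 + vs.length < V)
    (hvs : ∀ v ∈ vs, v < V)
    (h : ∀ s' : State, (∀ r, r ≠ 5 → s'.reg r = s.reg r) → (∀ a < p₀, s'.mem a = s.mem a) →
      es.map (Expr.val s') = vs) :
    Halts V orc (emit es) s fun s' t =>
      Emitted V vs s s' ∧ s'.reg 6 = s.reg 6 ∧ t = 2 * vs.length + 1 := by
  induction es generalizing s vs with
  | nil =>
    obtain rfl := h s (fun _ _ => rfl) (fun _ _ => rfl)
    exact Halts.skip ⟨.nil hs, rfl, rfl⟩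
  | cons e es ih =>
    have h0 := h s (fun _ _ => rfl) (fun _ _ => rfl)
    obtain ⟨v, vs, rfl⟩ : ∃ v vs', vs = v :: vs' := ⟨_, _, h0.symm⟩
    have hv : e.val s = v := by simpa using congrArg List.head? h0
    simp only [List.length_cons] at hend
    have hvV : v < V := hvs v List.mem_cons_self
    have g1 := hs.set_mem (s.reg 5) hvV
    have g2 := g1.set_reg 5 (x := s.reg 5 + 1) (by omega)
    refine Halts.write_seq hs ?_
    simp only [Expr.val_reg, hv]
    refine Halts.assign_seq g1 ?_
    simp only [Expr.val_reg, Expr.val_add, Expr.val_ofNat]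
    refine (ih (vs := vs) g2 (by simp; omega) (by simp; omega)
      (fun v hv => hvs v (List.mem_cons_of_mem _ hv)) ?_).imp ?_
    · intro s' h1 h2
      have := h s' (fun r hr => by rw [h1 r hr]; simp [hr])
        (fun a ha => by rw [h2 a ha]; simp [(show a ≠ s.reg 5 by omega)])
      simpa using congrArg List.tail this
    · rintro s' t ⟨he, h6, rfl⟩
      have hfirst : Emitted V [v] s ⟨update s.reg 5 (s.reg 5 + 1), update s.mem (s.reg 5) v⟩ := by
        refine ⟨g2, fun r hr _ => by simp [hr], by simp, fun a ha => ?_, ?_⟩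
        · simp [(show a ≠ s.reg 5 by omega)]
        · simp [cells_one]
      refine ⟨hfirst.trans he, by rw [h6]; simp, ?_⟩
      simp only [List.length_cons]; omega

/-- Code that appends the values of some expressions for all values of register `6` below a
bound. -/
def emitLoop (cnt : Expr) (es : List Expr) : Cmd :=
  Cmd.seq (Cmd.assign 6 0)
    (Cmd.loop ((Expr.reg 6).lt cnt) (Cmd.seq (emit es) (Cmd.assign 6 (Expr.reg 6 + 1))))

theorem length_flatMap_range {f : ℕ → List ℕ} {k : ℕ} (c : ℕ) (hf : ∀ x < c, (f x).length = k) :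
    ((List.range c).flatMap f).length = c * k := by
  induction c with
  | zero => simp
  | succ c ih =>
    simp [List.range_succ, List.flatMap_append, ih fun x hx => hf x (by omega), hf c (by omega)]
    ring

theorem emitLoop_spec {V : ℕ} {orc : List ℕ → ℕ → Prop} {cnt : Expr} {es : List Expr} {s : State}
    (hs : s.Good V) (c : ℕ) (f : ℕ → List ℕ) (hend : s.reg 5 + c * es.length < V) (hcV : c < V)
    (hc : ∀ s' : State, (∀ r, r ≠ 5 → r ≠ 6 → s'.reg r = s.reg r) →
      (∀ a < s.reg 5, s'.mem a = s.mem a) → cnt.val s' = c)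
    (h : ∀ x < c, ∀ s' : State, (∀ r, r ≠ 5 → r ≠ 6 → s'.reg r = s.reg r) → s'.reg 6 = x →
      (∀ a < s.reg 5, s'.mem a = s.mem a) → es.map (Expr.val s') = f x)
    (hfV : ∀ x < c, ∀ v ∈ f x, v < V) :
    Halts V orc (emitLoop cnt es) s fun s' t =>
      Emitted V ((List.range c).flatMap f) s s' ∧ t ≤ c * (2 * es.length + 3) + 2 := by
  have hlen : ∀ x < c, (f x).length = es.length := by
    intro x hx
    have := h x hx ⟨update s.reg 6 x, s.mem⟩ (fun r _ hr => by simp [hr]) (by simp) (fun _ _ => rfl)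
    rw [← this, List.length_map]
  have g0 := hs.set_reg 6 (x := 0) (by omega)
  refine Halts.assign_seq hs ?_
  simp only [Expr.val_ofNat]
  -- A round takes `2 * es.length + 1` steps for the output and one each for the increment and the
  -- test.
  refine Halts.loop (fun s' k m => ∃ x ≤ c, Emitted V ((List.range x).flatMap f) s s' ∧
    s'.reg 6 = x ∧ k = x * (2 * es.length + 3) ∧ m = c - x) (m := c)
    ⟨0, Nat.zero_le _, ?_, by simp, by simp, rfl⟩ ?_ ?_ ?_
  · exact ⟨g0, fun r _ hr => by simp [hr], by simp, fun _ _ => rfl, rfl⟩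
  · rintro s' k m ⟨x, _, he, -⟩
    exact he.good
  · rintro s' k m ⟨x, hx, he, h6, rfl, rfl⟩ hne
    have hlt : x < c := by
      by_contra hcon
      apply hne
      simp [hc s' he.reg he.mem, h6]
      omega
    have hl := length_flatMap_range x (f := f) (k := es.length) fun y hy => hlen y (by omega)
    have hp := he.ptr
    rw [hl] at hp
    have hxc : (x + 1) * es.length ≤ c * es.length := Nat.mul_le_mul_right _ hlt
    rw [add_mul, one_mul] at hxc
    refine Halts.seq ((emit_spec (vs := f x) he.good (s.reg 5) (by omega)
      (by rw [hlen x hlt]; omega) (hfV x hlt) ?_).imp ?_)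
    · intro s'' h1 h2
      refine h x hlt s'' (fun r h5 h6 => (h1 r h5).trans (he.reg r h5 h6))
        ((h1 6 (by omega)).trans h6) (fun a ha => (h2 a ha).trans (he.mem a ha))
    · rintro s'' t ⟨he', h6', rfl⟩
      refine Halts.assign he'.good ⟨c - (x + 1), by omega, x + 1, hlt, ?_, ?_, ?_, rfl⟩
      · have := he.trans he'
        rw [List.range_succ, List.flatMap_append, List.flatMap_singleton]
        exact ⟨this.good.set_reg 6 (by simp only [Expr.val_add, Expr.val_reg, Expr.val_ofNat]; omega),
          fun r h5 h6 => by simp only [update_of_ne h6]; exact this.reg r h5 h6,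
          by simp only [update_of_ne (show (5 : ℕ) ≠ 6 by omega)]; exact this.ptr,
          this.mem, this.cells⟩
      · simp [h6', h6]
      · rw [hlen x hlt]; ring
  · rintro s' k m ⟨x, hx, he, h6, rfl, rfl⟩ h0
    have : x = c := by
      by_contra hcon
      have hlt : x < c := by omega
      simp [hc s' he.reg he.mem, h6, hlt] at h0
    subst this
    exact ⟨he, by omega⟩

/-! ### The search for triangles -/

/-- The encoding of a statement. -/
def words (ℓ : Line) : List ℕ := [ℓ.1.code, ℓ.2.1, ℓ.2.2]

/-- The encoding of the part of a query that does not depend on the matrices. -/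
def Gadget.words (g : Gadget) (s : ℕ) : List ℕ :=
  g.size s :: g.p s :: g.q s :: (g.fams.flatMap fun f => f.lines s).flatMap DemandPT.words

theorem Gadget.encode_lines (g : Gadget) (s : ℕ) (α β υ : ℕ → Bool) (lo m : ℕ) :
    (g.size s :: g.p s :: g.q s ::
      (g.lines s α β υ lo m).flatMap fun ℓ => [ℓ.1.code, ℓ.2.1, ℓ.2.2]) =
    g.words s ++ ((g.a.lines s α 0 (s * s)).flatMap DemandPT.words ++
      ((g.b.lines s β 0 (s * s)).flatMap DemandPT.words ++
        (g.u.lines s υ lo m).flatMap DemandPT.words)) := by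
  simp [Gadget.words, Gadget.lines, List.flatMap_append]
  rfl

/-- A table is stored block by block, three words per entry. Hence the encoded statements of any
range of entries in one block form a contiguous segment, which can be passed by reference. -/
theorem cells_lines {mem : ℕ → ℕ} {d : Slots} {s base : ℕ} (bit : ℕ → Bool) {lo m c : ℕ}
    (hlo : lo + m ≤ s * s) (h : ∀ z < s * s,
      cells mem (base + 3 * (c * (s * s) + z)) 3 =
        words (d.line s (bit (c * (s * s) + z)) ((c * (s * s) + z) % (s * s)))) :
    cells mem (base + 3 * (c * (s * s) + lo)) (3 * m) =
      (d.lines s (fun z => bit (c * (s * s) + z)) lo m).flatMap words := by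
  induction m with
  | zero => simp [Slots.lines, cells]
  | succ m ih =>
    have e : base + 3 * (c * (s * s) + lo) + 3 * m = base + 3 * (c * (s * s) + (lo + m)) := by ring
    rw [Nat.mul_succ, cells_add, ih (by omega), e, h _ (by omega), Slots.lines, Slots.lines,
      List.range_succ, List.map_append, List.flatMap_append]
    have e' : (c * (s * s) + (lo + m)) % (s * s) = lo + m := block_mod (by omega)
    simp [e']

/-- The state between the construction of the tables and the output: the registers hold the
parameters, and the memory from `G` on holds the fixed part of the queries and the tables for
`α`, `β` and `υ`. -/
structure Env (g : Gadget) (V n s t G H : ℕ) (α β υ : ℕ → Bool) (st : State) : Prop where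
  good : st.Good V
  r1 : st.reg 1 = n
  r2 : st.reg 2 = s
  r3 : st.reg 3 = width s
  r4 : st.reg 4 = t
  r5 : st.reg 5 = H + 9 * (t * t * (s * s))
  r7 : st.reg 7 = G
  r8 : st.reg 8 = H - G
  r9 : st.reg 9 = H
  r10 : st.reg 10 = H + 3 * (t * t * (s * s))
  r11 : st.reg 11 = H + 6 * (t * t * (s * s))
  fixed : cells st.mem G (H - G) = g.words s
  a : ∀ x < t * t * (s * s), cells st.mem (H + 3 * x) 3 = words (g.a.line s (α x) (x % (s * s)))
  b : ∀ x < t * t * (s * s), cells st.mem (H + 3 * (t * t * (s * s)) + 3 * x) 3 =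
    words (g.b.line s (β x) (x % (s * s)))
  u : ∀ x < t * t * (s * s), cells st.mem (H + 6 * (t * t * (s * s)) + 3 * x) 3 =
    words (g.u.line s (υ x) (x % (s * s)))

/-- The numbers of the blocks that belong to the triple with number `y`. -/
def blockA (t y : ℕ) : ℕ := y / (t * t) * t + y / t % t
def blockB (t y : ℕ) : ℕ := y / t % t * t + y % t
def blockU (t y : ℕ) : ℕ := y % t * t + y / (t * t)

theorem block_lt_of_lt {t y : ℕ} (hy : y < t * t * t) :
    blockA t y < t * t ∧ blockB t y < t * t ∧ blockU t y < t * t := by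
  have ht : 0 < t := by
    rcases Nat.eq_zero_or_pos t with rfl | h
    · simp at hy
    · exact h
  have h1 : y / (t * t) < t := Nat.div_lt_of_lt_mul hy
  have h2 : y / t % t < t := Nat.mod_lt _ ht
  have h3 : y % t < t := Nat.mod_lt _ ht
  exact ⟨block_lt h2 h1, block_lt h3 h2, block_lt h1 h3⟩

/-- There is a triangle in the blocks of the triple `y`. -/
def TriangleAt (s t : ℕ) (α β υ : ℕ → Bool) (y lo hi : ℕ) : Prop :=
  Triangle s (fun z => α (blockA t y * (s * s) + z)) (fun z => β (blockB t y * (s * s) + z))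
    (fun z => υ (blockU t y * (s * s) + z)) lo hi

/-- The state during the search in the blocks of the triple `y`. -/
structure Local (g : Gadget) (V n s t G H : ℕ) (α β υ : ℕ → Bool) (y lo hi : ℕ) (st : State) : Prop
    extends Env g V n s t G H α β υ st where
  r12 : st.reg 12 = y
  r13 : st.reg 13 = H + 3 * (blockA t y * (s * s))
  r14 : st.reg 14 = H + 3 * (t * t * (s * s)) + 3 * (blockB t y * (s * s))
  r15 : st.reg 15 = H + 6 * (t * t * (s * s)) + 3 * (blockU t y * (s * s))
  r16 : st.reg 16 = lo
  r17 : st.reg 17 = hi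

/-- The registers that hold the parameters. -/
abbrev sReg : Expr := Expr.reg 2
abbrev tReg : Expr := Expr.reg 4

/-- The query about the current range. -/
def queryCmd : Cmd :=
  Cmd.call 19 [(Expr.reg 7, Expr.reg 8), (Expr.reg 13, 3 * (sReg * sReg)),
    (Expr.reg 14, 3 * (sReg * sReg)),
    (Expr.reg 15 + 3 * Expr.reg 16, 3 * (Expr.reg 17 - Expr.reg 16))]

/-- Binary search for a triangle. -/
def searchCmd : Cmd :=
  Cmd.loop (Expr.lt 1 (Expr.reg 17 - Expr.reg 16))
    (Cmd.seq (Cmd.assign 18 (Expr.reg 17))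
      (Cmd.seq (Cmd.assign 17 ((Expr.reg 16 + Expr.reg 17) / 2))
        (Cmd.seq queryCmd
          (Cmd.cond (Expr.reg 19) Cmd.skip
            (Cmd.seq (Cmd.assign 16 (Expr.reg 17)) (Cmd.assign 17 (Expr.reg 18)))))))

/-- The query about all of the current blocks. -/
def fullQueryCmd : Cmd :=
  Cmd.seq (Cmd.assign 16 0) (Cmd.seq (Cmd.assign 17 (sReg * sReg)) queryCmd)

/-- The removal of the edge that has been found. -/
def markCmd : Cmd :=
  Cmd.write (Expr.reg 15 + 3 * Expr.reg 16 + 1)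
    (Expr.read (Expr.reg 15 + 3 * Expr.reg 16 + 1) + Expr.reg 3)

/-- The search in the blocks of a triple. -/
def tripleCmd : Cmd :=
  Cmd.seq (Cmd.assign 13 (Expr.reg 9 + 3 * ((Expr.reg 12 / (tReg * tReg) * tReg +
      Expr.reg 12 / tReg % tReg) * (sReg * sReg))))
    (Cmd.seq (Cmd.assign 14 (Expr.reg 10 + 3 * ((Expr.reg 12 / tReg % tReg * tReg +
        Expr.reg 12 % tReg) * (sReg * sReg))))
      (Cmd.seq (Cmd.assign 15 (Expr.reg 11 + 3 * ((Expr.reg 12 % tReg * tReg +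
          Expr.reg 12 / (tReg * tReg)) * (sReg * sReg))))
        (Cmd.seq fullQueryCmd
          (Cmd.loop (Expr.reg 19) (Cmd.seq searchCmd (Cmd.seq markCmd fullQueryCmd))))))

/-- The search in all triples of blocks. -/
def triplesCmd : Cmd :=
  Cmd.seq (Cmd.assign 12 0)
    (Cmd.loop ((Expr.reg 12).lt (tReg * tReg * tReg))
      (Cmd.seq tripleCmd (Cmd.assign 12 (Expr.reg 12 + 1))))

/-! ### Correctness and cost of the search -/

section

variable {g : Gadget} {V n s t G H : ℕ} {α β υ : ℕ → Bool} {y lo hi : ℕ} {st : State}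

theorem Env.set_reg (h : Env g V n s t G H α β υ st) (r : ℕ) (hr : 12 ≤ r) {x : ℕ} (hx : x < V) :
    Env g V n s t G H α β υ ⟨update st.reg r x, st.mem⟩ := by
  have e : ∀ i < 12, update st.reg r x i = st.reg i := fun i hi => by
    rw [update_of_ne (by omega)]
  exact ⟨h.good.set_reg r hx, (e 1 (by omega)).trans h.r1, (e 2 (by omega)).trans h.r2,
    (e 3 (by omega)).trans h.r3, (e 4 (by omega)).trans h.r4, (e 5 (by omega)).trans h.r5,
    (e 7 (by omega)).trans h.r7, (e 8 (by omega)).trans h.r8, (e 9 (by omega)).trans h.r9,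
    (e 10 (by omega)).trans h.r10, (e 11 (by omega)).trans h.r11, h.fixed, h.a, h.b, h.u⟩

theorem Local.set_reg (h : Local g V n s t G H α β υ y lo hi st) (r : ℕ) (hr : 18 ≤ r) {x : ℕ}
    (hx : x < V) : Local g V n s t G H α β υ y lo hi ⟨update st.reg r x, st.mem⟩ := by
  have e : ∀ i < 18, update st.reg r x i = st.reg i := fun i hi => by
    rw [update_of_ne (by omega)]
  exact ⟨h.toEnv.set_reg r (by omega) hx, (e 12 (by omega)).trans h.r12,
    (e 13 (by omega)).trans h.r13, (e 14 (by omega)).trans h.r14, (e 15 (by omega)).trans h.r15,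
    (e 16 (by omega)).trans h.r16, (e 17 (by omega)).trans h.r17⟩

theorem Local.set_lo (h : Local g V n s t G H α β υ y lo hi st) {x : ℕ} (hx : x < V) :
    Local g V n s t G H α β υ y x hi ⟨update st.reg 16 x, st.mem⟩ :=
  ⟨h.toEnv.set_reg 16 (by omega) hx, by simpa using h.r12, by simpa using h.r13,
    by simpa using h.r14, by simpa using h.r15, by simp, by simpa using h.r17⟩

theorem Local.set_hi (h : Local g V n s t G H α β υ y lo hi st) {x : ℕ} (hx : x < V) :
    Local g V n s t G H α β υ y lo x ⟨update st.reg 17 x, st.mem⟩ :=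
  ⟨h.toEnv.set_reg 17 (by omega) hx, by simpa using h.r12, by simpa using h.r13,
    by simpa using h.r14, by simpa using h.r15, by simpa using h.r16, by simp⟩

open Classical in
/-- The procedure answers triangle queries. -/
def Answers (g : Gadget) (s : ℕ) (orc : List ℕ → ℕ → Prop) : Prop :=
  ∀ (α β υ : ℕ → Bool) (lo m : ℕ), lo + m ≤ s * s →
    orc (g.words s ++ ((g.a.lines s α 0 (s * s)).flatMap words ++
      ((g.b.lines s β 0 (s * s)).flatMap words ++ (g.u.lines s υ lo m).flatMap words)))
      (if Triangle s α β υ lo (lo + m) then 1 else 0)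

variable {orc : List ℕ → ℕ → Prop}

theorem query_spec (horc : Answers g s orc) (h : Local g V n s t G H α β υ y lo hi st)
    (hy : y < t * t * t) (hlo : lo ≤ hi) (hhi : hi ≤ s * s) (hV : 1 < V) :
    Halts V orc queryCmd st fun st' k => k = 1 ∧ Local g V n s t G H α β υ y lo hi st' ∧
      (st'.reg 19 ≠ 0 ↔ TriangleAt s t α β υ y lo hi) ∧ st'.reg 18 = st.reg 18 := by
  classical
  obtain ⟨h1, h2, h3⟩ := block_lt_of_lt hy
  refine Halts.call (y := if TriangleAt s t α β υ y lo hi then 1 else 0) h.good ?_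
    ⟨rfl, h.set_reg 19 (by omega) (by split_ifs <;> omega), by simp, by simp⟩
  have := horc (fun z => α (blockA t y * (s * s) + z)) (fun z => β (blockB t y * (s * s) + z))
    (fun z => υ (blockU t y * (s * s) + z)) lo (hi - lo) (by omega)
  rw [Nat.add_sub_cancel' hlo] at this
  convert this using 1
  swap
  · rfl
  have ea := cells_lines (mem := st.mem) (d := g.a) (base := H) (c := blockA t y) α
    (lo := 0) (m := s * s) (by omega) fun z hz => h.a _ (block_lt hz h1)
  have eb := cells_lines (mem := st.mem) (d := g.b) (base := H + 3 * (t * t * (s * s)))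
    (c := blockB t y) β (lo := 0) (m := s * s) (by omega) fun z hz => h.b _ (block_lt hz h2)
  have eu := cells_lines (mem := st.mem) (d := g.u) (base := H + 6 * (t * t * (s * s)))
    (c := blockU t y) υ (lo := lo) (m := hi - lo) (by omega) fun z hz => h.u _ (block_lt hz h3)
  rw [add_zero] at ea eb
  rw [mul_add, ← add_assoc] at eu
  simp only [List.flatMap_cons, List.flatMap_nil, Expr.val_reg, Expr.val_add, Expr.val_mul,
    Expr.val_ofNat, Expr.val_sub, h.r7, h.r8, h.r2, h.r13, h.r14, h.r15, h.r16, h.r17, h.fixed,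
    List.append_nil, ea, eb, eu]

theorem Triangle.split {s : ℕ} {α β υ : ℕ → Bool} {lo hi : ℕ} (mid : ℕ)
    (h : Triangle s α β υ lo hi) : Triangle s α β υ lo mid ∨ Triangle s α β υ mid hi := by
  obtain ⟨i, hi, k, hk, j, hj, h1, h2, h3, h4, h5⟩ := h
  rcases lt_or_ge (j * s + i) mid with h | h
  · exact Or.inl ⟨i, hi, k, hk, j, hj, h1, h2, h3, h4, h⟩
  · exact Or.inr ⟨i, hi, k, hk, j, hj, h1, h2, h3, h, h5⟩

theorem Triangle.lt {s : ℕ} {α β υ : ℕ → Bool} {lo hi : ℕ} (h : Triangle s α β υ lo hi) :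
    lo < hi := by
  obtain ⟨i, hi, k, hk, j, hj, h1, h2, h3, h4, h5⟩ := h
  omega

/-- The current range always contains an edge on a triangle; when its length is `1`, that edge is
found. Each halving lowers the ceiling of the logarithm of the length by at least one and takes at
most seven steps. -/
theorem search_spec (horc : Answers g s orc) (h : Local g V n s t G H α β υ y lo hi st)
    (hy : y < t * t * t) (hhi : hi ≤ s * s) (hV : s * s + 1 < V)
    (hT : TriangleAt s t α β υ y lo hi) :
    Halts V orc searchCmd st fun st' k => k ≤ 7 * Nat.clog 2 (hi - lo) + 1 ∧
      ∃ z < s * s, Local g V n s t G H α β υ y z (z + 1) st' ∧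
        TriangleAt s t α β υ y z (z + 1) := by
  refine Halts.loop (fun st' k m => ∃ lo' hi', Local g V n s t G H α β υ y lo' hi' st' ∧
    hi' ≤ s * s ∧ TriangleAt s t α β υ y lo' hi' ∧
    k + 7 * Nat.clog 2 (hi' - lo') ≤ 7 * Nat.clog 2 (hi - lo) ∧ m = hi' - lo') (m := hi - lo)
    ⟨lo, hi, h, hhi, hT, by omega, rfl⟩ ?_ ?_ ?_
  · rintro st' k m ⟨lo', hi', h', -⟩
    exact h'.good
  · rintro st' k m ⟨lo', hi', h', hhi', hT', hk, rfl⟩ hne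
    have hgap : 1 < hi' - lo' := by
      by_contra hcon
      apply hne
      simp [h'.r16, h'.r17]
      omega
    -- Both halves have at most `(hi' - lo' + 1) / 2` elements.
    have hclog : Nat.clog 2 (hi' - lo') = Nat.clog 2 ((hi' - lo' + 1) / 2) + 1 := by
      rw [Nat.clog_of_two_le (by omega) (by omega)]
      simp
    obtain ⟨mid, hmid⟩ : ∃ mid, mid = (lo' + hi') / 2 := ⟨_, rfl⟩
    have c1 : Nat.clog 2 (mid - lo') ≤ Nat.clog 2 ((hi' - lo' + 1) / 2) :=
      Nat.clog_mono_right 2 (by omega)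
    have c2 : Nat.clog 2 (hi' - mid) ≤ Nat.clog 2 ((hi' - lo' + 1) / 2) :=
      Nat.clog_mono_right 2 (by omega)
    refine Halts.assign_seq_eq h'.good (x := hi') (by simp [h'.r17]) fun s1 e1 => ?_
    have l1 := e1 ▸ h'.set_reg 18 le_rfl (x := hi') (by omega)
    refine Halts.assign_seq_eq l1.good (x := mid) (by simp [l1.r16, l1.r17, hmid]) fun s2 e2 => ?_
    have l2 := e2 ▸ l1.set_hi (x := mid) (by omega)
    have r18 : s2.reg 18 = hi' := by simp [e2, e1]
    refine Halts.seq ((query_spec horc l2 hy (by omega) (by omega) (by omega)).imp ?_)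
    rintro s3 _ ⟨rfl, l3, hT3, e3⟩
    refine Halts.cond l3.good (fun hne => ?_) fun h0 => ?_
    · exact Halts.skip ⟨mid - lo', by omega, lo', mid, l3, by omega, hT3.1 hne, by omega, rfl⟩
    · have hT1 : ¬ TriangleAt s t α β υ y lo' mid := fun hcon => hT3.2 hcon h0
      -- A negative answer on the left half locates a triangle in the right half, with no further
      -- query.
      have hT2 : TriangleAt s t α β υ y mid hi' := (Triangle.split mid hT').resolve_left hT1
      refine Halts.assign_seq_eq l3.good (x := mid) (by simp [l3.r17]) fun s4 e4 => ?_
      have l4 := e4 ▸ l3.set_lo (x := mid) (by omega)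
      refine Halts.assign_eq l4.good (x := hi') (by simp [e4, e3, r18]) ?_
      have l5 := l4.set_hi (x := hi') (by omega)
      exact ⟨hi' - mid, by omega, mid, hi', l5, hhi', hT2, by omega, rfl⟩
  · rintro st' k m ⟨lo', hi', h', hhi', hT', hk, rfl⟩ h0
    have hgap : hi' = lo' + 1 := by
      have := Triangle.lt hT'
      by_contra hcon
      have : 1 < hi' - lo' := by omega
      simp [h'.r16, h'.r17, this] at h0
    subst hgap
    exact ⟨by omega, lo', by omega, h', hT'⟩

theorem fullQuery_spec (horc : Answers g s orc) (h : Local g V n s t G H α β υ y lo hi st)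
    (hy : y < t * t * t) (hV : s * s + 1 < V) :
    Halts V orc fullQueryCmd st fun st' k => k = 3 ∧
      Local g V n s t G H α β υ y 0 (s * s) st' ∧
      (st'.reg 19 ≠ 0 ↔ TriangleAt s t α β υ y 0 (s * s)) := by
  refine Halts.assign_seq_eq h.good (x := 0) (by simp) fun s1 e1 => ?_
  have l1 := e1 ▸ h.set_lo (x := 0) (by omega)
  refine Halts.assign_seq_eq l1.good (x := s * s) (by simp [l1.r2]) fun s2 e2 => ?_
  have l2 := e2 ▸ l1.set_hi (x := s * s) (by omega)
  refine (query_spec horc l2 hy (by omega) le_rfl (by omega)).imp ?_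
  rintro s3 _ ⟨rfl, l3, hT, -⟩
  exact ⟨rfl, l3, hT⟩

/-- The number of edges of the third kind that are left. -/
def remaining (Z : ℕ) (υ : ℕ → Bool) : ℕ := ((Finset.range Z).filter fun x => υ x = true).card

theorem remaining_update {Z x : ℕ} {υ : ℕ → Bool} (hx : x < Z) (h : υ x = true) :
    remaining Z (update υ x false) + 1 = remaining Z υ := by
  have : (Finset.range Z).filter (fun x' => update υ x false x' = true) =
      ((Finset.range Z).filter fun x => υ x = true).erase x := by
    ext x'
    by_cases hx' : x' = x <;> simp [hx', update_apply]
  rw [remaining, remaining, this]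
  exact Finset.card_erase_add_one (by simp [hx, h])

/-- Only the middle word of an entry, the left side of its statement, depends on the bit. Rewriting
it into the dummy block turns the entry into a `0` and leaves all other segments untouched. -/
theorem Env.mark (h : Env g V n s t G H α β υ st) (hGH : G ≤ H) {x : ℕ}
    (hx : x < t * t * (s * s)) {v : ℕ} (hv : v = (g.u.x + 1) * width s + x % (s * s) / s)
    (hvV : v < V) : Env g V n s t G H α β (update υ x false)
      ⟨st.reg, update st.mem (H + 6 * (t * t * (s * s)) + 3 * x + 1) v⟩ := by
  have frame : ∀ a m, (a + m ≤ H + 6 * (t * t * (s * s)) + 3 * x + 1 ∨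
      H + 6 * (t * t * (s * s)) + 3 * x + 1 < a) →
      cells (update st.mem (H + 6 * (t * t * (s * s)) + 3 * x + 1) v) a m = cells st.mem a m :=
    fun a m hd => cells_congr fun y h1 h2 => update_of_ne (by omega) _ _
  refine ⟨h.good.set_mem _ hvV, h.r1, h.r2, h.r3, h.r4, h.r5, h.r7, h.r8, h.r9, h.r10, h.r11,
    ?_, ?_, ?_, ?_⟩
  · exact (frame _ _ (by omega)).trans h.fixed
  · exact fun x' hx' => (frame _ _ (by omega)).trans (h.a x' hx')
  · exact fun x' hx' => (frame _ _ (by omega)).trans (h.b x' hx')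
  · intro x' hx'
    by_cases hxx : x' = x
    · subst hxx
      have := h.u x' hx'
      rw [cells_three] at this ⊢
      simp only [words, Slots.line, List.cons.injEq, and_true] at this ⊢
      refine ⟨?_, ?_, ?_⟩
      · rw [update_of_ne (by omega)]; exact this.1
      · simp [hv]
      · rw [update_of_ne (by omega)]; exact this.2.2
    · rw [update_of_ne hxx]
      exact (frame _ _ (by omega)).trans (h.u x' hx')

theorem mark_spec (h : Local g V n s t G H α β υ y lo hi st) (hs : 0 < s) (hy : y < t * t * t)
    (hGH : G ≤ H) (hlo : lo < s * s) (hV : g.size s < V) (hu : g.u.x + 1 < g.blocks)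
    (hυ : υ (blockU t y * (s * s) + lo) = true) :
    Halts V orc markCmd st fun st' k => k = 1 ∧
      Local g V n s t G H α β (update υ (blockU t y * (s * s) + lo) false) y lo hi st' := by
  have hx : blockU t y * (s * s) + lo < t * t * (s * s) := block_lt hlo (block_lt_of_lt hy).2.2
  obtain ⟨x, hx0⟩ : ∃ x, x = blockU t y * (s * s) + lo := ⟨_, rfl⟩
  rw [← hx0] at hx hυ ⊢
  have hdiv : x % (s * s) / s < s := Nat.div_lt_of_lt_mul (Nat.mod_lt _ (Nat.mul_pos hs hs))
  have hline := h.u x hx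
  simp only [cells_three, words, Slots.line, List.cons.injEq, hυ] at hline
  have hval := hline.2.1
  have haddr : (Expr.reg 15 + 3 * Expr.reg 16 + 1 : Expr).val st =
      H + 6 * (t * t * (s * s)) + 3 * x + 1 := by
    simp only [Expr.val_add, Expr.val_reg, Expr.val_mul, Expr.val_ofNat, h.r15, h.r16, hx0]
    ring
  refine Halts.write h.good ⟨rfl, ?_⟩
  have e : (Expr.read (Expr.reg 15 + 3 * Expr.reg 16 + 1) + Expr.reg 3 : Expr).val st =
      (g.u.x + 1) * width s + x % (s * s) / s := by
    rw [Expr.val_add, Expr.val_read, haddr, hval, Expr.val_reg, h.r3]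
    simp; ring
  have := h.toEnv.mark hGH hx e (by
    rw [e]
    exact (block_lt (by simp only [width]; omega) hu).trans hV)
  rw [haddr]
  exact ⟨this, h.r12, h.r13, h.r14, h.r15, h.r16, h.r17⟩

/-- A bound on the number of steps that lead to the removal of an edge. -/
def searchCost (s : ℕ) : ℕ := 7 * Nat.clog 2 (s * s) + 6

/-- The potential is `searchCost s` times the number of entries left in `υ`: each deletion releases
enough to pay for the search before it. What is not covered are three assignments, the first full
query and the last loop test, seven steps. `P` stands for a property of pairs that follows from
lying on a triangle with any `υ`. -/
theorem triple_spec (horc : Answers g s orc) (h : Env g V n s t G H α β υ st)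
    (hy : st.reg 12 = y) (hyt : y < t * t * t) (hs : 0 < s) (hGH : G ≤ H)
    (hV : H + 9 * (t * t * (s * s)) + 1 < V) (hVg : g.size s < V) (hu : g.u.x + 1 < g.blocks)
    (P : ℕ → Prop)
    (hP : ∀ υ z, z < s * s → TriangleAt s t α β υ y z (z + 1) → P (blockU t y * (s * s) + z)) :
    Halts V orc tripleCmd st fun st' k => ∃ υ', Env g V n s t G H α β υ' st' ∧ st'.reg 12 = y ∧
      (∀ x, υ' x = true → υ x = true) ∧ (∀ x, υ x = true → υ' x = false → P x) ∧
      ¬ TriangleAt s t α β υ' y 0 (s * s) ∧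
      k + searchCost s * remaining (t * t * (s * s)) υ' ≤
        searchCost s * remaining (t * t * (s * s)) υ + 7 := by
  obtain ⟨b1, b2, b3⟩ := block_lt_of_lt hyt
  have q1 := Nat.mul_le_mul_right (s * s) b1.le
  have q2 := Nat.mul_le_mul_right (s * s) b2.le
  have q3 := Nat.mul_le_mul_right (s * s) b3.le
  have hsV : s * s + 1 < V := by
    have : s * s ≤ t * t * (s * s) := Nat.le_mul_of_pos_left _ (by omega)
    omega
  refine Halts.assign_seq_eq h.good (x := H + 3 * (blockA t y * (s * s)))
    (by simp [h.r9, h.r2, h.r4, hy, blockA]) fun s1 e1 => ?_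
  have l1 := e1 ▸ h.set_reg 13 (by omega) (x := H + 3 * (blockA t y * (s * s))) (by omega)
  have y1 : s1.reg 12 = y := by simpa [e1] using hy
  refine Halts.assign_seq_eq l1.good
    (x := H + 3 * (t * t * (s * s)) + 3 * (blockB t y * (s * s)))
    (by simp [l1.r10, l1.r2, l1.r4, y1, blockB]) fun s2 e2 => ?_
  have l2 := e2 ▸ l1.set_reg 14 (by omega)
    (x := H + 3 * (t * t * (s * s)) + 3 * (blockB t y * (s * s))) (by omega)
  have y2 : s2.reg 12 = y := by simpa [e2] using y1
  refine Halts.assign_seq_eq l2.good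
    (x := H + 6 * (t * t * (s * s)) + 3 * (blockU t y * (s * s)))
    (by simp [l2.r11, l2.r2, l2.r4, y2, blockU]) fun s3 e3 => ?_
  have l3 := e3 ▸ l2.set_reg 15 (by omega)
    (x := H + 6 * (t * t * (s * s)) + 3 * (blockU t y * (s * s))) (by omega)
  have loc : Local g V n s t G H α β υ y (s3.reg 16) (s3.reg 17) s3 :=
    ⟨l3, by simpa [e3] using y2, by simp [e3, e2, e1], by simp [e3, e2], by simp [e3], rfl, rfl⟩
  refine Halts.seq ((fullQuery_spec horc loc hyt hsV).imp ?_)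
  rintro s4 _ ⟨rfl, l4, hT4⟩
  refine Halts.loop (fun st' k m => ∃ υ', Local g V n s t G H α β υ' y 0 (s * s) st' ∧
      (st'.reg 19 ≠ 0 ↔ TriangleAt s t α β υ' y 0 (s * s)) ∧
      (∀ x, υ' x = true → υ x = true) ∧ (∀ x, υ x = true → υ' x = false → P x) ∧
      k + searchCost s * remaining (t * t * (s * s)) υ' ≤
        searchCost s * remaining (t * t * (s * s)) υ ∧ m = remaining (t * t * (s * s)) υ')
    (m := remaining (t * t * (s * s)) υ)
    ⟨υ, l4, hT4, fun _ h => h, fun x h h' => by simp [h] at h', by omega, rfl⟩ ?_ ?_ ?_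
  · rintro st' k m ⟨υ', l, -⟩
    exact l.good
  · rintro st' k m ⟨υ', l, hT, hsub, hfound, hk, rfl⟩ hne
    refine Halts.seq ((search_spec horc l hyt le_rfl hsV (hT.1 hne)).imp ?_)
    rintro s5 k5 ⟨hk5, z, hz, l5, hT5⟩
    have hυ : υ' (blockU t y * (s * s) + z) = true := by
      obtain ⟨i, hi, k, hk, j, hj, h1, h2, h3, h4, h5⟩ := hT5
      have : j * s + i = z := by omega
      rwa [this] at h3
    refine Halts.seq ((mark_spec l5 hs hyt hGH hz hVg hu hυ).imp ?_)
    rintro s6 _ ⟨rfl, l6⟩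
    refine (fullQuery_spec horc l6 hyt hsV).imp ?_
    rintro s7 _ ⟨rfl, l7, hT7⟩
    have hx : blockU t y * (s * s) + z < t * t * (s * s) := block_lt hz b3
    have hrem := remaining_update hx hυ
    refine ⟨_, Nat.lt_of_succ_le hrem.le, _, l7, hT7, ?_, ?_, ?_, rfl⟩
    · intro x h
      by_cases hxx : x = blockU t y * (s * s) + z
      · simp [hxx] at h
      · rw [update_of_ne hxx] at h
        exact hsub x h
    · intro x h h'
      by_cases hxx : x = blockU t y * (s * s) + z
      · rw [hxx]
        exact hP υ' z hz hT5
      · rw [update_of_ne hxx] at h'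
        exact hfound x h h'
    · rw [← hrem, mul_add] at hk
      simp only [Nat.sub_zero] at hk5
      -- Besides the halvings, a deletion takes the last test of the search, the mark, three steps
      -- of the full query and the loop test; these are the six steps in `searchCost`.
      simp only [searchCost] at hk ⊢
      omega
  · rintro st' k m ⟨υ', l, hT, hsub, hfound, hk, rfl⟩ h0
    exact ⟨υ', l.toEnv, l.r12, hsub, hfound, fun hcon => hT.2 hcon h0, by omega⟩

theorem TriangleAt.mono {υ υ' : ℕ → Bool} (h : ∀ x, υ' x = true → υ x = true)
    (hT : TriangleAt s t α β υ' y lo hi) : TriangleAt s t α β υ y lo hi := by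
  obtain ⟨i, hi, k, hk, j, hj, h1, h2, h3, h4, h5⟩ := hT
  exact ⟨i, hi, k, hk, j, hj, h1, h2, h _ h3, h4, h5⟩

/-- Deletions never create triangles, so a triple that has been cleared stays clear. The potential
is shared by all triples, since a pair deleted for one of them is deleted for all; each triple adds
nine steps, seven from `triple_spec` and two for the outer loop. -/
theorem triples_spec (horc : Answers g s orc) (h : Env g V n s t G H α β (fun _ => true) st)
    (hs : 0 < s) (hGH : G ≤ H) (hV : H + 9 * (t * t * (s * s)) + 1 < V) (hVt : t * t * t < V)
    (hVg : g.size s < V) (hu : g.u.x + 1 < g.blocks) (P : ℕ → Prop)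
    (hP : ∀ υ y z, y < t * t * t → z < s * s → TriangleAt s t α β υ y z (z + 1) →
      P (blockU t y * (s * s) + z)) :
    Halts V orc triplesCmd st fun st' k => ∃ υ, Env g V n s t G H α β υ st' ∧
      (∀ x, υ x = false → P x) ∧ (∀ y < t * t * t, ¬ TriangleAt s t α β υ y 0 (s * s)) ∧
      k ≤ searchCost s * (t * t * (s * s)) + 9 * (t * t * t) + 2 := by
  refine Halts.assign_seq_eq h.good (x := 0) (by simp) fun s1 e1 => ?_
  have l1 := e1 ▸ h.set_reg 12 le_rfl (x := 0) (by omega)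
  refine Halts.loop (fun st' k m => ∃ υ y, Env g V n s t G H α β υ st' ∧ st'.reg 12 = y ∧
      y ≤ t * t * t ∧ (∀ x, υ x = false → P x) ∧
      (∀ y' < y, ¬ TriangleAt s t α β υ y' 0 (s * s)) ∧
      k + searchCost s * remaining (t * t * (s * s)) υ ≤
        searchCost s * (t * t * (s * s)) + 9 * y ∧ m = t * t * t - y)
    (m := t * t * t)
    ⟨_, 0, l1, by simp [e1], Nat.zero_le _, fun x h => by simp at h, by simp, ?_, rfl⟩ ?_ ?_ ?_
  · have : remaining (t * t * (s * s)) (fun _ => true) ≤ t * t * (s * s) := by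
      simp [remaining]
    have := Nat.mul_le_mul_left (searchCost s) this
    omega
  · rintro st' k m ⟨υ, y, l, -⟩
    exact l.good
  · rintro st' k m ⟨υ, y, l, hy, hyt, hfound, hdone, hk, rfl⟩ hne
    have hlt : y < t * t * t := by
      by_contra hcon
      apply hne
      simp [hy, l.r4]
      omega
    refine Halts.seq ((triple_spec horc l hy hlt hs hGH hV hVg hu P
      fun υ z hz => hP υ y z hlt hz).imp ?_)
    rintro s2 k2 ⟨υ', l2, hy2, hsub, hfound2, hT, hk2⟩
    refine Halts.assign_eq l2.good (x := y + 1) (by simp [hy2]) ?_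
    refine ⟨t * t * t - (y + 1), by omega, υ', y + 1, l2.set_reg 12 le_rfl (by omega), by simp,
      hlt, ?_, ?_, by omega, rfl⟩
    · intro x hx
      cases hυ : υ x
      · exact hfound x hυ
      · exact hfound2 x hυ hx
    · intro y' hy'
      rcases Nat.lt_succ_iff_lt_or_eq.1 hy' with h1 | rfl
      · exact fun hcon => hdone y' h1 (hcon.mono hsub)
      · exact hT
  · rintro st' k m ⟨υ, y, l, hy, hyt, hfound, hdone, hk, rfl⟩ h0
    have : y = t * t * t := by
      by_contra hcon
      have hlt : y < t * t * t := by omega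
      simp [hy, l.r4, hlt] at h0
    subst this
    exact ⟨υ, l, hfound, hdone, by omega⟩

end

/-! ### The construction of the tables -/

/-- The entry of a matrix at a pair of natural numbers, `false` outside. -/
def natEntry {n : ℕ} (A : Matrix (Fin n) (Fin n) Bool) (i j : ℕ) : Bool :=
  if h : i < n ∧ j < n then A ⟨i, h.1⟩ ⟨j, h.2⟩ else false

theorem natEntry_eq {n : ℕ} (A : Matrix (Fin n) (Fin n) Bool) (i j : Fin n) :
    natEntry A i j = A i j := by
  simp [natEntry]

theorem lt_of_natEntry {n : ℕ} {A : Matrix (Fin n) (Fin n) Bool} {i j : ℕ}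
    (h : natEntry A i j = true) : i < n ∧ j < n := by
  by_contra hcon
  simp [natEntry, hcon] at h

/-- The row and the column of the matrix that belong to a slot. -/
def rowOf (s t x : ℕ) : ℕ := x / (s * s) / t * s + x % (s * s) / s
def colOf (s t x : ℕ) : ℕ := x / (s * s) % t * s + x % (s * s) % s

/-- The table of a matrix. -/
def table {n : ℕ} (A : Matrix (Fin n) (Fin n) Bool) (s t x : ℕ) : Bool :=
  natEntry A (rowOf s t x) (colOf s t x)

theorem getD_flatMap {ι : Type*} {f : ι → List ℕ} {k : ℕ} (hf : ∀ i, (f i).length = k)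
    (l : List ι) {i j : ℕ} (hi : i < l.length) (hj : j < k) :
    (l.flatMap f).getD (i * k + j) 0 = (f l[i]).getD j 0 := by
  induction l generalizing i with
  | nil => simp at hi
  | cons a l ih =>
    rw [List.flatMap_cons]
    cases i with
    | zero =>
      rw [List.getD_append _ _ _ _ (by rw [hf]; omega)]
      simp
    | succ i =>
      have e : (i + 1) * k + j = (f a).length + (i * k + j) := by rw [hf]; ring
      rw [e, List.getD_append_right _ _ _ _ (Nat.le_add_right _ _), Nat.add_sub_cancel_left,
        ih (by simpa using hi)]
      simp

theorem length_entries {n : ℕ} (A : Matrix (Fin n) (Fin n) Bool) :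
    (entries A).length = n * n := by
  simp [entries, List.length_flatMap]

theorem getD_entries {n : ℕ} (A : Matrix (Fin n) (Fin n) Bool) {i j : ℕ} (hi : i < n)
    (hj : j < n) : (entries A).getD (i * n + j) 0 = (natEntry A i j).toNat := by
  rw [entries, getD_flatMap (k := n) (fun i => by simp) _ (by simpa using hi) hj]
  simp [List.getD_eq_getElem?_getD, hj, natEntry, hi]

theorem length_encodeMatrices {n : ℕ} (A B : Matrix (Fin n) (Fin n) Bool) :
    (encodeMatrices A B).length = 2 * (n * n) + 1 := by
  simp [encodeMatrices, length_entries]; ring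

theorem getD_encodeMatrices_left {n : ℕ} (A B : Matrix (Fin n) (Fin n) Bool) {i j : ℕ}
    (hi : i < n) (hj : j < n) :
    (encodeMatrices A B).getD (1 + i * n + j) 0 = (natEntry A i j).toNat := by
  have : i * n + j < n * n := block_lt hj hi
  rw [encodeMatrices, show 1 + i * n + j = i * n + j + 1 by ring, List.getD_cons_succ,
    List.getD_append _ _ _ _ (by rwa [length_entries]), getD_entries A hi hj]

theorem getD_encodeMatrices_right {n : ℕ} (A B : Matrix (Fin n) (Fin n) Bool) {i j : ℕ}
    (hi : i < n) (hj : j < n) :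
    (encodeMatrices A B).getD (1 + n * n + i * n + j) 0 = (natEntry B i j).toNat := by
  rw [encodeMatrices, show 1 + n * n + i * n + j = n * n + (i * n + j) + 1 by ring,
    List.getD_cons_succ, List.getD_append_right _ _ _ _ (by rw [length_entries]; omega),
    length_entries, Nat.add_sub_cancel_left, getD_entries B hi hj]

theorem initState_good {n V : ℕ} (A B : Matrix (Fin n) (Fin n) Bool) (hn : n < V)
    (hV : 2 * (n * n) + 1 < V) : (initState (encodeMatrices A B)).Good V := by
  have hmem : ∀ v ∈ encodeMatrices A B, v < V := by
    have key : ∀ (A : Matrix (Fin n) (Fin n) Bool), ∀ v ∈ entries A, v < V := by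
      intro A v hv
      simp only [entries, List.mem_flatMap, List.mem_map] at hv
      obtain ⟨i, -, j, -, rfl⟩ := hv
      have := Bool.toNat_le (A i j)
      omega
    intro v hv
    simp only [encodeMatrices, List.mem_cons, List.mem_append] at hv
    rcases hv with rfl | hv | hv
    · exact hn
    · exact key A v hv
    · exact key B v hv
  constructor
  · intro r
    simp only [initState, length_encodeMatrices]
    split_ifs <;> omega
  · intro a
    simp only [initState]
    rcases lt_or_ge a (encodeMatrices A B).length with h | h
    · rw [List.getD_eq_getElem _ _ h]
      exact hmem _ (List.getElem_mem h)
    · rw [List.getD_eq_default _ _ h]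
      omega

abbrev nReg : Expr := Expr.reg 1
abbrev wReg : Expr := Expr.reg 3
abbrev xReg : Expr := Expr.reg 6

def Family.exprs (f : Family) : List Expr :=
  [Expr.const f.kind.code, Expr.const f.xb * wReg + (Expr.const f.xo + xReg),
    Expr.const f.yb * wReg + (Expr.const f.yo + xReg)]

def Family.cmd (f : Family) : Cmd :=
  emitLoop (Expr.const f.cs * sReg + Expr.const f.cc) f.exprs

def familiesCmd : List Family → Cmd
  | [] => Cmd.skip
  | f :: fs => Cmd.seq f.cmd (familiesCmd fs)

def Gadget.header (g : Gadget) : List Expr :=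
  [Expr.const g.blocks * wReg,
    Expr.const g.pb * wReg + (Expr.const g.ps * sReg + Expr.const g.pc),
    Expr.const g.qb * wReg + (Expr.const g.qs * sReg + Expr.const g.qc)]

def rowExpr : Expr := xReg / (sReg * sReg) / tReg * sReg + xReg % (sReg * sReg) / sReg
def colExpr : Expr := xReg / (sReg * sReg) % tReg * sReg + xReg % (sReg * sReg) % sReg

/-- The entry for the current slot of the matrix that starts at the address `off`. -/
def bitExpr (off : Expr) : Expr :=
  Expr.read (off + rowExpr * nReg + colExpr) * (rowExpr.lt nReg * colExpr.lt nReg)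

def Slots.exprs (d : Slots) (bit : Expr) : List Expr :=
  [Expr.const d.kind.code,
    (Expr.const d.x + (1 - bit)) * wReg + xReg % (sReg * sReg) / sReg,
    Expr.const d.y * wReg + xReg % (sReg * sReg) % sReg]

def Slots.cmd (d : Slots) (bit : Expr) : Cmd :=
  emitLoop (tReg * tReg * (sReg * sReg)) (d.exprs bit)

theorem Kind.code_le (κ : Kind) : κ.code ≤ 3 := by cases κ <;> simp [Kind.code]

theorem length_words (ℓ : Line) : (words ℓ).length = 3 := rfl

/-- The number of statements in a list of families. -/
def familiesCount (fs : List Family) (s : ℕ) : ℕ := (fs.map fun f => f.count s).sum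

theorem length_families (fs : List Family) (s : ℕ) :
    ((fs.flatMap fun f => f.lines s).flatMap words).length = 3 * familiesCount fs s := by
  induction fs with
  | nil => rfl
  | cons f fs ih =>
    rw [List.flatMap_cons, List.flatMap_append, List.length_append, ih]
    simp [familiesCount, Family.lines, List.length_flatMap, length_words, Function.comp_def]
    ring

section

variable {g : Gadget} {T : Set Kind} {V n s t : ℕ} {st : State} {orc : List ℕ → ℕ → Prop}

theorem families_spec (hg : g.WellFormed T) (hV3 : 3 < V) (hVg : g.size s < V) (fs : List Family)
    (hfs : ∀ f ∈ fs, f ∈ g.fams) (hst : st.Good V) (h2 : st.reg 2 = s) (h3 : st.reg 3 = width s)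
    (hend : st.reg 5 + 3 * familiesCount fs s < V) :
    Halts V orc (familiesCmd fs) st fun st' k =>
      Emitted V ((fs.flatMap fun f => f.lines s).flatMap words) st st' ∧
      k ≤ 9 * familiesCount fs s + 2 * fs.length + 1 := by
  induction fs generalizing st with
  | nil => exact Halts.skip ⟨.nil hst, by simp [familiesCount]⟩
  | cons f fs ih =>
    have hcount : familiesCount (f :: fs) s = f.count s + familiesCount fs s := by
      simp [familiesCount]
    rw [hcount] at hend ⊢
    have hf := hfs f List.mem_cons_self
    have hwords : (f.lines s).flatMap words =
        (List.range (f.count s)).flatMap fun x => words (f.line s x) := by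
      simp [Family.lines, List.flatMap_map]
    refine Halts.seq ((emitLoop_spec (es := f.exprs) hst (f.count s)
      (fun x => words (f.line s x)) (by simp [Family.exprs]; omega) (by omega) ?_ ?_ ?_).imp ?_)
    · intro s' hr _
      simp [hr, h2, Family.count]
    · intro x _ s' hr h6 _
      simp [Family.exprs, words, Family.line, hr, h3, h6]
    · intro x hx v hv
      obtain ⟨i1, i2⟩ := hg.family_index_lt hf hx
      obtain ⟨-, -, -, h3, h4, -⟩ := hg.fams f hf
      have l1 := (block_lt i1 h3).trans hVg
      have l2 := (block_lt i2 h4).trans hVg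
      have l3 := f.kind.code_le
      simp only [words, Family.line, List.mem_cons, List.not_mem_nil, or_false] at hv
      rcases hv with rfl | rfl | rfl
      · omega
      · exact l1
      · exact l2
    · rintro s1 k1 ⟨e1, hk1⟩
      rw [← hwords] at e1
      have hlen : ((f.lines s).flatMap words).length = 3 * f.count s := by
        rw [hwords, length_flatMap_range _ fun x _ => length_words _]; ring
      have hp := e1.ptr
      refine (ih (fun f hf => hfs f (List.mem_cons_of_mem _ hf)) e1.good
        ((e1.reg 2 (by omega) (by omega)).trans h2)
        ((e1.reg 3 (by omega) (by omega)).trans h3) (by omega)).imp ?_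
      rintro s2 k2 ⟨e2, hk2⟩
      refine ⟨?_, ?_⟩
      · rw [List.flatMap_cons, List.flatMap_append]
        exact e1.trans e2
      · simp only [Family.exprs, List.length_cons, List.length_nil] at hk1 ⊢
        omega

theorem cells_of_cells_flatMap {mem : ℕ → ℕ} {p c : ℕ} {f : ℕ → List ℕ}
    (hf : ∀ x, (f x).length = 3) (h : cells mem p (c * 3) = (List.range c).flatMap f) :
    ∀ x < c, cells mem (p + 3 * x) 3 = f x := by
  induction c with
  | zero => intro x hx; omega
  | succ c ih =>
    rw [add_mul, one_mul, cells_add, List.range_succ, List.flatMap_append,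
      List.flatMap_singleton] at h
    have hl := length_flatMap_range c (f := f) (k := 3) fun x _ => hf x
    obtain ⟨h1, h2⟩ := List.append_inj h (by rw [length_cells, hl])
    intro x hx
    rcases Nat.lt_succ_iff_lt_or_eq.1 hx with hx | rfl
    · exact ih h1 x hx
    · rwa [mul_comm 3 x]

theorem slots_spec {d : Slots} {bit : Expr} {b : ℕ → Bool} (hs : 0 < s)
    (hV3 : 3 < V) (hVg : g.size s < V) (hd : d.x + 1 < g.blocks ∧ d.y < g.blocks)
    (hst : st.Good V) (h2 : st.reg 2 = s) (h3 : st.reg 3 = width s) (h4 : st.reg 4 = t)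
    (hend : st.reg 5 + 3 * (t * t * (s * s)) < V)
    (hbit : ∀ x < t * t * (s * s), ∀ s' : State, (∀ r, r ≠ 5 → r ≠ 6 → s'.reg r = st.reg r) →
      s'.reg 6 = x → (∀ a < st.reg 5, s'.mem a = st.mem a) → bit.val s' = (b x).toNat) :
    Halts V orc (d.cmd bit) st fun st' k => st'.Good V ∧
      (∀ r, r ≠ 5 → r ≠ 6 → st'.reg r = st.reg r) ∧
      st'.reg 5 = st.reg 5 + 3 * (t * t * (s * s)) ∧ (∀ a < st.reg 5, st'.mem a = st.mem a) ∧
      (∀ x < t * t * (s * s), cells st'.mem (st.reg 5 + 3 * x) 3 =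
        words (d.line s (b x) (x % (s * s)))) ∧ k ≤ 9 * (t * t * (s * s)) + 2 := by
  refine (emitLoop_spec (es := d.exprs bit) hst (t * t * (s * s))
    (fun x => words (d.line s (b x) (x % (s * s)))) (by simp [Slots.exprs]; omega) (by omega)
    ?_ ?_ ?_).imp ?_
  · intro s' hr _
    simp [hr, h2, h4]
  · intro x hx s' hr h6 hm
    simp [Slots.exprs, words, Slots.line, hbit x hx s' hr h6 hm, hr, h2, h3, h6]
  · intro x hx v hv
    have a1 : x % (s * s) / s < width s := by
      have := Nat.div_lt_of_lt_mul (Nat.mod_lt x (Nat.mul_pos hs hs)); simp only [width]; omega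
    have a2 : x % (s * s) % s < width s := by
      have := Nat.mod_lt (x % (s * s)) hs; simp only [width]; omega
    have l1 := (block_lt a1 (show d.x + (1 - (b x).toNat) < g.blocks by omega)).trans hVg
    have l2 := (block_lt a2 hd.2).trans hVg
    have l3 := d.kind.code_le
    simp only [words, Slots.line, List.mem_cons, List.not_mem_nil, or_false] at hv
    rcases hv with rfl | rfl | rfl
    · omega
    · exact l1
    · exact l2
  · rintro s' k ⟨e, hk⟩
    have hl := length_flatMap_range (t * t * (s * s))
      (f := fun x => words (d.line s (b x) (x % (s * s)))) fun x _ => length_words _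
    have hp := e.ptr
    have hc := e.cells
    rw [hl] at hp hc
    refine ⟨e.good, e.reg, by omega, e.mem, cells_of_cells_flatMap (fun x => length_words _) hc, ?_⟩
    simp only [Slots.exprs, List.length_cons, List.length_nil] at hk
    omega

/-- The blocks overhang the matrix because `t * s > n`. The address read there may hold anything,
but the two comparisons multiply the result by `0`, which pads the matrix with zeros. -/
theorem bit_spec {A : Matrix (Fin n) (Fin n) Bool} {mem : ℕ → ℕ} {off : Expr} {o p : ℕ}
    (hp : o + n * n ≤ p) (hA : ∀ i < n, ∀ j < n, mem (o + i * n + j) = (natEntry A i j).toNat)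
    {x : ℕ} {s' : State} (h1 : s'.reg 1 = n) (h2 : s'.reg 2 = s) (h4 : s'.reg 4 = t)
    (h6 : s'.reg 6 = x) (hm : ∀ a < p, s'.mem a = mem a) (ho : off.val s' = o) :
    (bitExpr off).val s' = (table A s t x).toNat := by
  have hr : rowExpr.val s' = rowOf s t x := by simp [rowExpr, rowOf, h2, h4, h6]
  have hc : colExpr.val s' = colOf s t x := by simp [colExpr, colOf, h2, h4, h6]
  simp only [bitExpr, Expr.val_mul, Expr.val_read, Expr.val_add, Expr.val_lt', Expr.val_reg, hr,
    hc, h1, ho, table]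
  by_cases hlt : rowOf s t x < n ∧ colOf s t x < n
  · have : rowOf s t x * n + colOf s t x < n * n := block_lt hlt.2 hlt.1
    rw [hm _ (by omega), hA _ hlt.1 _ hlt.2]
    simp [hlt.1, hlt.2]
  · rw [natEntry, dif_neg hlt]
    rw [not_and_or] at hlt
    rcases hlt with h | h <;> simp [h]

/-- The construction of all tables. -/
def buildCmd (g : Gadget) : Cmd :=
  Cmd.seq (emit g.header) (Cmd.seq (familiesCmd g.fams)
    (Cmd.seq (Cmd.assign 8 (Expr.reg 5 - Expr.reg 7)) (Cmd.seq (Cmd.assign 9 (Expr.reg 5))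
      (Cmd.seq (g.a.cmd (bitExpr 1)) (Cmd.seq (Cmd.assign 10 (Expr.reg 5))
        (Cmd.seq (g.b.cmd (bitExpr (1 + nReg * nReg))) (Cmd.seq (Cmd.assign 11 (Expr.reg 5))
          (g.u.cmd 1))))))))

-- All output goes to or above the growing pointer in register `5`, so the input below `G` and every
-- area completed before stay intact. The areas are the fixed part from `G` to `H` and three tables
-- of `3 * (t * t * (s * s))` words each; the third starts with all entries `1`.
set_option maxHeartbeats 1000000 in
theorem build_spec (hg : g.WellFormed T) (A B : Matrix (Fin n) (Fin n) Bool) {G H : ℕ}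
    (hs : 0 < s) (hst : st.Good V)
    (h1 : st.reg 1 = n) (h2 : st.reg 2 = s) (h3 : st.reg 3 = width s)
    (h4 : st.reg 4 = t) (h5 : st.reg 5 = G) (h7 : st.reg 7 = G) (hG : 1 + n * n + n * n ≤ G)
    (hA : ∀ i < n, ∀ j < n, st.mem (1 + i * n + j) = (natEntry A i j).toNat)
    (hB : ∀ i < n, ∀ j < n, st.mem (1 + n * n + i * n + j) = (natEntry B i j).toNat)
    (hH : H = G + 3 + 3 * familiesCount g.fams s) (hVg : g.size s < V)
    (hV : H + 9 * (t * t * (s * s)) + 1 < V) :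
    Halts V orc (buildCmd g) st fun st' k =>
      Env g V n s t G H (table A s t) (table B s t) (fun _ => true) st' ∧
      k ≤ 27 * (t * t * (s * s)) + 9 * familiesCount g.fams s + 2 * g.fams.length + 18 := by
  have hp := hg.p_lt_size (s := s)
  have hq := hg.q_lt_size (s := s)
  refine Halts.seq ((emit_spec (es := g.header) (vs := [g.size s, g.p s, g.q s]) hst G h5.ge
    (by simp; omega) ?_ ?_).imp ?_)
  · simp; omega
  · intro s' hr _
    simp [Gadget.header, hr, h2, h3, Gadget.size, Gadget.p, Gadget.q]
  rintro s1 _ ⟨e1, -, rfl⟩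
  have p1 := e1.ptr
  simp only [List.length_cons, List.length_nil] at p1
  refine Halts.seq ((families_spec hg (by omega) hVg g.fams (fun _ h => h) e1.good
    ((e1.reg 2 (by omega) (by omega)).trans h2) ((e1.reg 3 (by omega) (by omega)).trans h3)
    (by omega)).imp ?_)
  rintro s2 k2 ⟨e2, hk2⟩
  have p2 := e2.ptr
  rw [length_families] at p2
  have r2 : ∀ r, r ≠ 5 → r ≠ 6 → s2.reg r = st.reg r := fun r a b =>
    (e2.reg r a b).trans (e1.reg r a b)
  have m2 : ∀ a < G, s2.mem a = st.mem a := fun a ha =>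
    (e2.mem a (by omega)).trans (e1.mem a (by omega))
  have c2 : cells s2.mem G (H - G) = g.words s := by
    have := (e1.trans e2).cells
    have hl : H - G = ([g.size s, g.p s, g.q s] ++
        (g.fams.flatMap fun f => f.lines s).flatMap words).length := by
      rw [List.length_append, length_families]
      simp only [List.length_cons, List.length_nil]
      omega
    rw [hl, ← h5, this]
    rfl
  have hp2 : s2.reg 5 = H := by omega
  clear e1 p1
  refine Halts.assign_seq_eq e2.good (x := H - G)
    (by simp [hp2, r2 7 (by omega) (by omega), h7]) fun s3 e3 => ?_
  have g3 : s3.Good V := e3 ▸ e2.good.set_reg 8 (by omega)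
  have p3 : s3.reg 5 = H := by simp [e3, hp2]
  refine Halts.assign_seq_eq g3 (x := H) (by simp [p3]) fun s4 e4 => ?_
  have g4 : s4.Good V := e4 ▸ g3.set_reg 9 (by omega)
  have r4 : ∀ r < 5, s4.reg r = st.reg r := fun r hr => by
    simp only [e4, e3]
    rw [update_of_ne (by omega), update_of_ne (by omega)]
    exact r2 r (by omega) (by omega)
  have r47 : s4.reg 7 = G := by simp [e4, e3, r2, h7]
  have r48 : s4.reg 8 = H - G := by simp [e4, e3]
  have r49 : s4.reg 9 = H := by simp [e4]
  have p4 : s4.reg 5 = H := by simp [e4, p3]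
  have m4 : s4.mem = s2.mem := by simp [e4, e3]
  clear e3 e4 g3 p3
  refine Halts.seq ((slots_spec (b := table A s t) hs (by omega) hVg
    ⟨(hg.slots g.a (by simp)).1, (hg.slots g.a (by simp)).2.1⟩ g4
    ((r4 2 (by omega)).trans h2) ((r4 3 (by omega)).trans h3) ((r4 4 (by omega)).trans h4)
    (by omega) ?_).imp ?_)
  · intro x hx s' hr h6 hm
    refine bit_spec (mem := st.mem) (o := 1) (p := G) (by omega) hA
      ((hr 1 (by omega) (by omega)).trans ((r4 1 (by omega)).trans h1))
      ((hr 2 (by omega) (by omega)).trans ((r4 2 (by omega)).trans h2))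
      ((hr 4 (by omega) (by omega)).trans ((r4 4 (by omega)).trans h4)) h6 (fun a ha => ?_) rfl
    rw [hm a (by omega), m4, m2 a ha]
  rintro s5 k5 ⟨g5, r5, p5, m5, c5, hk5⟩
  rw [p4] at p5 m5 c5
  refine Halts.assign_seq_eq g5 (x := H + 3 * (t * t * (s * s))) (by simp [p5]) fun s6 e6 => ?_
  have g6 : s6.Good V := e6 ▸ g5.set_reg 10 (by omega)
  have r6 : ∀ r < 10, r ≠ 5 → r ≠ 6 → s6.reg r = s4.reg r := fun r hr a b => by
    simp only [e6]
    rw [update_of_ne (by omega)]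
    exact r5 r a b
  have r610 : s6.reg 10 = H + 3 * (t * t * (s * s)) := by simp [e6]
  have p6 : s6.reg 5 = H + 3 * (t * t * (s * s)) := by simp [e6, p5]
  have m6 : s6.mem = s5.mem := by simp [e6]
  clear e6
  have b1 : s6.reg 1 = n := (r6 1 (by omega) (by omega) (by omega)).trans ((r4 1 (by omega)).trans h1)
  have b2 : s6.reg 2 = s := (r6 2 (by omega) (by omega) (by omega)).trans ((r4 2 (by omega)).trans h2)
  have b3 : s6.reg 3 = width s :=
    (r6 3 (by omega) (by omega) (by omega)).trans ((r4 3 (by omega)).trans h3)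
  have b4 : s6.reg 4 = t := (r6 4 (by omega) (by omega) (by omega)).trans ((r4 4 (by omega)).trans h4)
  refine Halts.seq ((slots_spec (b := table B s t) hs (by omega) hVg
    ⟨(hg.slots g.b (by simp)).1, (hg.slots g.b (by simp)).2.1⟩ g6 b2 b3 b4 (by omega) ?_).imp ?_)
  · intro x hx s' hr h6 hm
    have a1 := (hr 1 (by omega) (by omega)).trans b1
    refine bit_spec (mem := st.mem) (o := 1 + n * n) (p := G) (by omega) hB a1
      ((hr 2 (by omega) (by omega)).trans b2) ((hr 4 (by omega) (by omega)).trans b4) h6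
      (fun a ha => ?_) (by simp [a1])
    rw [hm a (by omega), m6, m5 a (by omega), m4, m2 a ha]
  rintro s7 k7 ⟨g7, r7, p7, m7, c7, hk7⟩
  rw [p6] at p7 m7 c7
  refine Halts.assign_seq_eq g7 (x := H + 6 * (t * t * (s * s))) (by simp [p7]; omega)
    fun s8 e8 => ?_
  have g8 : s8.Good V := e8 ▸ g7.set_reg 11 (by omega)
  have r8 : ∀ r < 11, r ≠ 5 → r ≠ 6 → s8.reg r = s6.reg r := fun r hr a b => by
    simp only [e8]
    rw [update_of_ne (by omega)]
    exact r7 r a b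
  have r811 : s8.reg 11 = H + 6 * (t * t * (s * s)) := by simp [e8]
  have p8 : s8.reg 5 = H + 6 * (t * t * (s * s)) := by simp [e8, p7]; omega
  have m8 : s8.mem = s7.mem := by simp [e8]
  clear e8
  refine (slots_spec (b := fun _ => true) hs (by omega) hVg
    ⟨(hg.slots g.u (by simp)).1, (hg.slots g.u (by simp)).2.1⟩ g8
    ((r8 2 (by omega) (by omega) (by omega)).trans b2)
    ((r8 3 (by omega) (by omega) (by omega)).trans b3)
    ((r8 4 (by omega) (by omega) (by omega)).trans b4) (by omega) ?_).imp ?_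
  · intro x hx s' hr h6 hm
    rfl
  rintro s9 k9 ⟨g9, r9, p9, m9, c9, hk9⟩
  rw [p8] at p9 m9 c9
  have q9 : ∀ r < 11, r ≠ 5 → r ≠ 6 → s9.reg r = s6.reg r := fun r hr a b =>
    (r9 r a b).trans (r8 r hr a b)
  have q96 : ∀ r < 10, r ≠ 5 → r ≠ 6 → s9.reg r = s4.reg r := fun r hr a b =>
    (q9 r (by omega) a b).trans (r6 r hr a b)
  have n7 : ∀ a < H + 6 * (t * t * (s * s)), s9.mem a = s7.mem a := fun a ha => by
    rw [m9 a ha, m8]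
  have n5 : ∀ a < H + 3 * (t * t * (s * s)), s9.mem a = s5.mem a := fun a ha => by
    rw [n7 a (by omega), m7 a ha, m6]
  have n2 : ∀ a < H, s9.mem a = s2.mem a := fun a ha => by
    rw [n5 a (by omega), m5 a ha, m4]
  refine ⟨⟨g9, ?_, ?_, ?_, ?_, ?_, ?_, ?_, ?_, ?_, ?_, ?_, ?_, ?_, ?_⟩, ?_⟩
  · exact (q9 1 (by omega) (by omega) (by omega)).trans b1
  · exact (q9 2 (by omega) (by omega) (by omega)).trans b2
  · exact (q9 3 (by omega) (by omega) (by omega)).trans b3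
  · exact (q9 4 (by omega) (by omega) (by omega)).trans b4
  · omega
  · exact (q96 7 (by omega) (by omega) (by omega)).trans r47
  · exact (q96 8 (by omega) (by omega) (by omega)).trans r48
  · exact (q96 9 (by omega) (by omega) (by omega)).trans r49
  · exact (q9 10 (by omega) (by omega) (by omega)).trans r610
  · exact (r9 11 (by omega) (by omega)).trans r811
  · exact (cells_congr fun a h1 h2 => n2 a (by omega)).trans c2
  · exact fun x hx => (cells_congr fun a h1 h2 => n5 a (by omega)).trans (c5 x hx)
  · exact fun x hx => (cells_congr fun a h1 h2 => n7 a (by omega)).trans (c7 x hx)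
  · exact c9
  · simp only [List.length_cons, List.length_nil]
    omega

end

/-! ### The reduction -/

/-- The computation of the block length and of the number of blocks. -/
def setupCmd : Cmd :=
  Cmd.seq (Cmd.assign 1 (Expr.read 0)) (Cmd.seq (Cmd.assign 5 (Expr.reg 0))
    (Cmd.seq (Cmd.loop (Expr.lt ((sReg + 1) * (sReg + 1) * (sReg + 1)) (nReg + 1))
        (Cmd.assign 2 (sReg + 1)))
      (Cmd.seq (Cmd.assign 3 (sReg + 4)) (Cmd.seq (Cmd.assign 4 (nReg / sReg + 1))
        (Cmd.assign 7 (Expr.reg 5))))))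

/-- The cube root is found by counting up while the next cube is at most `n`; the linear time this
takes is negligible against `n ^ 2`. -/
theorem setup_spec {V n s : ℕ} {orc : List ℕ → ℕ → Prop} (A B : Matrix (Fin n) (Fin n) Bool)
    (h1 : s * s * s ≤ n) (h2 : n < (s + 1) * (s + 1) * (s + 1)) (hV : 2 * (n * n) + 1 < V)
    (hn : n + 4 < V) :
    Halts V orc setupCmd (initState (encodeMatrices A B)) fun st k => st.Good V ∧
      st.mem = (initState (encodeMatrices A B)).mem ∧ st.reg 1 = n ∧ st.reg 2 = s ∧
      st.reg 3 = width s ∧ st.reg 4 = n / s + 1 ∧ st.reg 5 = 2 * (n * n) + 1 ∧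
      st.reg 7 = 2 * (n * n) + 1 ∧ k ≤ 2 * n + 6 := by
  have hsn : s ≤ n := by
    rcases Nat.eq_zero_or_pos s with rfl | hs
    · omega
    · exact (Nat.le_mul_of_pos_left s (Nat.mul_pos hs hs)).trans h1
  have hdn : n / s ≤ n := Nat.div_le_self _ _
  have g0 := initState_good A B (V := V) (by omega) hV
  have i0 : (initState (encodeMatrices A B)).reg 0 = 2 * (n * n) + 1 := by
    simp [initState, length_encodeMatrices]
  have i2 : (initState (encodeMatrices A B)).reg 2 = 0 := by simp [initState]
  have im : (initState (encodeMatrices A B)).mem 0 = n := by simp [initState, encodeMatrices]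
  generalize initState (encodeMatrices A B) = st at *
  refine Halts.assign_seq_eq g0 (x := n) (by simp [im]) fun s1 e1 => ?_
  have g1 : s1.Good V := e1 ▸ g0.set_reg 1 (by omega)
  refine Halts.assign_seq_eq g1 (x := 2 * (n * n) + 1) (by simp [e1, i0]) fun s2 e2 => ?_
  have g2 : s2.Good V := e2 ▸ g1.set_reg 5 (by omega)
  refine Halts.seq (Halts.loop (fun st' k m => st'.Good V ∧ st'.mem = st.mem ∧ st'.reg 1 = n ∧
    st'.reg 5 = 2 * (n * n) + 1 ∧ ∃ r, st'.reg 2 = r ∧ r ≤ s ∧ k = 2 * r ∧ m = s - r) (m := s)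
    ⟨g2, by simp [e2, e1], by simp [e2, e1], by simp [e2], 0, by simp [e2, e1, i2], by omega,
      rfl, rfl⟩ ?_ ?_ ?_)
  · rintro st' k m ⟨h, -⟩
    exact h
  · rintro st' k m ⟨g3, hm, r1, r5, r, r2, hr, rfl, rfl⟩ hne
    have hlt : r < s := by
      by_contra hcon
      obtain rfl : r = s := by omega
      apply hne
      simp [r1, r2]
      omega
    refine Halts.assign_eq g3 (x := r + 1) (by simp [r2]) ?_
    exact ⟨s - (r + 1), by omega, g3.set_reg 2 (by omega), hm, by simpa using r1, by simpa using r5,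
      r + 1, by simp, hlt, by ring, rfl⟩
  · rintro s3 k m ⟨g3, hm, r1, r5, r, r2, hr, rfl, rfl⟩ h0
    obtain rfl : r = s := by
      by_contra hcon
      have hlt : r + 1 ≤ s := by omega
      have : (r + 1) * (r + 1) * (r + 1) ≤ s * s * s :=
        Nat.mul_le_mul (Nat.mul_le_mul hlt hlt) hlt
      have : (r + 1) * (r + 1) * (r + 1) < n + 1 := by omega
      simp [r1, r2, this] at h0
    refine Halts.assign_seq_eq g3 (x := width r) (by simp [r2]) fun s4 e4 => ?_
    have g4 : s4.Good V := e4 ▸ g3.set_reg 3 (by simp only [width]; omega)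
    refine Halts.assign_seq_eq g4 (x := n / r + 1) (by simp [e4, r1, r2]) fun s5 e5 => ?_
    have g5 : s5.Good V := e5 ▸ g4.set_reg 4 (by omega)
    refine Halts.assign_eq g5 (x := 2 * (n * n) + 1) (by simp [e5, e4, r5]) ?_
    exact ⟨g5.set_reg 7 (by omega), by simp [e5, e4, hm], by simp [e5, e4, r1],
      by simp [e5, e4, r2], by simp [e5, e4], by simp [e5], by simp [e5, e4, r5], by simp,
      by omega⟩

/-- The slot of the third table for a pair of indices. -/
def slotOf (s t i j : ℕ) : ℕ := (j / s * t + i / s) * (s * s) + (j % s * s + i % s)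

/-- The left side stored for an entry exceeds its original value exactly when it has been moved to
the dummy block, so this comparison reads off whether the pair was deleted. -/
def outputExpr (g : Gadget) : Expr :=
  Expr.lt (Expr.const g.u.x * wReg + xReg % nReg % sReg)
    (Expr.read (Expr.reg 11 + 3 * ((xReg % nReg / sReg * tReg + xReg / nReg / sReg) *
      (sReg * sReg) + (xReg % nReg % sReg * sReg + xReg / nReg % sReg)) + 1))

def outputCmd (g : Gadget) : Cmd :=
  Cmd.seq (Cmd.assign 0 (Expr.reg 5)) (emitLoop (nReg * nReg) [outputExpr g])

theorem slotOf_lt {s t i j : ℕ} (hs : 0 < s) (hi : i / s < t) (hj : j / s < t) :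
    slotOf s t i j < t * t * (s * s) :=
  block_lt (block_lt (Nat.mod_lt _ hs) (Nat.mod_lt _ hs)) (block_lt hi hj)

theorem output_spec {g : Gadget} {V n s t G H : ℕ} {α β υ : ℕ → Bool} {st : State}
    {orc : List ℕ → ℕ → Prop} (h : Env g V n s t G H α β υ st) (hs : 0 < s)
    (ht : ∀ i < n, i / s < t) (hV : H + 9 * (t * t * (s * s)) + n * n + 1 < V) :
    Halts V orc (outputCmd g) st fun st' k =>
      (∀ i < n, ∀ j < n, st'.mem (st'.reg 0 + i * n + j) = (!υ (slotOf s t i j)).toNat) ∧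
      k ≤ 5 * (n * n) + 3 := by
  refine Halts.assign_seq_eq h.good (x := H + 9 * (t * t * (s * s))) (by simp [h.r5])
    fun s1 e1 => ?_
  have g1 : s1.Good V := e1 ▸ h.good.set_reg 0 (by omega)
  have r1 : ∀ r, r ≠ 0 → s1.reg r = st.reg r := fun r hr => by simp [e1, hr]
  have p1 : s1.reg 5 = H + 9 * (t * t * (s * s)) := (r1 5 (by omega)).trans h.r5
  have m1 : s1.mem = st.mem := by simp [e1]
  have r10 : s1.reg 0 = H + 9 * (t * t * (s * s)) := by simp [e1]
  have n1 := (r1 1 (by omega)).trans h.r1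
  have n2 := (r1 2 (by omega)).trans h.r2
  have n3 := (r1 3 (by omega)).trans h.r3
  have n4 := (r1 4 (by omega)).trans h.r4
  have n11 := (r1 11 (by omega)).trans h.r11
  clear e1 r1
  refine (emitLoop_spec (es := [outputExpr g]) g1 (n * n)
    (fun x => [(!υ (slotOf s t (x / n) (x % n))).toNat]) (by simp; omega) (by omega) ?_ ?_ ?_).imp ?_
  · intro s' hr _
    simp [hr, n1]
  · intro x hx s' hr h6 hm
    have hn : 0 < n := Nat.pos_of_ne_zero fun h => by simp [h] at hx
    have hi : x / n < n := Nat.div_lt_of_lt_mul hx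
    have hj : x % n < n := Nat.mod_lt _ hn
    have hslot := slotOf_lt (i := x / n) (j := x % n) hs (ht _ hi) (ht _ hj)
    have hu := h.u _ hslot
    simp only [cells_three, words, Slots.line, List.cons.injEq] at hu
    have hu := hu.2.1
    have e : slotOf s t (x / n) (x % n) % (s * s) / s = x % n % s := by
      rw [slotOf, block_mod (block_lt (Nat.mod_lt _ hs) (Nat.mod_lt _ hs)),
        block_div (Nat.mod_lt _ hs)]
    rw [e] at hu
    have hread : s'.mem (H + 6 * (t * t * (s * s)) + 3 * slotOf s t (x / n) (x % n) + 1) =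
        (g.u.x + (1 - (υ (slotOf s t (x / n) (x % n))).toNat)) * width s + x % n % s := by
      rw [hm _ (by rw [p1]; omega), m1, hu]
    simp only [slotOf] at hread
    have hw : 0 < width s := by simp [width]
    simp only [List.map_cons, List.map_nil, outputExpr, Expr.val_lt', Expr.val_add, Expr.val_mul,
      Expr.val_const, Expr.val_reg, Expr.val_mod, Expr.val_div, Expr.val_read, Expr.val_ofNat,
      hr _ (show (1 : ℕ) ≠ 5 by omega) (by omega), hr _ (show (2 : ℕ) ≠ 5 by omega) (by omega),
      hr _ (show (3 : ℕ) ≠ 5 by omega) (by omega), hr _ (show (4 : ℕ) ≠ 5 by omega) (by omega),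
      hr _ (show (11 : ℕ) ≠ 5 by omega) (by omega), n1, n2, n3, n4, n11, h6, hread, slotOf]
    cases υ ((x % n / s * t + x / n / s) * (s * s) + (x % n % s * s + x / n % s))
    · simp [add_mul, hw]
    · simp
  · intro x _ v hv
    have := Bool.toNat_le (!υ (slotOf s t (x / n) (x % n)))
    simp only [List.mem_singleton] at hv
    omega
  · rintro s' k ⟨e, hk⟩
    refine ⟨?_, ?_⟩
    · intro i hi j hj
      have hx : i * n + j < n * n := block_lt hj hi
      have hc := e.cells
      rw [length_flatMap_range (k := 1) _ fun x _ => rfl, mul_one] at hc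
      rw [← List.map_eq_flatMap, DemandPT.cells, List.map_inj_left] at hc
      have := hc (i * n + j) (List.mem_range.2 hx)
      rw [block_div hj, block_mod hj, p1, ← add_assoc] at this
      rw [e.reg 0 (by omega) (by omega), r10, this]
    · simp only [List.length_cons, List.length_nil] at hk
      omega

theorem rowOf_block {s t b b' i k : ℕ} (hb : b' < t) (hi : i < s) (hk : k < s) :
    rowOf s t ((b * t + b') * (s * s) + (i * s + k)) = b * s + i := by
  rw [rowOf, block_div (block_lt hk hi), block_mod (block_lt hk hi), block_div hb, block_div hk]

theorem colOf_block {s t b b' i k : ℕ} (hb : b' < t) (hi : i < s) (hk : k < s) :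
    colOf s t ((b * t + b') * (s * s) + (i * s + k)) = b' * s + k := by
  rw [colOf, block_div (block_lt hk hi), block_mod (block_lt hk hi), block_mod hb, block_mod hk]

/-- The reduction of matrix multiplication to queries. -/
def reductionCmd (g : Gadget) : Cmd :=
  Cmd.seq setupCmd (Cmd.seq (buildCmd g) (Cmd.seq triplesCmd (outputCmd g)))

/-- A pair is deleted only if a witness for its product entry was seen, and a surviving pair with a
witness would form a triangle in the triple of its blocks, where none is left. -/
theorem reduction_spec {g : Gadget} {T : Set Kind} (hg : g.WellFormed T) {V n s t H : ℕ}
    {orc : List ℕ → ℕ → Prop} (horc : Answers g s orc) (A B : Matrix (Fin n) (Fin n) Bool)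
    (hn : 0 < n) (h1 : s * s * s ≤ n) (h2 : n < (s + 1) * (s + 1) * (s + 1)) (ht : t = n / s + 1)
    (hH : H = 2 * (n * n) + 4 + 3 * familiesCount g.fams s) (hVg : g.size s < V)
    (hVt : t * t * t < V) (hn4 : n + 4 < V)
    (hV : H + 9 * (t * t * (s * s)) + n * n + 1 < V) :
    Halts V orc (reductionCmd g) (initState (encodeMatrices A B)) fun st k =>
      (∀ i j : Fin n, st.mem (st.reg 0 + (i : ℕ) * n + (j : ℕ)) = (boolMul A B i j).toNat) ∧
      k ≤ (searchCost s + 27) * (t * t * (s * s)) + 9 * (t * t * t) +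
        9 * familiesCount g.fams s + 2 * g.fams.length + 5 * (n * n) + 2 * n + 29 := by
  have hs : 0 < s := by
    by_contra hcon
    obtain rfl : s = 0 := by omega
    omega
  have hlt : ∀ i < n, i / s < t := fun i hi => by
    have := Nat.div_le_div_right (c := s) hi.le
    omega
  refine Halts.seq ((setup_spec A B h1 h2 (by omega) hn4).imp ?_)
  rintro s1 k1 ⟨g1, m1, r1, r2, r3, r4, r5, r7, hk1⟩
  refine Halts.seq ((build_spec hg A B hs g1 r1 r2 r3 (r4.trans ht.symm) r5 r7 (by omega)
    ?_ ?_ (H := H) (by omega) hVg (by omega)).imp ?_)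
  · intro i hi j hj
    rw [m1]
    exact getD_encodeMatrices_left A B hi hj
  · intro i hi j hj
    rw [m1]
    exact getD_encodeMatrices_right A B hi hj
  rintro s2 k2 ⟨e2, hk2⟩
  refine Halts.seq ((triples_spec horc e2 hs (by omega) (by omega) hVt hVg
    (hg.slots g.u (by simp)).1 (fun x => ∃ k, natEntry A (colOf s t x) k = true ∧
      natEntry B k (rowOf s t x) = true) ?_).imp ?_)
  · rintro υ y z hy hz ⟨i, hi, k, hk, j, hj, hA, hB, -, hz1, hz2⟩
    obtain rfl : j * s + i = z := by omega
    have ht0 : 0 < t := ht ▸ Nat.succ_pos _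
    have b1 : y / t % t < t := Nat.mod_lt _ ht0
    have b2 : y % t < t := Nat.mod_lt _ ht0
    have b3 : y / (t * t) < t := Nat.div_lt_of_lt_mul hy
    simp only [table, blockA, blockB] at hA hB
    rw [rowOf_block b1 hi hk, colOf_block b1 hi hk] at hA
    rw [rowOf_block b2 hk hj, colOf_block b2 hk hj] at hB
    refine ⟨y / t % t * s + k, ?_⟩
    rw [blockU, rowOf_block b3 hj hi, colOf_block b3 hj hi]
    exact ⟨hA, hB⟩
  rintro s3 k3 ⟨υ, e3, hfound, hdone, hk3⟩
  refine (output_spec e3 hs hlt hV).imp ?_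
  rintro s4 k4 ⟨hout, hk4⟩
  refine ⟨fun i j => ?_, ?_⟩
  · rw [hout i i.2 j j.2]
    congr 1
    have hi := hlt i i.2
    have hj := hlt j j.2
    have ms : ∀ a, a % s < s := fun a => Nat.mod_lt _ hs
    rw [boolMul, ← Bool.decide_coe (!υ _), decide_eq_decide, Bool.not_eq_true']
    constructor
    · intro hυ
      obtain ⟨k, hA, hB⟩ := hfound _ hυ
      rw [slotOf, colOf_block hi (ms _) (ms _)] at hA
      rw [slotOf, rowOf_block hi (ms _) (ms _)] at hB
      rw [mul_comm, Nat.div_add_mod] at hA hB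
      have hk := (lt_of_natEntry hA).2
      exact ⟨⟨k, hk⟩, (natEntry_eq A i ⟨k, hk⟩) ▸ hA, (natEntry_eq B ⟨k, hk⟩ j) ▸ hB⟩
    · rintro ⟨k, hA, hB⟩
      have hk := hlt k k.2
      cases hυ : υ (slotOf s t i j)
      · rfl
      exfalso
      -- Triples are numbered in base `t` by the blocks of `i`, `k` and `j`.
      obtain ⟨y, hy⟩ : ∃ y, y = (i / s * t + k / s) * t + j / s := ⟨_, rfl⟩
      have y1 : y / (t * t) = i / s := by
        rw [← Nat.div_div_eq_div_mul, hy, block_div hj, block_div hk]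
      have y2 : y / t % t = k / s := by rw [hy, block_div hj, block_mod hk]
      have y3 : y % t = j / s := by rw [hy, block_mod hj]
      have hyt : y < t * t * t := by
        rw [hy]
        exact block_lt hj (block_lt hk hi)
      have em : ∀ a, a / s * s + a % s = a := fun a => by rw [mul_comm]; exact Nat.div_add_mod a s
      refine hdone y hyt ⟨i % s, ms _, k % s, ms _, j % s, ms _, ?_, ?_, ?_, Nat.zero_le _,
        block_lt (ms _) (ms _)⟩
      · simp only [table, blockA, y1, y2]
        rw [rowOf_block hk (ms _) (ms _), colOf_block hk (ms _) (ms _), em, em, natEntry_eq, hA]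
      · simp only [table, blockB, y2, y3]
        rw [rowOf_block hj (ms _) (ms _), colOf_block hj (ms _) (ms _), em, em, natEntry_eq, hB]
      · simp only [blockU, y1, y3]
        exact hυ
  · rw [add_mul]
    omega

/-! ### Tameness -/

theorem emit_tame {es : List Expr} (h : ∀ e ∈ es, e.Tame) : (emit es).Tame := by
  induction es with
  | nil => trivial
  | cons e es ih =>
    exact ⟨⟨trivial, h e List.mem_cons_self⟩, ⟨trivial, trivial, trivial⟩,
      ih fun e he => h e (List.mem_cons_of_mem _ he)⟩

theorem emitLoop_tame {cnt : Expr} {es : List Expr} (hc : cnt.Tame) (h : ∀ e ∈ es, e.Tame) :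
    (emitLoop cnt es).Tame := by
  simp [emitLoop, Cmd.Tame, emit_tame h, hc]

theorem familiesCmd_tame (fs : List Family) : (familiesCmd fs).Tame := by
  induction fs with
  | nil => trivial
  | cons f fs ih => exact ⟨emitLoop_tame (by simp) (by simp [Family.exprs]), ih⟩

theorem bitExpr_tame {off : Expr} (h : off.Tame) : (bitExpr off).Tame := by
  simp [bitExpr, rowExpr, colExpr, h]

theorem Slots.cmd_tame (d : Slots) {bit : Expr} (h : bit.Tame) : (d.cmd bit).Tame :=
  emitLoop_tame (by simp) (by simp [Slots.exprs, h])

theorem queryCmd_tame : queryCmd.Tame := by simp [queryCmd, Cmd.Tame]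

theorem reductionCmd_tame (g : Gadget) : (reductionCmd g).Tame := by
  refine ⟨?_, ⟨emit_tame (by simp [Gadget.header]), familiesCmd_tame _, by simp [Cmd.Tame],
    by simp [Cmd.Tame], Slots.cmd_tame _ (bitExpr_tame (by simp)), by simp [Cmd.Tame],
    Slots.cmd_tame _ (bitExpr_tame (by simp)), by simp [Cmd.Tame], Slots.cmd_tame _ (by simp)⟩,
    ?_, by simp [Cmd.Tame], emitLoop_tame (by simp) (by simp [outputExpr])⟩
  · simp [setupCmd, Cmd.Tame]
  · simp [triplesCmd, tripleCmd, fullQueryCmd, searchCmd, markCmd, Cmd.Tame, queryCmd_tame]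

/-! ### The resources -/

theorem exists_cube_root (n : ℕ) : ∃ s, s * s * s ≤ n ∧ n < (s + 1) * (s + 1) * (s + 1) := by
  induction n with
  | zero => exact ⟨0, by simp⟩
  | succ n ih =>
    obtain ⟨s, h1, h2⟩ := ih
    rcases Nat.lt_or_ge (n + 1) ((s + 1) * (s + 1) * (s + 1)) with h | h
    · exact ⟨s, by omega, h⟩
    · refine ⟨s + 1, h, ?_⟩
      have : (s + 1) * (s + 1) * (s + 1) < (s + 1 + 1) * (s + 1 + 1) * (s + 1 + 1) :=
        Nat.mul_lt_mul'' (Nat.mul_lt_mul'' (by omega) (by omega)) (by omega)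
      omega

theorem familiesCount_le {g : Gadget} {T : Set Kind} (hg : g.WellFormed T) (s : ℕ) :
    familiesCount g.fams s ≤ g.fams.length * (s + 4) := by
  rw [familiesCount, ← List.length_map (f := fun f : Family => f.count s), ← smul_eq_mul]
  refine List.sum_le_card_nsmul _ _ ?_
  intro x hx
  obtain ⟨f, hf, rfl⟩ := List.mem_map.1 hx
  obtain ⟨h1, h2, -⟩ := hg.fams f hf
  simp only [Family.count]
  nlinarith

theorem searchCost_le {s n : ℕ} (h : s * s ≤ n) : searchCost s ≤ 13 * (Nat.log 2 n + 1) := by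
  have h1 : Nat.clog 2 (s * s) ≤ Nat.log 2 (s * s) + 1 :=
    Nat.clog_le_of_le_pow (Nat.lt_pow_succ_log_self (by omega) _).le
  have h2 : Nat.log 2 (s * s) ≤ Nat.log 2 n := Nat.log_mono_right h
  simp only [searchCost]
  omega

structure Sizes (n s t : ℕ) : Prop where
  s_pos : 0 < s
  s_le : s ≤ n
  sq_le : s * s ≤ n
  slots_le : t * t * (s * s) ≤ 4 * (n * n)
  triples_le : t * t * t ≤ 64 * (n * n)

/-- Everything rests on `t * s ≤ 2 * n` and `n ≤ 8 * s ^ 3`: the tables have `(t * s) ^ 2` entries,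
and `t ^ 3` is about `n ^ 3 / s ^ 3`. -/
theorem sizes {n s t : ℕ} (hn : 0 < n) (h1 : s * s * s ≤ n)
    (h2 : n < (s + 1) * (s + 1) * (s + 1)) (ht : t = n / s + 1) : Sizes n s t := by
  have hs : 0 < s := by
    by_contra hcon
    obtain rfl : s = 0 := by omega
    omega
  have hsq : s * s ≤ n := (Nat.le_mul_of_pos_right _ hs).trans h1
  have hsn : s ≤ n := (Nat.le_mul_of_pos_left s hs).trans hsq
  have hts : t * s ≤ 2 * n := by
    rw [ht, add_mul, one_mul]
    have := Nat.div_mul_le_self n s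
    omega
  refine ⟨hs, hsn, hsq, ?_, ?_⟩
  · calc t * t * (s * s) = (t * s) * (t * s) := by ring
      _ ≤ (2 * n) * (2 * n) := Nat.mul_le_mul hts hts
      _ = _ := by ring
  · have h8 : n ≤ 8 * (s * s * s) := by
      have : (s + 1) * (s + 1) * (s + 1) ≤ (2 * s) * (2 * s) * (2 * s) :=
        Nat.mul_le_mul (Nat.mul_le_mul (by omega) (by omega)) (by omega)
      have e : (2 * s) * (2 * s) * (2 * s) = 8 * (s * s * s) := by ring
      omega
    -- Multiplying by `n ≤ 8 * s ^ 3` turns `t ^ 3` into `(t * s) ^ 3` without division.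
    refine Nat.le_of_mul_le_mul_right ?_ hn
    calc t * t * t * n ≤ t * t * t * (8 * (s * s * s)) := Nat.mul_le_mul_left _ h8
      _ = 8 * ((t * s) * (t * s) * (t * s)) := by ring
      _ ≤ 8 * ((2 * n) * (2 * n) * (2 * n)) :=
        Nat.mul_le_mul_left _ (Nat.mul_le_mul (Nat.mul_le_mul hts hts) hts)
      _ = _ := by ring

theorem steps_le {g : Gadget} {T : Set Kind} (hg : g.WellFormed T) {n s t k : ℕ} (hn : 0 < n)
    (h : Sizes n s t)
    (hk : k ≤ (searchCost s + 27) * (t * t * (s * s)) + 9 * (t * t * t) +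
      9 * familiesCount g.fams s + 2 * g.fams.length + 5 * (n * n) + 2 * n + 29) :
    k ≤ (1000 + 50 * g.fams.length) * n ^ 2 * (Nat.log 2 n + 1) ^ 1 := by
  have hF := familiesCount_le hg s
  have hC := searchCost_le h.sq_le
  obtain ⟨L, hL⟩ : ∃ L, L = Nat.log 2 n + 1 := ⟨_, rfl⟩
  obtain ⟨f, hf⟩ : ∃ f, f = g.fams.length := ⟨_, rfl⟩
  rw [← hL] at hC ⊢
  rw [← hf] at hF hk ⊢
  have hL1 : 1 ≤ L := by omega
  have hnn : n ≤ n * n := Nat.le_mul_of_pos_left _ hn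
  have a1 : (searchCost s + 27) * (t * t * (s * s)) ≤ (40 * L) * (4 * (n * n)) :=
    Nat.mul_le_mul (by omega) h.slots_le
  have hF' : familiesCount g.fams s ≤ f * (5 * (n * n)) :=
    hF.trans (Nat.mul_le_mul_left _ (by have := h.s_le; omega))
  have a2 := h.triples_le
  have a3 : f ≤ f * (n * n) := Nat.le_mul_of_pos_right _ (by omega)
  have a4 : n * n ≤ n * n * L := Nat.le_mul_of_pos_right _ hL1
  have a5 : f * (n * n) ≤ f * (n * n) * L := Nat.le_mul_of_pos_right _ hL1
  have e : (1000 + 50 * f) * n ^ 2 * L ^ 1 = 1000 * (n * n * L) + 50 * (f * (n * n) * L) := by ring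
  have e1 : (40 * L) * (4 * (n * n)) = 160 * (n * n * L) := by ring
  have e2 : f * (5 * (n * n)) = 5 * (f * (n * n)) := by ring
  rw [e]
  omega

/-- A polynomial bound on the words that occur. -/
theorem space_lt {g : Gadget} {T : Set Kind} (hg : g.WellFormed T) {n s t : ℕ} (hn : 0 < n)
    (h : Sizes n s t) {V : ℕ}
    (hV : V = (n + 2) ^ (2 + (200 + 15 * g.fams.length + 5 * g.blocks))) :
    2 * (n * n) + 4 + 3 * familiesCount g.fams s + 9 * (t * t * (s * s)) + n * n + 1 < V ∧
      t * t * t < V ∧ g.size s < V ∧ n + 4 < V ∧ 2 ≤ V := by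
  obtain ⟨c, hc⟩ : ∃ c, c = 200 + 15 * g.fams.length + 5 * g.blocks := ⟨_, rfl⟩
  have hnn : n ≤ n * n := Nat.le_mul_of_pos_left _ hn
  have hF : familiesCount g.fams s ≤ g.fams.length * (5 * (n * n)) :=
    (familiesCount_le hg s).trans (Nat.mul_le_mul_left _ (by have := h.s_le; omega))
  have hsize : g.size s ≤ g.blocks * (5 * (n * n)) :=
    Nat.mul_le_mul_left _ (by have := h.s_le; simp only [width]; omega)
  -- All quantities are at most a constant times `n ^ 2`; the constant `c` itself is absorbed by `(n
  -- + 2) ^ c`.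
  have key : c * (n * n) < V := by
    calc c * (n * n) < (n + 2) ^ c * ((n + 2) * (n + 2)) := by
          refine Nat.mul_lt_mul'' (Nat.lt_pow_self (by omega)) ?_
          exact Nat.mul_lt_mul'' (by omega) (by omega)
      _ = V := by rw [hV, ← hc, pow_add]; ring
  have e : c * (n * n) = 200 * (n * n) + 3 * (g.fams.length * (5 * (n * n))) +
      g.blocks * (5 * (n * n)) := by rw [hc]; ring
  have a1 := h.slots_le
  have a2 := h.triples_le
  refine ⟨?_, ?_, ?_, ?_, ?_⟩ <;> omega

open Real in
/-- The total time, if a call on `N` variables takes `K * N ^ (3 - δ)` steps. -/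
theorem total_time_le (δ K : ℝ) (hδ : 0 < δ) (c b : ℕ) : ∃ C : ℝ, ∀ n s N k v : ℕ, 0 < n → 0 < N →
    s * s * s ≤ n → N ≤ b * s → k ≤ c * n ^ 2 * (Nat.log 2 n + 1) ^ 1 →
    (v : ℝ) ≤ K * (N : ℝ) ^ (3 - δ) →
    ((k + k * v : ℕ) : ℝ) ≤ C * (n : ℝ) ^ (3 - min δ 1 / 6) := by
  -- Capping `δ` at `1` keeps `3 - d` and `1 - d / 3` positive, as the monotonicity of the powers
  -- requires.
  obtain ⟨d, hd⟩ : ∃ d, d = min δ 1 := ⟨_, rfl⟩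
  have hd0 : 0 < d := by rw [hd]; exact lt_min hδ one_pos
  have hd1 : d ≤ 1 := by rw [hd]; exact min_le_right _ _
  have hdδ : d ≤ δ := by rw [hd]; exact min_le_left _ _
  rw [← hd]
  refine ⟨c * (1 / (log 2 * (d / 6)) + 1) * (1 + |K| * (b : ℝ) ^ (3 - d)), ?_⟩
  intro n s N k v hn hN hs hNs hk hv
  have hn1 : (1 : ℝ) ≤ n := by exact_mod_cast hn
  have hN1 : (1 : ℝ) ≤ N := by exact_mod_cast hN
  have hn0 : (0 : ℝ) < n := by linarith
  have hlog2 : 0 < log 2 := log_pos one_lt_two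
  -- Half of the saving `d / 3` is spent on the logarithm.
  have hlog : ((Nat.log 2 n + 1 : ℕ) : ℝ) ≤ (1 / (log 2 * (d / 6)) + 1) * (n : ℝ) ^ (d / 6) := by
    have h1 : (Nat.log 2 n : ℝ) ≤ log n / log 2 := by
      rw [le_div_iff₀ hlog2, ← log_pow]
      refine log_le_log (by positivity) ?_
      exact_mod_cast Nat.pow_log_le_self 2 (by omega)
    have h2 : log n ≤ (n : ℝ) ^ (d / 6) / (d / 6) := log_le_rpow_div hn0.le (by positivity)
    have h3 : 1 ≤ (n : ℝ) ^ (d / 6) := one_le_rpow hn1 (by positivity)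
    have h4 : log n / log 2 ≤ (n : ℝ) ^ (d / 6) / (d / 6) / log 2 := by gcongr
    have h5 : (n : ℝ) ^ (d / 6) / (d / 6) / log 2 =
        1 / (log 2 * (d / 6)) * (n : ℝ) ^ (d / 6) := by field_simp
    push_cast
    linarith
  have hsn : (s : ℝ) ≤ (n : ℝ) ^ (1 / 3 : ℝ) := by
    have : ((s : ℝ) ^ (3 : ℕ)) ≤ n := by
      have : ((s * s * s : ℕ) : ℝ) ≤ n := by exact_mod_cast hs
      push_cast at this
      linarith [show (s : ℝ) ^ 3 = s * s * s by ring]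
    calc (s : ℝ) = ((s : ℝ) ^ (3 : ℕ)) ^ (1 / 3 : ℝ) := by
          rw [← rpow_natCast, ← rpow_mul (by positivity)]; norm_num
      _ ≤ _ := rpow_le_rpow (by positivity) this (by positivity)
  have hv' : (v : ℝ) ≤ |K| * (b : ℝ) ^ (3 - d) * (n : ℝ) ^ (1 - d / 3) := by
    have h1 : (N : ℝ) ^ (3 - δ) ≤ (N : ℝ) ^ (3 - d) := rpow_le_rpow_of_exponent_le hN1 (by linarith)
    have h2 : (N : ℝ) ^ (3 - d) ≤ ((b : ℝ) * s) ^ (3 - d) :=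
      rpow_le_rpow (by positivity) (by exact_mod_cast hNs) (by linarith)
    have h3 : ((b : ℝ) * s) ^ (3 - d) = (b : ℝ) ^ (3 - d) * (s : ℝ) ^ (3 - d) :=
      mul_rpow (by positivity) (by positivity)
    have h4 : (s : ℝ) ^ (3 - d) ≤ (n : ℝ) ^ (1 - d / 3) := by
      calc (s : ℝ) ^ (3 - d) ≤ ((n : ℝ) ^ (1 / 3 : ℝ)) ^ (3 - d) :=
            rpow_le_rpow (by positivity) hsn (by linarith)
        _ = _ := by rw [← rpow_mul hn0.le]; congr 1; ring
    calc (v : ℝ) ≤ K * (N : ℝ) ^ (3 - δ) := hv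
      _ ≤ |K| * (N : ℝ) ^ (3 - δ) := by gcongr; exact le_abs_self K
      _ ≤ |K| * ((b : ℝ) ^ (3 - d) * (n : ℝ) ^ (1 - d / 3)) := by
        refine mul_le_mul_of_nonneg_left ?_ (abs_nonneg K)
        refine h1.trans (h2.trans (h3.le.trans ?_))
        gcongr
      _ = _ := by ring
  have hone : 1 ≤ (n : ℝ) ^ (1 - d / 3) := one_le_rpow hn1 (by linarith)
  have hk' : (k : ℝ) ≤ c * (n : ℝ) ^ (2 : ℝ) *
      ((1 / (log 2 * (d / 6)) + 1) * (n : ℝ) ^ (d / 6)) := by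
    have : (k : ℝ) ≤ ((c * n ^ 2 * (Nat.log 2 n + 1) ^ 1 : ℕ) : ℝ) := by exact_mod_cast hk
    refine this.trans ?_
    rw [pow_one, Nat.cast_mul]
    refine mul_le_mul ?_ hlog (by positivity) (by positivity)
    push_cast
    rw [rpow_two]
  -- The exponents add up to `2 + d / 6 + (1 - d / 3) = 3 - d / 6`.
  calc ((k + k * v : ℕ) : ℝ) = k * (1 + v) := by push_cast; ring
    _ ≤ (c * (n : ℝ) ^ (2 : ℝ) * ((1 / (log 2 * (d / 6)) + 1) * (n : ℝ) ^ (d / 6))) *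
        ((1 + |K| * (b : ℝ) ^ (3 - d)) * (n : ℝ) ^ (1 - d / 3)) := by
      refine mul_le_mul hk' ?_ (by positivity) (by positivity)
      linarith
    _ = c * (1 / (log 2 * (d / 6)) + 1) * (1 + |K| * (b : ℝ) ^ (3 - d)) *
        ((n : ℝ) ^ (2 : ℝ) * (n : ℝ) ^ (d / 6) * (n : ℝ) ^ (1 - d / 3)) := by ring
    _ = _ := by
      rw [← rpow_add hn0, ← rpow_add hn0]
      congr 2
      ring

/-- The given algorithm plays the role of the oracle: by `Gadget.exists_query` each triangle query
is the encoding of a genuine program with exactly the statement types in `T`. -/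
theorem multipliesMatrices_reduction {g : Gadget} {T : Set Kind} (hg : g.WellFormed T)
    (hd : g.Detects) {δ : ℝ} (hδ : 0 < δ) {Q : Algorithm} (hQ : SolvesDemand T Q δ) :
    MultipliesMatrices (reductionCmd g :: Q) (1000 + 50 * g.fams.length) 1 (min δ 1 / 6) := by
  classical
  obtain ⟨K, kQ, hQ⟩ := hQ
  obtain ⟨C, hC⟩ := total_time_le δ K hδ (1000 + 50 * g.fams.length) (5 * g.blocks)
  obtain ⟨κ, hκ⟩ : ∃ κ, κ = 2 + (200 + 15 * g.fams.length + 5 * g.blocks) := ⟨_, rfl⟩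
  -- The first summand of the exponent provides words for the reduction, the second for the called
  -- algorithm on `g.size s` variables.
  refine ⟨C, κ * (reductionCmd g).deg + (κ + 1) * kQ, ?_⟩
  intro n hn A B
  obtain ⟨s, h1, h2⟩ := exists_cube_root n
  have hsz := sizes hn h1 h2 rfl
  have hs := hsz.s_pos
  obtain ⟨V1, V2, V3, V4, V5⟩ := space_lt hg hn hsz rfl
  rw [← hκ] at V1 V2 V3 V4 V5
  obtain ⟨W, hW⟩ : ∃ W, W = (n + 2) ^ (κ * (reductionCmd g).deg + (κ + 1) * kQ) := ⟨_, rfl⟩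
  have hW1 : ((n + 2) ^ κ) ^ (reductionCmd g).deg ≤ W := by
    rw [hW, ← pow_mul]
    exact Nat.pow_le_pow_right (by omega) (Nat.le_add_right _ _)
  have hW2 : (g.size s + 2) ^ kQ ≤ W := by
    have : g.size s + 2 ≤ (n + 2) ^ (κ + 1) := by
      rw [pow_succ]
      nlinarith
    calc _ ≤ ((n + 2) ^ (κ + 1)) ^ kQ := Nat.pow_le_pow_left this _
      _ = (n + 2) ^ ((κ + 1) * kQ) := (pow_mul _ _ _).symm
      _ ≤ W := hW ▸ Nat.pow_le_pow_right (by omega) (Nat.le_add_left _ _)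
  have hN : 0 < g.size s := (Nat.zero_le _).trans_lt (hg.p_lt_size (s := s))
  rw [← hW]
  -- All queries have the same number of variables, so one bound `v₀` serves for all calls.
  obtain ⟨v₀, hv₀⟩ : ∃ v₀, v₀ = ⌊K * (g.size s : ℝ) ^ (3 - δ)⌋₊ := ⟨_, rfl⟩
  have hans : Answers g s fun x y => ∃ v ≤ v₀, ∃ s' t' u', Runs Q W x s' t' u' ∧ s'.reg 0 = y ∧
      v = t' + u' := by
    intro α β υ lo m hm
    obtain ⟨P, p, q, hP, hpt, henc⟩ := Gadget.exists_query hg hd hs α β υ hm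
    obtain ⟨s', t', u', hrun, hyes, hno, htime⟩ := hQ _ P hP p q
    rw [← Gadget.encode_lines, ← henc]
    refine ⟨t' + u', ?_, s', t', u', hrun.mono hW2, ?_, rfl⟩
    · rw [hv₀]
      exact Nat.le_floor htime
    · by_cases hT : Triangle s α β υ lo (lo + m)
      · rw [if_pos hT]
        exact hyes (hpt.2 hT)
      · rw [if_neg hT]
        exact hno fun h => hT (hpt.1 h)
  -- The floor is below its argument only if that is nonnegative; a run on any one program shows
  -- this, as it takes a nonnegative number of steps.
  have hK : (v₀ : ℝ) ≤ K * (g.size s : ℝ) ^ (3 - δ) := by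
    obtain ⟨P, p, q, hP, -⟩ := Gadget.exists_query hg hd hs (fun _ => false) (fun _ => false)
      (fun _ => false) (lo := 0) (m := 0) (by omega)
    obtain ⟨s', t', u', -, -, -, htime⟩ := hQ _ P hP p q
    rw [hv₀]
    exact Nat.floor_le ((Nat.cast_nonneg _).trans htime)
  obtain ⟨s', k, hex, hout, hk⟩ := reduction_spec hg hans A B hn h1 h2 rfl rfl V3 V2 V4 V1
  obtain ⟨u, hu, hexec⟩ := hex.exec V5 (fun x y h => h) (reductionCmd_tame g) hW1
  have hk' := steps_le hg hn hsz hk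
  refine ⟨s', k, u, hexec, hout, hk', ?_⟩
  refine le_trans ?_ (hC n s (g.size s) k v₀ hn hN h1 ?_ hk' hK)
  · exact_mod_cast Nat.add_le_add_left hu k
  · simp only [Gadget.size, width]
    nlinarith

end DemandPT

theorem corollary2 (T : Set DemandPT.Kind) (haddr : DemandPT.Kind.addr ∈ T)
    (hderef : DemandPT.Kind.load ∈ T ∨ DemandPT.Kind.store ∈ T) :
    ∃ (R : DemandPT.Cmd) (c e : ℕ), ∀ δ : ℝ, 0 < δ → ∃ δ' : ℝ, 0 < δ' ∧
      ∀ Q : DemandPT.Algorithm, DemandPT.SolvesDemand T Q δ →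
        DemandPT.MultipliesMatrices (R :: Q) c e δ' := by
  obtain ⟨g, hg, hd⟩ := DemandPT.exists_gadget haddr hderef
  exact ⟨DemandPT.reductionCmd g, 1000 + 50 * g.fams.length, 1, fun δ hδ =>
    ⟨min δ 1 / 6, by positivity, fun Q hQ => DemandPT.multipliesMatrices_reduction hg hd hδ hQ⟩⟩
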